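/- **Setting.** Let $d\ge 1$ and let $\Omega\subset\mathbb R^{d+1}$ be the closure of an open, connected, bounded $C^2$-domain, with boundary $\Gamma=\partial\Omega$. Here $C^2$ means: there are $\delta,M>0$ and a finite cover of $\Gamma$ by connected open sets $U_1,\dots,U_J$ such that every $x\in\Omega$ with $\operatorname{dist}(x,\Gamma)<\delta$ lies in some $U_j$ with $\operatorname{dist}(x,\partial U_j)>\delta$, and such that, for each $j$, in a suitable Cartesian coordinate system the set $\Omega\cap U_j$ is given in $U_j$ by $\xi_{d+1}\le f_j(\xi_1,\dots,\xi_d)$ with $f_j\in C^2(\mathbb R^d)$ and $\max_{i,k}\|\partial_i\partial_kf_j\|_\infty\le M$. For $0<p<\infty$, $L^p(\Omega)$ is the Lebesgue space of real-valued functions, with its (quasi-)norm; $L^\infty(\Omega)$ means $C(\Omega)$, and for $p=\infty$ all $L^p$-norms below are uniform norms (suprema). Let $r\ge1$ be an integer. For $h\in\mathbb R^{d+1}$ put $$\triangle_h^r(f,\Omega,\xi)=\sum_{j=0}^r(-1)^{r+j}\binom rj f(\xi+jh)\ \text{ if the segment } [\xi,\xi+rh]\subset\Omega,\qquad \triangle_h^r(f,\Omega,\xi)=0\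 \text{ otherwise,}$$ and $\widetilde\triangle{}_h^r(f,\Omega,\xi)=\triangle_h^r(f,\Omega,\xi-\tfrac r2h)$. **Ivanov's average modulus.** Let $\rho_\Omega(\xi,\eta)=\|\xi-\eta\|+\bigl|\sqrt{\operatorname{dist}(\xi,\Gamma)}-\sqrt{\operatorname{dist}(\eta,\Gamma)}\bigr|$ and $U(\xi,t)=\{\eta\in\Omega:\rho_\Omega(\xi,\eta)\le t\}$. For $0<q\le p\le\infty$ let $\tau_r(f,t)_{p,q}=\bigl\|w_r(f,\cdot,t)_q\bigr\|_{L^p(\Omega)}$, where $$w_r(f,\xi,t)_q=\Bigl(\frac1{|U(\xi,t)|}\int_{U(\xi,t)}\bigl|\triangle^r_{(\eta-\xi)/r}(f,\Omega,\xi)\bigr|^q\,d\eta\Bigr)^{1/q}\ (q<\infty),\qquad w_r(f,\xi,t)_\infty=\sup_{\eta\in U(\xi,t)}\bigl|\triangle^r_{(\eta-\xi)/r}(f,\Omega,\xi)\bigr|.$$ **Domains of special type.** An upward $x_{d+1}$-domain with base size $b>0$ and parameter $L\ge1$ is a set $G=\zeta+\{(x,y): x\in(-b,b)^d,\ g(x)-Lb<y\le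 g(x)\}$ with $\zeta\in\mathbb R^{d+1}$ and $g\in C^2(\mathbb R^d)$; put $$\partial'G=\zeta+\{(x,g(x)):x\in(-b,b)^d\},\qquad \partial'G^*=\zeta+\{(x,g(x)):x\in(-2b,2b)^d\},$$ $$G^*=\zeta+\Bigl\{(x,y):x\in(-2b,2b)^d,\ \min_{[-2b,2b]^d}g-4Lb<y\le g(x)\Bigr\}.$$ Upward $x_j$-domains, and downward $x_j$-domains, are the images of these under the interchange of the $j$-th and the last coordinate, followed in the downward case by $x_j\mapsto-x_j$; the sets $\partial'G$, $\partial'G^*$, $G^*$ are transported accordingly. All these sets are called domains of special type. Such a $G\subset\Omega$ is attached to $\Gamma$ if $\overline{G^*}\cap\Gamma=\overline{\partial'G^*}$ and $G^*=Q\cap\Omega$ for some open box $Q$ with sides parallel to the axes. Fix a finite cover $G_1,\dots,G_m\subset\Omega$ of $\Gamma$ by domains of special type attached to $\Gamma$, each with $L\ge4\sqrt d\max_{[-2b,2b]^d}\|\nabla g\|+1$. **The new modulus.** Let $A_0>1$ and $0<t\le1$. For a unit vector $e$ let $\varphi_\Omega(e,\xi)=\max\{\sqrt{l_1l_2}:l_1,l_2\ge0,\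 [\xi-l_1e,\xi+l_2e]\subset\Omega\}$. For an upward $x_{d+1}$-domain $G\subset\Omega$ with $\zeta=0$ let $$\widetilde\omega{}_G^r(f,t;A_0)_p=\sup_{0<s\le t,\ 1\le j\le d}\Bigl(\int_{G^t}\frac1{(bt)^d}\int_{I_x(tb)}\bigl|\triangle^r_{s\xi_j(u)}(f,\Omega,(x,y))\bigr|^p\,du\,dx\,dy\Bigr)^{1/p}$$ (with suprema over $G^t$ and $I_x(tb)$ in place of the integrals if $p=\infty$), where $G^t=\{\xi\in G:\operatorname{dist}(\xi,\partial'G)\ge A_0t^2\}$, $I_x(tb)=\{u\in(-b,b)^d:\|u-x\|\le tb\}$ and $\xi_j(u)=e_j+\partial_jg(u)e_{d+1}$; for other domains $G\subset\Omega$ of special type define it by transport ($\widetilde\omega{}^r_G(f,t;A_0)_p=\widetilde\omega{}^r_{T(G)}(f\circ T^{-1},t;A_0)_p$, with $\Omega$ replaced by $T(\Omega)$, $T$ being the composition of the reflections and the translation above that takes $G$ to an upward $x_{d+1}$-domain with $\zeta=0$). Put $$\omega_\Omega^r(f,t;A_0)_p=\max_{1\le j\le d+1}\ \sup_{|h|\le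 t}\Bigl\|\widetilde\triangle{}^r_{h\varphi_\Omega(e_j,\cdot)e_j}(f,\Omega,\cdot)\Bigr\|_{L^p(\Omega)}+\sum_{i=1}^{m}\widetilde\omega{}^r_{G_i}(f,t;A_0)_p.$$ **Theorem.** There is a constant $c_0>1$, depending only on $\Omega$, $G_1,\dots,G_m$ and $r$, such that for every $A_0>1$ and all $0<q\le p\le\infty$ there is a constant $C<\infty$ with $$\omega_\Omega^r(f,t;A_0)_p\le C\,\tau_r(f,c_0t)_{p,q}\qquad\text{for all } f\in L^p(\Omega)\text{ and all } 0<t\le1 ;$$ in particular $C$ is independent of $f$ and $t$. -/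

import Mathlib

open MeasureTheory
open scoped ENNReal NNReal

/-- The ambient Euclidean space `ℝ^{d+1}`, with the Euclidean norm. -/
abbrev Ambient (d : ℕ) : Type := EuclideanSpace ℝ (Fin (d + 1))

/-- The base space `ℝ^d`; points of `ℝ^{d+1}` are written `(x, y)`, `x ∈ ℝ^d`, `y ∈ ℝ`. -/
abbrev Base (d : ℕ) : Type := EuclideanSpace ℝ (Fin d)

/-- The first `d` coordinates `x` of a point `(x, y)`. -/
noncomputable def horiz {d : ℕ} (z : Ambient d) : Base d :=
  WithLp.toLp 2 fun i => z i.castSucc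

/-- The last coordinate `y` of a point `(x, y)`. -/
def vert {d : ℕ} (z : Ambient d) : ℝ := z (Fin.last d)

/-- The partial derivative `∂_j g (x)`. -/
noncomputable def partialD {d : ℕ} (j : Fin d) (g : Base d → ℝ) (x : Base d) : ℝ :=
  fderiv ℝ g x (EuclideanSpace.single j 1)

section Domains

/-- The boundary charts of a (closed) `C²`-domain: a finite cover of the boundary by connected
open sets `U j` that covers a `δ`-neighbourhood of it with room `δ`, such that in each `U j`, in
some Cartesian coordinate system, the domain is given by `y ≤ f(x)`, where `f` is a `C²`-function
on `ℝ^d` with second order partial derivatives bounded by `M`. -/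
def HasC2Charts {d : ℕ} (Ω : Set (Ambient d)) : Prop :=
  ∃ δ : ℝ, 0 < δ ∧ ∃ M : ℝ, 0 < M ∧ ∃ (J : ℕ) (U : Fin J → Set (Ambient d)),
    (∀ j, IsOpen (U j) ∧ IsConnected (U j)) ∧
    frontier Ω ⊆ ⋃ j, U j ∧
    (∀ x ∈ Ω, Metric.infDist x (frontier Ω) < δ →
      ∃ j, x ∈ U j ∧ δ < Metric.infDist x (frontier (U j))) ∧
    ∀ j, ∃ (T : Ambient d ≃ᵃⁱ[ℝ] Ambient d) (f : Base d → ℝ),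
      ContDiff ℝ 2 f ∧
      (∀ (i k : Fin d) (x : Base d), |partialD i (partialD k f) x| ≤ M) ∧
      ∀ z ∈ U j, z ∈ Ω ↔ vert (T z) ≤ f (horiz (T z))

/-- `Ω` is the closure of an open, connected, bounded `C²`-domain. -/
structure IsCompactC2Domain {d : ℕ} (Ω : Set (Ambient d)) : Prop where
  exists_open : ∃ Ω₀ : Set (Ambient d),
    IsOpen Ω₀ ∧ IsConnected Ω₀ ∧ Bornology.IsBounded Ω₀ ∧ closure Ω₀ = Ω
  charts : HasC2Charts Ω

/-- The interchange `σ_j` of the `j`-th and the last coordinate. -/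
noncomputable def swapLast {d : ℕ} (j : Fin (d + 1)) : Ambient d ≃ₗᵢ[ℝ] Ambient d :=
  LinearIsometryEquiv.piLpCongrLeft 2 ℝ ℝ (Equiv.swap j (Fin.last d))

/-- The reflection `τ_j` in the coordinate plane `x_j = 0`. -/
noncomputable def reflCoord {d : ℕ} (j : Fin (d + 1)) : Ambient d ≃ₗᵢ[ℝ] Ambient d :=
  LinearIsometryEquiv.piLpCongrRight 2 fun i =>
    if i = j then LinearIsometryEquiv.neg ℝ else LinearIsometryEquiv.refl ℝ ℝ

/-- `{(x, y) : x ∈ (-b, b)^d, g(x) - L b < y ≤ g(x)}`. -/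
def stdDomain {d : ℕ} (b L : ℝ) (g : Base d → ℝ) : Set (Ambient d) :=
  {w | (∀ i, |horiz w i| < b) ∧ g (horiz w) - L * b < vert w ∧ vert w ≤ g (horiz w)}

/-- `{(x, g(x)) : x ∈ (-b, b)^d}`. -/
def stdGraph {d : ℕ} (b : ℝ) (g : Base d → ℝ) : Set (Ambient d) :=
  {w | (∀ i, |horiz w i| < b) ∧ vert w = g (horiz w)}

/-- `{(x, y) : x ∈ (-2b, 2b)^d, min_{[-2b, 2b]^d} g - 4 L b < y ≤ g(x)}`. -/
def stdStar {d : ℕ} (b L : ℝ) (g : Base d → ℝ) : Set (Ambient d) :=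
  {w | (∀ i, |horiz w i| < 2 * b) ∧
    sInf (g '' {u | ∀ i, |u i| ≤ 2 * b}) - 4 * L * b < vert w ∧ vert w ≤ g (horiz w)}

/-- The data of a domain of special type: an upward or downward `x_j`-domain of base size `b` and
parameter `L`, bounded by the graph of a `C²`-function `g`. -/
structure SpecialDomain (d : ℕ) where
  /-- the distinguished coordinate `x_j` -/
  axis : Fin (d + 1)
  /-- `true` for a downward domain, `false` for an upward one -/
  down : Bool
  /-- the translation vector -/
  shift : Ambient d
  /-- the base size -/
  b : ℝ
  /-- the parameter -/
  L : ℝ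
  /-- the function whose graph is the essential boundary -/
  g : Base d → ℝ
  b_pos : 0 < b
  one_le_L : 1 ≤ L
  contDiff_g : ContDiff ℝ 2 g

namespace SpecialDomain

/-- The composition of reflections that makes `G` an upward `x_{d+1}`-domain: `σ_j` if `G` is
upward, `σ_j ∘ τ_j` if `G` is downward. -/
noncomputable def rot {d : ℕ} (G : SpecialDomain d) : Ambient d ≃ₗᵢ[ℝ] Ambient d :=
  if G.down then (reflCoord G.axis).trans (swapLast G.axis) else swapLast G.axis

/-- The map `T` that takes `G` to `{(x, y) : x ∈ (-b, b)^d, g(x) - L b < y ≤ g(x)}`. -/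
noncomputable def toStd {d : ℕ} (G : SpecialDomain d) (z : Ambient d) : Ambient d :=
  G.rot z - G.shift

/-- The inverse of `toStd`. -/
noncomputable def fromStd {d : ℕ} (G : SpecialDomain d) (w : Ambient d) : Ambient d :=
  G.rot.symm (w + G.shift)

/-- The underlying set of the domain. -/
def carrier {d : ℕ} (G : SpecialDomain d) : Set (Ambient d) :=
  {z | G.toStd z ∈ stdDomain G.b G.L G.g}

/-- The enlarged domain `G^*`. -/
def star {d : ℕ} (G : SpecialDomain d) : Set (Ambient d) :=
  {z | G.toStd z ∈ stdStar G.b G.L G.g}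

/-- The essential boundary `∂' G^*` of the enlarged domain. -/
def essBoundaryStar {d : ℕ} (G : SpecialDomain d) : Set (Ambient d) :=
  {z | G.toStd z ∈ stdGraph (2 * G.b) G.g}

/-- `L ≥ 4 √d max_{[-2b, 2b]^d} ‖∇ g‖ + 1`. -/
def Steep {d : ℕ} (G : SpecialDomain d) : Prop :=
  ∀ x : Base d, (∀ i, |x i| ≤ 2 * G.b) → 4 * √(d : ℝ) * ‖gradient G.g x‖ + 1 ≤ G.L

/-- `G ⊆ Ω` is attached to the boundary of `Ω`: `closure G^* ∩ ∂Ω = closure (∂' G^*)`, and `G^*` is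
the intersection of `Ω` with an open rectangular box. -/
structure IsAttached {d : ℕ} (G : SpecialDomain d) (Ω : Set (Ambient d)) : Prop where
  subset : G.carrier ⊆ Ω
  closure_star : closure G.star ∩ frontier Ω = closure G.essBoundaryStar
  exists_box : ∃ l u : Fin (d + 1) → ℝ, G.star = {z | ∀ i, l i < z i ∧ z i < u i} ∩ Ω

end SpecialDomain

end Domains

section Differences

/-- The finite difference `Δ_h^r (f, Ω, z)`: it is `∑_{j=0}^r (-1)^{r+j} (r choose j) f(z + j h)` if
the segment `[z, z + r h]` lies in `Ω`, and `0` otherwise. -/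
noncomputable def finDiff {d : ℕ} (r : ℕ) (h : Ambient d) (f : Ambient d → ℝ)
    (Ω : Set (Ambient d)) (z : Ambient d) : ℝ :=
  open Classical in
  if segment ℝ z (z + (r : ℝ) • h) ⊆ Ω then
    ∑ j ∈ Finset.range (r + 1), (-1 : ℝ) ^ (r + j) * (r.choose j : ℝ) * f (z + (j : ℝ) • h)
  else 0

/-- The symmetric finite difference, `Δ_h^r (f, Ω, z - r h / 2)`. -/
noncomputable def symFinDiff {d : ℕ} (r : ℕ) (h : Ambient d) (f : Ambient d → ℝ)
    (Ω : Set (Ambient d)) (z : Ambient d) : ℝ :=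
  finDiff r h f Ω (z - ((r : ℝ) / 2) • h)

/-- The space `L^p(Ω)`, `0 < p ≤ ∞`, where `L^∞(Ω)` is taken to be `C(Ω)`. -/
def InLp {d : ℕ} (p : ℝ≥0∞) (Ω : Set (Ambient d)) (f : Ambient d → ℝ) : Prop :=
  if p = ∞ then ContinuousOn f Ω else MemLp f p (volume.restrict Ω)

/-- The `L^p(S)` (quasi-)norm of `F ≥ 0`, `0 < p ≤ ∞`, which is the uniform norm for `p = ∞`. -/
noncomputable def lpQuasiNorm {d : ℕ} (p : ℝ≥0∞) (S : Set (Ambient d)) (F : Ambient d → ℝ≥0∞) : ℝ≥0∞ :=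
  if p = ∞ then ⨆ z ∈ S, F z
  else (∫⁻ z in S, F z ^ p.toReal) ^ (1 / p.toReal)

end Differences

section AverageModulus

/-- The metric `ρ_Ω(ξ, η) = ‖ξ - η‖ + |√dist(ξ, ∂Ω) - √dist(η, ∂Ω)|`. -/
noncomputable def rhoDist {d : ℕ} (Ω : Set (Ambient d)) (ξ η : Ambient d) : ℝ :=
  ‖ξ - η‖ + |√(Metric.infDist ξ (frontier Ω)) - √(Metric.infDist η (frontier Ω))|

/-- The ball `U(ξ, t)` of `Ω` in the metric `ρ_Ω`. -/
def rhoBall {d : ℕ} (Ω : Set (Ambient d)) (ξ : Ambient d) (t : ℝ) : Set (Ambient d) :=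
  {η | η ∈ Ω ∧ rhoDist Ω ξ η ≤ t}

/-- The local average `w_r(f, ξ, t)_q`, a supremum for `q = ∞`. -/
noncomputable def localAverage {d : ℕ} (r : ℕ) (q : ℝ≥0∞) (Ω : Set (Ambient d))
    (f : Ambient d → ℝ) (ξ : Ambient d) (t : ℝ) : ℝ≥0∞ :=
  if q = ∞ then ⨆ η ∈ rhoBall Ω ξ t, ‖finDiff r ((r : ℝ)⁻¹ • (η - ξ)) f Ω ξ‖ₑ
  else ((volume (rhoBall Ω ξ t))⁻¹ *
    ∫⁻ η in rhoBall Ω ξ t, ‖finDiff r ((r : ℝ)⁻¹ • (η - ξ)) f Ω ξ‖ₑ ^ q.toReal) ^ (1 / q.toReal)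

/-- Ivanov's average modulus `τ_r(f, t)_{p,q}`. -/
noncomputable def ivanovModulus {d : ℕ} (r : ℕ) (p q : ℝ≥0∞) (Ω : Set (Ambient d))
    (f : Ambient d → ℝ) (t : ℝ) : ℝ≥0∞ :=
  lpQuasiNorm p Ω fun ξ => localAverage r q Ω f ξ t

end AverageModulus

section NewModulus

/-- `φ_Ω(e, ξ) = max {√(l₁ l₂) : l₁, l₂ ≥ 0, [ξ - l₁ e, ξ + l₂ e] ⊆ Ω}`. -/
noncomputable def phiDist {d : ℕ} (Ω : Set (Ambient d)) (e ξ : Ambient d) : ℝ :=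
  sSup {v | ∃ l₁ l₂ : ℝ, 0 ≤ l₁ ∧ 0 ≤ l₂ ∧
    segment ℝ (ξ - l₁ • e) (ξ + l₂ • e) ⊆ Ω ∧ v = √(l₁ * l₂)}

/-- The Ditzian-Totik modulus `ω^r_{Ω,φ}(f, t; e)_p` along the direction `e`. -/
noncomputable def directionalModulus {d : ℕ} (r : ℕ) (p : ℝ≥0∞) (Ω : Set (Ambient d))
    (f : Ambient d → ℝ) (t : ℝ) (e : Ambient d) : ℝ≥0∞ :=
  ⨆ h : ℝ, ⨆ _ : |h| ≤ min t 1,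
    lpQuasiNorm p Ω fun ξ => ‖symFinDiff r ((h * phiDist Ω e ξ) • e) f Ω ξ‖ₑ

/-- The tangent vector `ξ_j(u) = e_j + ∂_j g(u) e_{d+1}`. -/
noncomputable def tangentVec {d : ℕ} (g : Base d → ℝ) (j : Fin d) (u : Base d) : Ambient d :=
  EuclideanSpace.single j.castSucc 1 + partialD j g u • EuclideanSpace.single (Fin.last d) 1

/-- `G^t = {w ∈ G : dist(w, ∂' G) ≥ A₀ t²}` for `G = stdDomain b L g`. -/
def stdInner {d : ℕ} (b L : ℝ) (g : Base d → ℝ) (A₀ t : ℝ) : Set (Ambient d) :=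
  {w | w ∈ stdDomain b L g ∧ A₀ * t ^ 2 ≤ Metric.infDist w (stdGraph b g)}

/-- `I_x(ρ) = {u ∈ (-b, b)^d : ‖u - x‖ ≤ ρ}`. -/
def baseBall {d : ℕ} (b : ℝ) (x : Base d) (ρ : ℝ) : Set (Base d) :=
  {u | (∀ i, |u i| < b) ∧ ‖u - x‖ ≤ ρ}

/-- The tangential modulus, for `0 < t ≤ 1`, of the upward `x_{d+1}`-domain
`G = stdDomain b L g ⊆ Ω`. -/
noncomputable def stdTangentialModulus {d : ℕ} (r : ℕ) (p : ℝ≥0∞) (Ω : Set (Ambient d))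
    (b L : ℝ) (g : Base d → ℝ) (A₀ : ℝ) (f : Ambient d → ℝ) (t : ℝ) : ℝ≥0∞ :=
  ⨆ s : ℝ, ⨆ _ : 0 < s ∧ s ≤ t, ⨆ j : Fin d,
    if p = ∞ then
      ⨆ w ∈ stdInner b L g A₀ t, ⨆ u ∈ baseBall b (horiz w) (t * b),
        ‖finDiff r (s • tangentVec g j u) f Ω w‖ₑ
    else
      (∫⁻ w in stdInner b L g A₀ t, (ENNReal.ofReal ((b * t) ^ d))⁻¹ *
        ∫⁻ u in baseBall b (horiz w) (t * b),
          ‖finDiff r (s • tangentVec g j u) f Ω w‖ₑ ^ p.toReal) ^ (1 / p.toReal)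

/-- The tangential modulus of a domain `G ⊆ Ω` of special type, by transport to an upward
`x_{d+1}`-domain; for `t > 1` it is the modulus at `1`. -/
noncomputable def tangentialModulus {d : ℕ} (r : ℕ) (p : ℝ≥0∞) (Ω : Set (Ambient d))
    (G : SpecialDomain d) (A₀ : ℝ) (f : Ambient d → ℝ) (t : ℝ) : ℝ≥0∞ :=
  stdTangentialModulus r p (G.toStd '' Ω) G.b G.L G.g A₀ (fun w => f (G.fromStd w)) (min t 1)

/-- The modulus of smoothness `ω_Ω^r(f, t; A₀)_p` of `Ω`, defined through the domains `G i` of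
special type. -/
noncomputable def newModulus {d m : ℕ} (r : ℕ) (p : ℝ≥0∞) (Ω : Set (Ambient d))
    (G : Fin m → SpecialDomain d) (A₀ : ℝ) (f : Ambient d → ℝ) (t : ℝ) : ℝ≥0∞ :=
  (⨆ j : Fin (d + 1), directionalModulus r p Ω f t (EuclideanSpace.single j 1)) +
    ∑ i, tangentialModulus r p Ω (G i) A₀ f t

/-- A finite cover of the boundary of `Ω` by domains of special type that are attached to it. -/
structure IsAttachedCover {d m : ℕ} (G : Fin m → SpecialDomain d) (Ω : Set (Ambient d)) :
    Prop where
  attached : ∀ i, (G i).IsAttached Ω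
  steep : ∀ i, (G i).Steep
  cover : frontier Ω ⊆ ⋃ i, (G i).carrier

end NewModulus

/-! The proof has a pointwise half and an integral half.

Pointwise: sum `f` over the array z + j(h + is), 0 ≤ i, j ≤ r, by rows and by columns. With c_i the
coefficients of the r-th difference this gives Σ_i c_i Δ_{h+is} f(z) = Σ_j c_j Δ_{js} f(z + jh)
(`sum_diffCoeff_mul_diffSum`). The term i = 0 is ±Δ_h f(z) and the term j = 0 vanishes, so a given
difference is controlled by differences that depend on a free shift s. Averaging over s in a set S
turns these into local averages at the nodes z + jh, provided that S is comparable in volume to the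
ρ_Ω-balls of radius O(t) there and that its shifts keep the segments inside Ω and their ends inside
those balls (`enorm_diffSum_le_of_shift_set`). Both facts come from boundary charts. With δ the
depth of ξ, a ρ_Ω-ball of radius t about ξ has volume O(t^{d+1}(t + √δ))
(`exists_volume_rhoBall_le`); a slab of inward vectors with normal component about t(t + √δ) has at
least that volume up to a constant and consists of admissible shifts (`exists_shift_set`).

This handles segments of ρ_Ω-length at most κ times a small scale. The segments in the new modulus
are first cut into pieces by (X^n - 1)^r = (X - 1)^r (1 + ... + X^{n-1})^r
(`exists_diffSum_smul_eq`). The pieces are short at scale t₀t: along a coordinate direction because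
φ_Ω is small where that direction is steep against a nearby boundary
(`exists_rhoDist_le_of_directional`), along ξ_j(u) because this vector is almost tangent
(`SpecialDomain.exists_rhoDist_le_of_tangential`). The order of choices matters: κ does not depend
on t₀, then t₀ is chosen from κ, and only n depends on t₀.

Integral half: the node of a directional difference is ξ + c β φ_Ω(ξ) e_j with |c| ≤ 1. On each line
this map is injective with derivative at least 1/2 where φ_Ω > 0, and the identity elsewhere, so
composition with it costs a factor 3 (`setLIntegral_comp_add_phiDist_le`). For tangential
differences with u fixed the node is a translate, and Tonelli gives the bound
(`lintegral_lintegral_add_tangentVec`). Finally q = ∞ reduces to q = 1. -/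

/-- The distance of a point to the boundary of `Ω`. -/
noncomputable abbrev depth {d : ℕ} (Ω : Set (Ambient d)) (z : Ambient d) : ℝ :=
  Metric.infDist z (frontier Ω)

/-! ### Distance to the boundary and the metric ρ_Ω -/

section Depth

variable {d : ℕ} {Ω : Set (Ambient d)}

lemma depth_nonneg (z : Ambient d) : 0 ≤ depth Ω z := Metric.infDist_nonneg

lemma depth_le_add (z z' : Ambient d) : depth Ω z' ≤ depth Ω z + ‖z' - z‖ := by
  rw [← dist_eq_norm]
  exact Metric.infDist_le_infDist_add_dist

lemma abs_depth_sub_le (z z' : Ambient d) : |depth Ω z' - depth Ω z| ≤ ‖z' - z‖ := by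
  rw [abs_sub_le_iff]
  constructor
  · linarith [depth_le_add (Ω := Ω) z z']
  · rw [norm_sub_rev]
    linarith [depth_le_add (Ω := Ω) z' z]

lemma ne_univ_of_isCompact (hΩ : IsCompact Ω) : Ω ≠ Set.univ := by
  rintro rfl
  exact (noncompact_univ (Ambient d)) hΩ

lemma frontier_nonempty_of_isCompact (hΩ : IsCompact Ω) (hne : Ω.Nonempty) :
    (frontier Ω).Nonempty :=
  nonempty_frontier_iff.2 ⟨hne, ne_univ_of_isCompact hΩ⟩

/-- Seen from inside Ω, the nearest point of the complement lies on the frontier, so the depth is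
the distance to the complement. Upper bounds for the depth thus need only a point that is a limit of
exterior points. -/
lemma depth_le_norm_sub {x y : Ambient d} (hΩ : IsCompact Ω) (hx : x ∈ Ω)
    (hy : y ∈ closure Ωᶜ) : depth Ω x ≤ ‖x - y‖ := by
  obtain ⟨p, hp, hpd⟩ := exists_mem_frontier_infDist_compl_eq_dist hx (ne_univ_of_isCompact hΩ)
  calc depth Ω x ≤ dist x p := Metric.infDist_le_dist_of_mem hp
    _ = Metric.infDist x Ωᶜ := hpd.symm
    _ = Metric.infDist x (closure Ωᶜ) := Metric.infDist_closure.symm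
    _ ≤ dist x y := Metric.infDist_le_dist_of_mem hy
    _ = ‖x - y‖ := dist_eq_norm _ _

lemma mem_of_norm_sub_lt_depth {x y : Ambient d} (hΩ : IsCompact Ω) (hx : x ∈ Ω)
    (h : ‖x - y‖ < depth Ω x) : y ∈ Ω := by
  by_contra hy
  exact absurd (depth_le_norm_sub hΩ hx (subset_closure hy)) (not_le.2 h)

lemma exists_frontier_norm_eq (hΩ : IsCompact Ω) (hne : Ω.Nonempty) (z : Ambient d) :
    ∃ p ∈ frontier Ω, depth Ω z = ‖z - p‖ := by
  obtain ⟨p, hp, h⟩ := isClosed_frontier.exists_infDist_eq_dist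
    (frontier_nonempty_of_isCompact hΩ hne) z
  exact ⟨p, hp, by rw [← dist_eq_norm]; exact h⟩

lemma rhoDist_eq (ξ η : Ambient d) :
    rhoDist Ω ξ η = ‖ξ - η‖ + |√(depth Ω ξ) - √(depth Ω η)| := rfl

lemma rhoDist_triangle (x y z : Ambient d) :
    rhoDist Ω x z ≤ rhoDist Ω x y + rhoDist Ω y z := by
  simp only [rhoDist_eq]
  have h1 := norm_sub_le_norm_sub_add_norm_sub x y z
  have h2 := abs_sub_le (√(depth Ω x)) (√(depth Ω y)) (√(depth Ω z))
  linarith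

lemma norm_sub_le_rhoDist (ξ η : Ambient d) : ‖ξ - η‖ ≤ rhoDist Ω ξ η := by
  rw [rhoDist_eq]; linarith [abs_nonneg (√(depth Ω ξ) - √(depth Ω η))]

lemma abs_sqrt_depth_le_rhoDist (ξ η : Ambient d) :
    |√(depth Ω ξ) - √(depth Ω η)| ≤ rhoDist Ω ξ η := by
  rw [rhoDist_eq]; linarith [norm_nonneg (ξ - η)]

/-- If `|x - y| ≤ C t (t + √x)`, then `√x` and `√y` differ by at most a multiple of `t`. -/
lemma abs_sqrt_sub_sqrt_le {x y t C : ℝ} (hx : 0 ≤ x) (hy : 0 ≤ y) (ht : 0 ≤ t) (hC : 0 ≤ C)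
    (h : |x - y| ≤ C * t * (t + √x)) : |√x - √y| ≤ (2 * C + 1) * t := by
  have hsx := Real.sqrt_nonneg x
  have hsy := Real.sqrt_nonneg y
  have e : |x - y| = |√x - √y| * (√x + √y) := by
    rw [← abs_of_nonneg (add_nonneg hsx hsy), ← abs_mul]
    congr 1
    nlinarith [Real.sq_sqrt hx, Real.sq_sqrt hy]
  rw [e] at h
  have hd := abs_nonneg (√x - √y)
  have hd2 : |√x - √y| ≤ √x + √y := by
    rw [abs_le]; constructor <;> linarith
  by_contra! hcon
  have hpos : 0 < |√x - √y| := lt_of_le_of_lt (by positivity) hcon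
  -- Both |√x - √y| and √x are at most √x + √y, whence the factor 2.
  have h1 : |√x - √y| * (|√x - √y| + √x) ≤ 2 * (C * t * (t + √x)) := by nlinarith
  have h2 : (2 * C + 1) * t * (t + √x) < |√x - √y| * (|√x - √y| + √x) := by
    rcases eq_or_lt_of_le ht with rfl | htp
    · nlinarith
    · have : t < |√x - √y| := by nlinarith
      apply mul_lt_mul'' hcon (by linarith) (by positivity) (by positivity)
  nlinarith [mul_nonneg ht (add_nonneg ht hsx)]

lemma abs_sqrt_sub_sqrt_le_div {x y ε : ℝ} (hε : 0 < ε) (hx : ε ≤ x) (hy : 0 ≤ y) :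
    |√x - √y| ≤ |x - y| / √ε := by
  have hsx := Real.sqrt_le_sqrt hx
  have hse := Real.sqrt_pos.2 hε
  have hsy := Real.sqrt_nonneg y
  have e : |x - y| = |√x - √y| * (√x + √y) := by
    rw [← abs_of_nonneg (show 0 ≤ √x + √y by linarith), ← abs_mul]
    congr 1
    nlinarith [Real.sq_sqrt (hε.le.trans hx), Real.sq_sqrt hy]
  rw [e, le_div_iff₀ hse]
  exact mul_le_mul_of_nonneg_left (by linarith) (abs_nonneg _)

lemma abs_sqrt_sub_sqrt_le_sqrt {x y : ℝ} (hx : 0 ≤ x) (hy : 0 ≤ y) :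
    |√x - √y| ≤ √|x - y| := by
  apply Real.le_sqrt_of_sq_le
  have hsx := Real.sqrt_nonneg x
  have hsy := Real.sqrt_nonneg y
  have e : |x - y| = |√x - √y| * (√x + √y) := by
    rw [← abs_of_nonneg (add_nonneg hsx hsy), ← abs_mul]
    congr 1
    nlinarith [Real.sq_sqrt hx, Real.sq_sqrt hy]
  rw [e, sq]
  apply mul_le_mul_of_nonneg_left _ (abs_nonneg _)
  rw [abs_le]; constructor <;> linarith

/-- The square root is Hölder continuous of order 1/2. This crude bound serves where no chart is
available because t is bounded below. -/
lemma rhoDist_le_of_norm_le_sq {x y : Ambient d} {t : ℝ} (ht : 0 ≤ t) (ht1 : t ≤ 1)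
    (h : ‖x - y‖ ≤ t ^ 2) : rhoDist Ω x y ≤ 2 * t := by
  have h1 : |√(depth Ω x) - √(depth Ω y)| ≤ t := by
    refine (abs_sqrt_sub_sqrt_le_sqrt (depth_nonneg _) (depth_nonneg _)).trans ?_
    refine (Real.sqrt_le_sqrt ((abs_depth_sub_le y x).trans h)).trans ?_
    rw [Real.sqrt_sq ht]
  rw [rhoDist_eq]
  nlinarith

end Depth

/-! ### Local boundary charts and the behaviour of the depth in them -/

/-- Near `c`, the set `Ω` is `{Ψ ≥ 0}`, where `Ψ` has slope `-1` along lines in the direction `e`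
and derivative `Ψ'`, which is bounded by `K` and Lipschitz with constant `M`. -/
structure LocalChart {d : ℕ} (Ω : Set (Ambient d)) (c : Ambient d) (R M K : ℝ)
    (Ψ : Ambient d → ℝ) (Ψ' : Ambient d → Ambient d →L[ℝ] ℝ) (e : Ambient d) : Prop where
  R_pos : 0 < R
  M_nonneg : 0 ≤ M
  K_nonneg : 0 ≤ K
  norm_e : ‖e‖ = 1
  shift : ∀ z l, Ψ (z + l • e) = Ψ z - l
  mem_iff : ∀ z, ‖z - c‖ < R → (z ∈ Ω ↔ 0 ≤ Ψ z)
  deriv_e : ∀ z, Ψ' z e = -1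
  norm_deriv_le : ∀ z, ‖z - c‖ < R → ‖Ψ' z‖ ≤ K
  lip : ∀ z z', ‖z - c‖ < R → ‖z' - c‖ < R → |Ψ z' - Ψ z| ≤ K * ‖z' - z‖
  taylor : ∀ ξ z z', ‖ξ - c‖ < R → ‖z - c‖ < R → ‖z' - c‖ < R →
    |Ψ z' - Ψ z - Ψ' ξ (z' - z)| ≤ M * ‖z' - z‖ * (‖z - ξ‖ + ‖z' - z‖)

namespace LocalChart

variable {d : ℕ} {Ω : Set (Ambient d)} {c : Ambient d} {R M K : ℝ}
  {Ψ : Ambient d → ℝ} {Ψ' : Ambient d → Ambient d →L[ℝ] ℝ} {e : Ambient d}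

/-- An arbitrarily small step along `e` makes `Ψ` negative. -/
lemma mem_closure_compl (h : LocalChart Ω c R M K Ψ Ψ' e) {y : Ambient d}
    (hy : ‖y - c‖ < R) (h0 : Ψ y ≤ 0) : y ∈ closure Ωᶜ := by
  rw [Metric.mem_closure_iff]
  intro ε hε
  set l := min (ε / 2) ((R - ‖y - c‖) / 2) with hl
  have hlpos : 0 < l := lt_min (by linarith) (by linarith)
  have hn : ‖l • e‖ = l := by rw [norm_smul, h.norm_e, mul_one, Real.norm_of_nonneg hlpos.le]
  refine ⟨y + l • e, ?_, ?_⟩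
  · intro hmem
    have h1 : ‖y + l • e - c‖ < R := by
      have : ‖y + l • e - c‖ ≤ ‖y - c‖ + ‖l • e‖ := by
        rw [show y + l • e - c = (y - c) + l • e by abel]; exact norm_add_le _ _
      have := min_le_right (ε / 2) ((R - ‖y - c‖) / 2)
      linarith
    have := (h.mem_iff _ h1).1 hmem
    rw [h.shift] at this
    linarith
  · rw [dist_eq_norm, sub_add_cancel_left, norm_neg, hn]
    have := min_le_left (ε / 2) ((R - ‖y - c‖) / 2)
    linarith

lemma frontier_le_zero (h : LocalChart Ω c R M K Ψ Ψ' e) {p : Ambient d}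
    (hp : ‖p - c‖ < R) (hpf : p ∈ frontier Ω) : Ψ p ≤ 0 := by
  by_contra! hpos
  apply hpf.2
  rw [mem_interior_iff_mem_nhds, Metric.mem_nhds_iff]
  have hK := h.K_nonneg
  refine ⟨min (Ψ p / (K + 1)) (R - ‖p - c‖), lt_min (by positivity) (by linarith), ?_⟩
  intro y hy
  rw [Metric.mem_ball, dist_eq_norm] at hy
  have hy1 := lt_of_lt_of_le hy (min_le_left _ _)
  have hy2 := lt_of_lt_of_le hy (min_le_right _ _)
  have hyc : ‖y - c‖ < R := by
    have := norm_sub_le_norm_sub_add_norm_sub y p c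
    linarith
  rw [h.mem_iff y hyc]
  have h1 := h.lip p y hp hyc
  rw [lt_div_iff₀ (by linarith)] at hy1
  have := (abs_le.1 h1).1
  nlinarith [norm_nonneg (y - p)]

lemma frontier_eq_zero (h : LocalChart Ω c R M K Ψ Ψ' e) (hΩ : IsCompact Ω) {p : Ambient d}
    (hp : ‖p - c‖ < R) (hpf : p ∈ frontier Ω) : Ψ p = 0 :=
  le_antisymm (h.frontier_le_zero hp hpf)
    ((h.mem_iff p hp).1 (hΩ.isClosed.frontier_subset hpf))

/-- Carry the nearest frontier point `p` of `z` along to `p + v`, then move it along `e` back to the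
zero set of `Ψ`. The correction `μ` is the change of `Ψ` from `p` to `p + v`; by Taylor expansion it
differs from the change from `z` to `z'` only by a second order term. The gain over the Lipschitz
bound is that displacements with little effect on `Ψ` have little effect on the depth. -/
lemma depth_le_depth_add (h : LocalChart Ω c R M K Ψ Ψ' e) (hΩ : IsCompact Ω)
    {z z' : Ambient d} (hz : ‖z - c‖ < R / 4) (hz' : ‖z' - c‖ < R / 4) (hmem : z' ∈ Ω)
    (hδ : depth Ω z < R / 4) (hv : ‖z' - z‖ ≤ R / (4 * (K + 1))) :
    depth Ω z' ≤ depth Ω z + |Ψ z' - Ψ z| + 2 * M * ‖z' - z‖ * (depth Ω z + ‖z' - z‖) := by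
  have hR := h.R_pos
  have hK := h.K_nonneg
  have hM := h.M_nonneg
  obtain ⟨p, hpf, hp⟩ := exists_frontier_norm_eq hΩ ⟨z', hmem⟩ z
  set v := z' - z with hvdef
  rw [le_div_iff₀ (by positivity)] at hv
  have hvn := norm_nonneg v
  have hv4 : ‖v‖ ≤ R / 4 := by nlinarith
  have hKv : K * ‖v‖ ≤ R / 4 := by nlinarith
  have hpz : ‖p - z‖ = depth Ω z := by rw [hp, norm_sub_rev]
  have hpc : ‖p - c‖ < R / 2 := by
    have := norm_sub_le_norm_sub_add_norm_sub p z c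
    linarith
  have hpR : ‖p - c‖ < R := by linarith
  have hzR : ‖z - c‖ < R := by linarith
  have hz'R : ‖z' - c‖ < R := by linarith
  have hpv : ‖p + v - c‖ < R * (3 / 4) := by
    have : ‖p + v - c‖ ≤ ‖p - c‖ + ‖v‖ := by
      rw [show p + v - c = (p - c) + v by abel]; exact norm_add_le _ _
    linarith
  have hpvR : ‖p + v - c‖ < R := by linarith
  have h0 := h.frontier_eq_zero hΩ hpR hpf
  set μ := Ψ (p + v) with hμ
  have hμ1 : |μ| ≤ K * ‖v‖ := by
    have := h.lip p (p + v) hpR hpvR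
    rwa [h0, sub_zero, add_sub_cancel_left] at this
  have t1 := h.taylor z p (p + v) hzR hpR hpvR
  have t2 := h.taylor z z z' hzR hzR hz'R
  rw [h0, add_sub_cancel_left, hpz, sub_zero] at t1
  rw [sub_self, norm_zero, zero_add] at t2
  have hμ2 : |μ| ≤ |Ψ z' - Ψ z| + 2 * M * ‖v‖ * (depth Ω z + ‖v‖) := by
    have e1 : μ = (μ - Ψ' z v) - (Ψ z' - Ψ z - Ψ' z v) + (Ψ z' - Ψ z) := by ring
    have hab : |μ| ≤ |μ - Ψ' z v| + |Ψ z' - Ψ z - Ψ' z v| + |Ψ z' - Ψ z| := by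
      conv_lhs => rw [e1]
      exact (abs_add_le _ _).trans (add_le_add_left (abs_sub _ _) _)
    have : M * ‖v‖ * ‖v‖ ≤ M * ‖v‖ * (depth Ω z + ‖v‖) :=
      mul_le_mul_of_nonneg_left (by linarith [depth_nonneg (Ω := Ω) z]) (by positivity)
    rw [← hvdef] at t2
    linarith
  have hμe : ‖μ • e‖ = |μ| := by rw [norm_smul, h.norm_e, mul_one, Real.norm_eq_abs]
  have hp'c : ‖p + v + μ • e - c‖ < R := by
    have : ‖p + v + μ • e - c‖ ≤ ‖p + v - c‖ + ‖μ • e‖ := by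
      rw [show p + v + μ • e - c = (p + v - c) + μ • e by abel]; exact norm_add_le _ _
    rw [hμe] at this
    linarith
  have hcl := h.mem_closure_compl hp'c (by rw [h.shift]; linarith)
  have h3 := depth_le_norm_sub hΩ hmem hcl
  have h4 : ‖z' - (p + v + μ • e)‖ ≤ depth Ω z + |μ| := by
    rw [show z' - (p + v + μ • e) = (z - p) - μ • e by rw [hvdef]; abel, hp, ← hμe]
    exact norm_sub_le _ _
  linarith

/-- The previous bound used in both directions; the smaller radii keep the depth of `z'` below `R /
4`. -/
lemma abs_depth_sub_depth_le (h : LocalChart Ω c R M K Ψ Ψ' e) (hΩ : IsCompact Ω)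
    {z z' : Ambient d} (hz : ‖z - c‖ < R / 4) (hz' : ‖z' - c‖ < R / 4) (hmem : z ∈ Ω)
    (hmem' : z' ∈ Ω) (hδ : depth Ω z < R / 8) (hv : ‖z' - z‖ ≤ R / (8 * (K + 1))) :
    |depth Ω z' - depth Ω z| ≤
      |Ψ z' - Ψ z| + 2 * M * ‖z' - z‖ * (depth Ω z + 2 * ‖z' - z‖) := by
  have hR := h.R_pos
  have hK := h.K_nonneg
  have hM := h.M_nonneg
  have hn := norm_nonneg (z' - z)
  have hv' : ‖z' - z‖ ≤ R / (4 * (K + 1)) := by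
    refine hv.trans (div_le_div_of_nonneg_left hR.le (by positivity) (by linarith))
  have hv8 : ‖z' - z‖ ≤ R / 8 := by
    refine hv.trans (div_le_div_of_nonneg_left hR.le (by positivity) (by linarith))
  have hle := depth_le_add (Ω := Ω) z z'
  have a := h.depth_le_depth_add hΩ hz hz' hmem' (by linarith) hv'
  have b := h.depth_le_depth_add hΩ hz' hz hmem (by linarith) (by rwa [norm_sub_rev])
  rw [abs_sub_comm, norm_sub_rev z z'] at b
  have m1 : 2 * M * ‖z' - z‖ * (depth Ω z + ‖z' - z‖) ≤
      2 * M * ‖z' - z‖ * (depth Ω z + 2 * ‖z' - z‖) :=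
    mul_le_mul_of_nonneg_left (by linarith) (by positivity)
  have m2 : 2 * M * ‖z' - z‖ * (depth Ω z' + ‖z' - z‖) ≤
      2 * M * ‖z' - z‖ * (depth Ω z + 2 * ‖z' - z‖) :=
    mul_le_mul_of_nonneg_left (by linarith) (by positivity)
  rw [abs_sub_le_iff]
  constructor <;> linarith

/-- Moving a distance `l` into the domain increases the distance to the boundary by at least a
fixed multiple of `l`. -/
lemma depth_add_le_depth_sub (h : LocalChart Ω c R M K Ψ Ψ' e) (hΩ : IsCompact Ω)
    {z : Ambient d} {l : ℝ} (hl : 0 ≤ l) (hz : ‖z - c‖ < R / 4) (hl4 : l < R / 4)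
    (hmem : z ∈ Ω) (hmem' : z - l • e ∈ Ω) (hδ : depth Ω (z - l • e) < R / 4) :
    depth Ω z + l / (K + 1) ≤ depth Ω (z - l • e) := by
  have hR := h.R_pos
  have hK := h.K_nonneg
  rcases eq_or_lt_of_le hl with rfl | hlp
  · simp
  obtain ⟨p, hpf, hp⟩ := exists_frontier_norm_eq hΩ ⟨z, hmem⟩ (z - l • e)
  set z1 := z - l • e with hz1
  have hle : ‖l • e‖ = l := by rw [norm_smul, h.norm_e, mul_one, Real.norm_of_nonneg hl]
  have hz1c : ‖z1 - c‖ < R / 2 := by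
    have : ‖z1 - c‖ ≤ ‖z - c‖ + ‖l • e‖ := by
      rw [show z1 - c = (z - c) - l • e by rw [hz1]; abel]; exact norm_sub_le _ _
    linarith
  set v := p - z1 with hv
  have hvn : ‖v‖ = depth Ω z1 := by rw [hp, hv, norm_sub_rev]
  have hpc : ‖p - c‖ < R * (3 / 4) := by
    have := norm_sub_le_norm_sub_add_norm_sub p z1 c
    rw [← hv] at this
    linarith
  have hpR : ‖p - c‖ < R := by linarith
  have h0 := h.frontier_eq_zero hΩ hpR hpf
  have hzΨ := (h.mem_iff z (by linarith)).1 hmem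
  have hshift : Ψ z = Ψ z1 - l := by rw [← h.shift, hz1, sub_add_cancel]
  have hκ : l / (K + 1) * (K + 1) = l := div_mul_cancel₀ _ (by positivity)
  have hκ0 : 0 < l / (K + 1) := by positivity
  by_contra! hcon
  -- `Ψ` is at least `l` at `z1` and vanishes at `p`, so the Lipschitz bound separates the two
  -- points.
  have hlarge : l / (K + 1) ≤ ‖v‖ := by
    by_contra! hsm
    have := (abs_le.1 (h.lip p z1 hpR (by linarith))).2
    rw [h0, ← norm_sub_rev, ← hv] at this
    nlinarith
  have hvpos : 0 < ‖v‖ := by linarith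
  -- The point `z + (1 - μ) • v` is `p - μ • v` pushed outward by `l`. Backing up from `p` raises
  -- `Ψ` by at most `K l / (K + 1)`, the push lowers it by `l`, so the point is not interior and
  -- bounds the depth of `z` by `(1 - μ)‖v‖`, which is the depth of `z1` minus `l / (K + 1)`.
  set μ := l / (K + 1) / ‖v‖ with hμ
  have hμv : μ * ‖v‖ = l / (K + 1) := div_mul_cancel₀ _ hvpos.ne'
  have hμ0 : 0 ≤ μ := by positivity
  have hμ1 : μ ≤ 1 := (div_le_one hvpos).2 hlarge
  have e1 : z + (1 - μ) • v = (p - μ • v) + l • e := by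
    rw [hv, hz1]; module
  have hnv : ‖μ • v‖ = μ * ‖v‖ := by rw [norm_smul, Real.norm_of_nonneg hμ0]
  have hκl : l / (K + 1) ≤ l := div_le_self hl (by linarith)
  have hsegc : ‖p - μ • v - c‖ < R := by
    have : p - μ • v - c = (z1 - c) + (1 - μ) • v := by rw [hv]; module
    have h2 : ‖(1 - μ) • v‖ ≤ ‖v‖ := by
      rw [norm_smul, Real.norm_of_nonneg (by linarith)]
      nlinarith
    have h3 := norm_add_le (z1 - c) ((1 - μ) • v)
    rw [this]
    linarith
  have hyc : ‖z + (1 - μ) • v - c‖ < R := by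
    have h2 : ‖(1 - μ) • v‖ ≤ ‖v‖ := by
      rw [norm_smul, Real.norm_of_nonneg (by linarith)]
      nlinarith
    have h3 := norm_add_le (z - c) ((1 - μ) • v)
    rw [show z + (1 - μ) • v - c = (z - c) + (1 - μ) • v by abel]
    linarith
  have hΨ : Ψ (z + (1 - μ) • v) ≤ 0 := by
    rw [e1, h.shift]
    have := (abs_le.1 (h.lip p (p - μ • v) hpR hsegc)).2
    rw [h0, sub_sub_cancel_left, norm_neg, hnv, hμv] at this
    nlinarith
  have hfin := depth_le_norm_sub hΩ hmem (h.mem_closure_compl hyc hΨ)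
  rw [sub_add_cancel_left, norm_neg, norm_smul, Real.norm_of_nonneg (by linarith)] at hfin
  nlinarith

end LocalChart

/-- Every boundary point of `Ω` is the centre of a local chart, with uniform constants. -/
def HasUniformCharts {d : ℕ} (Ω : Set (Ambient d)) (R M K : ℝ) : Prop :=
  ∀ p ∈ frontier Ω, ∃ Ψ Ψ' e, LocalChart Ω p R M K Ψ Ψ' e

/-! ### Volumes of ρ_Ω-balls and sets of admissible shifts -/

section Volume

variable {d : ℕ} {Ω : Set (Ambient d)}

/-- The volume of the unit ball. -/
noncomputable def unitVol (d : ℕ) : ℝ := (volume (Metric.ball (0 : Ambient d) 1)).toReal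

lemma unitVol_pos (d : ℕ) : 0 < unitVol d :=
  ENNReal.toReal_pos (Metric.measure_ball_pos _ _ one_pos).ne' measure_ball_lt_top.ne

lemma volume_closedBall_eq (x : Ambient d) {t : ℝ} (ht : 0 ≤ t) :
    volume (Metric.closedBall x t) = ENNReal.ofReal (t ^ (d + 1) * unitVol d) := by
  rw [Measure.addHaar_closedBall _ _ ht, finrank_euclideanSpace_fin,
    ENNReal.ofReal_mul (by positivity), unitVol, ENNReal.ofReal_toReal measure_ball_lt_top.ne]

lemma continuous_rhoDist : Continuous fun x : Ambient d × Ambient d => rhoDist Ω x.1 x.2 := by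
  have h := (Metric.continuous_infDist_pt (frontier Ω)).sqrt
  exact (continuous_fst.sub continuous_snd).norm.add
    ((h.comp continuous_fst).sub (h.comp continuous_snd)).abs

lemma isClosed_rhoBall (hΩ : IsClosed Ω) (ξ : Ambient d) (t : ℝ) : IsClosed (rhoBall Ω ξ t) := by
  have hd := (Metric.continuous_infDist_pt (frontier Ω)).sqrt
  have h : Continuous fun η : Ambient d => rhoDist Ω ξ η :=
    (continuous_const.sub continuous_id).norm.add (continuous_const.sub hd).abs
  exact hΩ.inter (isClosed_le h continuous_const)

lemma rhoBall_subset_closedBall (ξ : Ambient d) (t : ℝ) :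
    rhoBall Ω ξ t ⊆ Metric.closedBall ξ t := by
  intro η hη
  rw [Metric.mem_closedBall, dist_eq_norm, norm_sub_rev]
  exact (norm_sub_le_rhoDist _ _).trans hη.2

/-- Packing: a set of extent less than `ρ` along `e` has disjoint translates by the multiples of `ρ
• e`. -/
lemma card_mul_volume_le {U B : Set (Ambient d)} (hU : MeasurableSet U) (e : Ambient d) {ρ : ℝ}
    (hρ0 : 0 ≤ ρ) (hρ : ∀ z ∈ U, ∀ l, ρ ≤ l → z - l • e ∉ U) (N : ℕ)
    (hB : ∀ z ∈ U, ∀ k < N, z + ((k : ℝ) * ρ) • e ∈ B) : N * volume U ≤ volume B := by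
  set A : ℕ → Set (Ambient d) := fun k => (fun x => x + (-((k : ℝ) * ρ)) • e) ⁻¹' U with hA
  have hvol : ∀ k, volume (A k) = volume U := fun k => measure_preimage_add_right _ _ _
  have hlt : ∀ i j : ℕ, i < j → Disjoint (A i) (A j) := by
    intro i j hij
    rw [Set.disjoint_left]
    intro x hx hx'
    refine hρ _ hx (((j : ℝ) - i) * ρ) ?_ ?_
    · have : (1 : ℝ) ≤ (j : ℝ) - i := by
        have : (i : ℝ) + 1 ≤ j := by exact_mod_cast hij
        linarith
      nlinarith
    · have e1 : x + (-((i : ℝ) * ρ)) • e - (((j : ℝ) - i) * ρ) • e =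
          x + (-((j : ℝ) * ρ)) • e := by module
      rw [e1]
      exact hx'
  have hdisj : Set.PairwiseDisjoint (↑(Finset.range N) : Set ℕ) A := by
    intro i _ j _ hij
    rcases lt_or_gt_of_ne hij with h | h
    · exact hlt i j h
    · exact (hlt j i h).symm
  calc (N : ℝ≥0∞) * volume U = ∑ k ∈ Finset.range N, volume (A k) := by simp [hvol]
    _ = volume (⋃ k ∈ Finset.range N, A k) := by
      rw [measure_biUnion_finset hdisj]
      intro k _
      exact hU.preimage (by fun_prop)
    _ ≤ volume B := by
      apply measure_mono
      intro x hx
      simp only [Set.mem_iUnion, Finset.mem_range] at hx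
      obtain ⟨k, hk, hx⟩ := hx
      have := hB _ hx k hk
      have e1 : x + (-((k : ℝ) * ρ)) • e + ((k : ℝ) * ρ) • e = x := by module
      rwa [e1] at this

/-- Covering: `B` lies in the union of the 2N + 1 translates of `S` by multiples of `a • e`. -/
lemma volume_le_card_mul {S B : Set (Ambient d)} (e : Ambient d) (a : ℝ) (N : ℕ)
    (h : ∀ x ∈ B, ∃ k : ℤ, |k| ≤ N ∧ x + ((k : ℝ) * a) • e ∈ S) :
    volume B ≤ (2 * N + 1 : ℕ) * volume S := by
  set A : ℤ → Set (Ambient d) := fun k => (fun x => x + ((k : ℝ) * a) • e) ⁻¹' S with hA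
  have hvol : ∀ k, volume (A k) = volume S := fun k => measure_preimage_add_right _ _ _
  calc volume B ≤ volume (⋃ k ∈ Finset.Icc (-(N : ℤ)) N, A k) := by
        apply measure_mono
        intro x hx
        obtain ⟨k, hk, hxk⟩ := h x hx
        simp only [Set.mem_iUnion, Finset.mem_Icc]
        exact ⟨k, abs_le.1 hk, hxk⟩
    _ ≤ ∑ k ∈ Finset.Icc (-(N : ℤ)) N, volume (A k) := measure_biUnion_finset_le _ _
    _ = (2 * N + 1 : ℕ) * volume S := by
      simp only [hvol, Finset.sum_const, Int.card_Icc, nsmul_eq_mul]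
      congr 2
      omega

/-- The volume of a ball of radius `t` in the metric `ρ_Ω` is `O(t ^ (d + 1) (t + √depth))`. -/
lemma exists_volume_rhoBall_le (hΩ : IsCompact Ω) {R M K : ℝ} (hR : 0 < R) (hK : 0 ≤ K)
    (hch : HasUniformCharts Ω R M K) :
    ∃ C : ℝ, 0 < C ∧ ∀ t, 0 < t → ∀ ξ ∈ Ω,
      volume (rhoBall Ω ξ t) ≤ ENNReal.ofReal (C * (t ^ (d + 1) * (t + √(depth Ω ξ)))) := by
  have hv := unitVol_pos d
  -- For t + √δ ≥ τ the Euclidean ball already gives the bound; below τ the whole ball lies in one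
  -- chart.
  set τ := min (R / 32) (√(R / 16)) with hτ
  have hτ0 : 0 < τ := lt_min (by positivity) (by positivity)
  set B := 1 + 5 * (K + 1) * (1 + R + √R) with hB
  have hB0 : 0 < B := by positivity
  refine ⟨unitVol d / τ + B ^ (d + 1) * unitVol d, by positivity, ?_⟩
  intro t ht ξ hξ
  have hs := Real.sqrt_nonneg (depth Ω ξ)
  by_cases hcase : τ ≤ t + √(depth Ω ξ)
  · refine (measure_mono (rhoBall_subset_closedBall ξ t)).trans ?_
    rw [volume_closedBall_eq _ ht.le]
    apply ENNReal.ofReal_le_ofReal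
    have h1 : 1 ≤ (t + √(depth Ω ξ)) / τ := (one_le_div hτ0).2 hcase
    have h2 : t ^ (d + 1) * unitVol d * 1 ≤
        t ^ (d + 1) * unitVol d * ((t + √(depth Ω ξ)) / τ) :=
      mul_le_mul_of_nonneg_left h1 (by positivity)
    have h3 : 0 ≤ B ^ (d + 1) * unitVol d * (t ^ (d + 1) * (t + √(depth Ω ξ))) := by positivity
    have h4 : t ^ (d + 1) * unitVol d * ((t + √(depth Ω ξ)) / τ) =
      unitVol d / τ * (t ^ (d + 1) * (t + √(depth Ω ξ))) := by ring
    linarith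
  push Not at hcase
  have ht32 : t < R / 32 := by
    have := min_le_left (R / 32) (√(R / 16)); linarith
  have hδ16 : depth Ω ξ < R / 16 := by
    have := min_le_right (R / 32) (√(R / 16))
    exact lt_of_not_ge fun h => by
      have := Real.sqrt_le_sqrt h
      linarith
  obtain ⟨p, hpf, hp⟩ := exists_frontier_norm_eq hΩ ⟨ξ, hξ⟩ ξ
  obtain ⟨Ψ, Ψ', e, h⟩ := hch p hpf
  set u := t + √(depth Ω ξ) with hu
  have hu0 : 0 < u := by positivity
  -- In the ball √depth varies by at most 2t and is at most u, so the depth varies by at most 4tu.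
  -- Two points of the ball at distance `ρ` along `e` would have depths differing by 5tu.
  set ρ := 5 * (K + 1) * t * u with hρ
  have hρ0 : 0 < ρ := by positivity
  have hnear : ∀ z ∈ rhoBall Ω ξ t, ‖z - ξ‖ ≤ t := fun z hz => by
    have := rhoBall_subset_closedBall ξ t hz
    rwa [Metric.mem_closedBall, dist_eq_norm] at this
  have hsep : ∀ z ∈ rhoBall Ω ξ t, ∀ l, ρ ≤ l → z - l • e ∉ rhoBall Ω ξ t := by
    intro z hz l hl hz'
    have n1 := hnear z hz
    have n2 := hnear _ hz'
    have hl0 : 0 < l := hρ0.trans_le hl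
    have hl2 : l ≤ 2 * t := by
      have e1 : ‖l • e‖ = l := by rw [norm_smul, h.norm_e, mul_one, Real.norm_of_nonneg hl0.le]
      have e2 : l • e = (z - ξ) - (z - l • e - ξ) := by module
      have := norm_sub_le (z - ξ) (z - l • e - ξ)
      rw [← e2, e1] at this
      linarith
    have hzp : ‖z - p‖ < R / 4 := by
      have := norm_sub_le_norm_sub_add_norm_sub z ξ p
      linarith
    have hd1 : depth Ω (z - l • e) < R / 4 := by
      have := depth_le_add (Ω := Ω) ξ (z - l • e)
      linarith
    have hcone := h.depth_add_le_depth_sub hΩ hl0.le hzp (by linarith) hz.1 hz'.1 hd1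
    have s1 := (abs_sqrt_depth_le_rhoDist (Ω := Ω) ξ z).trans hz.2
    have s2 := (abs_sqrt_depth_le_rhoDist (Ω := Ω) ξ (z - l • e)).trans hz'.2
    have q1 := Real.sq_sqrt (depth_nonneg (Ω := Ω) z)
    have q2 := Real.sq_sqrt (depth_nonneg (Ω := Ω) (z - l • e))
    have p1 := Real.sqrt_nonneg (depth Ω z)
    have p2 := Real.sqrt_nonneg (depth Ω (z - l • e))
    have h5 : 5 * t * u ≤ l / (K + 1) := by
      rw [le_div_iff₀ (by positivity)]
      nlinarith
    rw [abs_le] at s1 s2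
    have h6 : depth Ω (z - l • e) - depth Ω z ≤ 4 * t * u := by
      have a1 : √(depth Ω (z - l • e)) - √(depth Ω z) ≤ 2 * t := by linarith
      have a2 : √(depth Ω (z - l • e)) + √(depth Ω z) ≤ 2 * u := by linarith
      have a3 : (√(depth Ω (z - l • e)) - √(depth Ω z)) *
          (√(depth Ω (z - l • e)) + √(depth Ω z)) ≤ 2 * t * (2 * u) :=
        mul_le_mul a1 a2 (by positivity) (by positivity)
      nlinarith
    nlinarith [mul_pos ht hu0]
  -- About 1/u disjoint translates fit into a Euclidean ball of radius O(t), which gains the factor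
  -- u.
  set N := ⌈1 / u⌉₊ with hN
  have hN1 : 1 / u ≤ N := Nat.le_ceil _
  have hN2 : (N : ℝ) < 1 / u + 1 := Nat.ceil_lt_add_one (by positivity)
  have hsub : ∀ z ∈ rhoBall Ω ξ t, ∀ k < N, z + ((k : ℝ) * ρ) • e ∈
      Metric.closedBall ξ (B * t) := by
    intro z hz k hk
    rw [Metric.mem_closedBall, dist_eq_norm]
    have n1 := hnear z hz
    have n2 : ‖((k : ℝ) * ρ) • e‖ = k * ρ := by
      rw [norm_smul, h.norm_e, mul_one, Real.norm_of_nonneg (by positivity)]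
    have n3 : ‖z + ((k : ℝ) * ρ) • e - ξ‖ ≤ t + k * ρ := by
      rw [show z + ((k : ℝ) * ρ) • e - ξ = (z - ξ) + ((k : ℝ) * ρ) • e by abel]
      have := norm_add_le (z - ξ) (((k : ℝ) * ρ) • e)
      linarith
    have hk' : (k : ℝ) ≤ 1 / u + 1 := by
      have : (k : ℝ) < N := by exact_mod_cast hk
      linarith
    have n4 : (k : ℝ) * ρ ≤ (1 / u + 1) * ρ := mul_le_mul_of_nonneg_right hk' hρ0.le
    have n5 : (1 / u + 1) * ρ = 5 * (K + 1) * t * (1 + u) := by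
      rw [hρ]; field_simp
    have n6 : u ≤ R + √R := by
      have : √(depth Ω ξ) ≤ √R := Real.sqrt_le_sqrt (by linarith)
      linarith
    have n7 : 5 * (K + 1) * t * (1 + u) ≤ 5 * (K + 1) * t * (1 + R + √R) :=
      mul_le_mul_of_nonneg_left (by linarith) (by positivity)
    have n8 : B * t = t + 5 * (K + 1) * t * (1 + R + √R) := by rw [hB]; ring
    linarith
  have hpack := card_mul_volume_le (isClosed_rhoBall hΩ.isClosed ξ t).measurableSet e hρ0.le
    hsep N hsub
  rw [volume_closedBall_eq _ (by positivity)] at hpack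
  have hone : (1 : ℝ≥0∞) ≤ ENNReal.ofReal u * N := by
    rw [← ENNReal.ofReal_natCast, ← ENNReal.ofReal_mul hu0.le, ENNReal.one_le_ofReal]
    rw [div_le_iff₀ hu0] at hN1
    linarith
  calc volume (rhoBall Ω ξ t) ≤ ENNReal.ofReal u * N * volume (rhoBall Ω ξ t) :=
        le_mul_of_one_le_left zero_le hone
    _ ≤ ENNReal.ofReal u * ENNReal.ofReal ((B * t) ^ (d + 1) * unitVol d) := by
        rw [mul_assoc]; gcongr
    _ = ENNReal.ofReal (u * ((B * t) ^ (d + 1) * unitVol d)) :=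
        (ENNReal.ofReal_mul hu0.le).symm
    _ ≤ _ := by
        apply ENNReal.ofReal_le_ofReal
        have e1 : u * ((B * t) ^ (d + 1) * unitVol d) =
          B ^ (d + 1) * unitVol d * (t ^ (d + 1) * u) := by rw [mul_pow]; ring
        have h3 : 0 ≤ unitVol d / τ * (t ^ (d + 1) * u) := by positivity
        linarith

/-- Since `Ψ' ξ e = -1`, moving along `e` brings any vector into the slab, so the ball of radius `t`
is covered by O(t/a) translates of the slab. The radius `(K + 2) * t` allows for a shift of length
at most `K t + 2a`. -/
lemma LocalChart.volume_slab_ge {c : Ambient d} {R M K : ℝ} {Ψ : Ambient d → ℝ}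
    {Ψ' : Ambient d → Ambient d →L[ℝ] ℝ} {e : Ambient d} (h : LocalChart Ω c R M K Ψ Ψ' e)
    {ξ : Ambient d} (hξ : ‖ξ - c‖ < R) {t a : ℝ} (ht : 0 < t) (ha : 0 < a) (hat : 2 * a ≤ t) :
    ENNReal.ofReal (unitVol d / (2 * K + 7) * (t ^ d * a)) ≤
      volume {s : Ambient d | ‖s‖ ≤ (K + 2) * t ∧ a ≤ Ψ' ξ s ∧ Ψ' ξ s ≤ 2 * a} := by
  have hK := h.K_nonneg
  have hv := unitVol_pos d
  set S := {s : Ambient d | ‖s‖ ≤ (K + 2) * t ∧ a ≤ Ψ' ξ s ∧ Ψ' ξ s ≤ 2 * a} with hS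
  set N := ⌈K * t / a⌉₊ + 2 with hN
  have hcov : ∀ x ∈ Metric.closedBall (0 : Ambient d) t,
      ∃ k : ℤ, |k| ≤ N ∧ x + ((k : ℝ) * a) • e ∈ S := by
    intro x hx
    rw [mem_closedBall_zero_iff] at hx
    have hℓ : |Ψ' ξ x| ≤ K * t := by
      have := (Ψ' ξ).le_opNorm x
      rw [Real.norm_eq_abs] at this
      refine this.trans (mul_le_mul (h.norm_deriv_le ξ hξ) hx (norm_nonneg _) hK)
    -- The `- 1` puts the remaining value into [a, 2a) rather than [0, a).
    set k : ℤ := ⌊Ψ' ξ x / a⌋ - 1 with hk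
    have f1 := Int.floor_le (Ψ' ξ x / a)
    have f2 := Int.lt_floor_add_one (Ψ' ξ x / a)
    rw [le_div_iff₀ ha] at f1
    rw [div_lt_iff₀ ha] at f2
    have hkc : (k : ℝ) = ⌊Ψ' ξ x / a⌋ - 1 := by rw [hk]; push_cast; ring
    have hval : Ψ' ξ (x + ((k : ℝ) * a) • e) = Ψ' ξ x - k * a := by
      rw [map_add, map_smul, h.deriv_e, smul_eq_mul]; ring
    have g1 : a ≤ Ψ' ξ x - k * a := by rw [hkc]; nlinarith
    have g2 : Ψ' ξ x - k * a ≤ 2 * a := by rw [hkc]; nlinarith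
    have habs : |(k : ℝ) * a| ≤ K * t + 2 * a := by
      rw [abs_le] at hℓ ⊢
      constructor <;> linarith
    refine ⟨k, ?_, ?_, ?_, ?_⟩
    · have : |(k : ℝ)| ≤ K * t / a + 2 := by
        rw [abs_mul, abs_of_pos ha] at habs
        rw [← sub_le_iff_le_add, le_div_iff₀ ha]
        linarith
      have h2 : |(k : ℝ)| ≤ (N : ℝ) := by
        rw [hN]; push_cast
        have := Nat.le_ceil (K * t / a)
        linarith
      exact_mod_cast h2
    · refine (norm_add_le _ _).trans ?_
      rw [norm_smul, h.norm_e, mul_one, Real.norm_eq_abs]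
      linarith
    · rw [hval]; exact g1
    · rw [hval]; exact g2
  have hle := volume_le_card_mul e a N hcov
  rw [volume_closedBall_eq _ ht.le] at hle
  have hcard : ((2 * N + 1 : ℕ) : ℝ) ≤ (2 * K + 7) * t / a := by
    have := Nat.ceil_lt_add_one (show 0 ≤ K * t / a by positivity)
    have h1 : 1 ≤ t / a := (one_le_div ha).2 (by linarith)
    rw [hN]; push_cast
    have e1 : (2 * K + 7) * t / a = 2 * (K * t / a) + 7 * (t / a) := by ring
    linarith
  have hf : ENNReal.ofReal (a / ((2 * K + 7) * t)) * ((2 * N + 1 : ℕ) : ℝ≥0∞) ≤ 1 := by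
    rw [← ENNReal.ofReal_natCast, ← ENNReal.ofReal_mul (by positivity), ENNReal.ofReal_le_one]
    calc a / ((2 * K + 7) * t) * ((2 * N + 1 : ℕ) : ℝ)
        ≤ a / ((2 * K + 7) * t) * ((2 * K + 7) * t / a) := by gcongr
      _ = 1 := by field_simp
  calc ENNReal.ofReal (unitVol d / (2 * K + 7) * (t ^ d * a))
      = ENNReal.ofReal (a / ((2 * K + 7) * t)) * ENNReal.ofReal (t ^ (d + 1) * unitVol d) := by
        rw [← ENNReal.ofReal_mul (by positivity)]
        congr 1
        field_simp
        ring
    _ ≤ ENNReal.ofReal (a / ((2 * K + 7) * t)) * ((2 * N + 1 : ℕ) * volume S) := by gcongr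
    _ ≤ 1 * volume S := by rw [← mul_assoc]; gcongr
    _ = volume S := one_mul _

lemma le_sqrt_of_le_one {x : ℝ} (hx : 0 ≤ x) (hx1 : x ≤ 1) : x ≤ √x :=
  Real.le_sqrt_of_sq_le (by nlinarith)

set_option maxHeartbeats 1000000 in
/-- Around every point of `Ω` there is a large set of directions in which all points that are
close in the metric `ρ_Ω` can be moved without leaving `Ω`. -/
lemma exists_shift_set (hΩ : IsCompact Ω) {R M K : ℝ} (hR : 0 < R) (hM : 0 ≤ M) (hK : 0 ≤ K)
    (hch : HasUniformCharts Ω R M K) {κ : ℝ} (hκ : 0 < κ) :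
    ∃ t₀ : ℝ, 0 < t₀ ∧ t₀ ≤ 1 ∧ ∃ C : ℝ, 0 < C ∧ ∃ c : ℝ, 0 < c ∧ ∀ t, 0 < t → t ≤ t₀ →
      ∀ ξ ∈ Ω, ∃ S : Set (Ambient d), MeasurableSet S ∧
        ENNReal.ofReal (c * (t ^ (d + 1) * (t + √(depth Ω ξ)))) ≤ volume S ∧
        ∀ z ∈ Ω, rhoDist Ω ξ z ≤ κ * t → ∀ s ∈ S, ∀ l : ℝ, 0 ≤ l → l ≤ 1 →
          z + l • s ∈ Ω ∧ rhoDist Ω z (z + l • s) ≤ C * t := by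
  have hv := unitVol_pos d
  obtain ⟨D, hD⟩ := hΩ.exists_bound_of_continuousOn
    (Metric.continuous_infDist_pt (frontier Ω)).continuousOn
  set B := K + 2 with hB
  have hB0 : 0 < B := by positivity
  -- With this `A` the Taylor error along a fraction `l` of a shift is at most `l * a`, which is
  -- dominated by the linear gain `l * Ψ' ξ s`.
  set A := M * B * (κ + B) + 1 with hA
  have hA0 : 0 < A := by positivity
  -- Below this depth the point is well inside a chart and nearby depths are at most 1. The last
  -- entry and `t₀ ≤ 1 / (4 * A)` give `A * u ≤ 1 / 2`, that is `2 * a ≤ t`, as the slab bound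
  -- requires.
  set δ₀ := min (min (R / 16) (1 / 2)) ((1 / (4 * A)) ^ 2) with hδ₀
  have hδ₀0 : 0 < δ₀ := lt_min (lt_min (by positivity) (by positivity)) (by positivity)
  have hδ₀R : δ₀ ≤ R / 16 := (min_le_left _ _).trans (min_le_left _ _)
  have hδ₀1 : δ₀ ≤ 1 / 2 := (min_le_left _ _).trans (min_le_right _ _)
  have hδ₀A : δ₀ ≤ (1 / (4 * A)) ^ 2 := min_le_right _ _
  set t₀ := min (min (1 / (4 * A)) (δ₀ / (4 * (κ + 1)))) (R / (8 * (K + 1) * B)) with ht₀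
  have ht₀A : t₀ ≤ 1 / (4 * A) := (min_le_left _ _).trans (min_le_left _ _)
  have ht₀κ : t₀ ≤ δ₀ / (4 * (κ + 1)) := (min_le_left _ _).trans (min_le_right _ _)
  have ht₀R : t₀ ≤ R / (8 * (K + 1) * B) := min_le_right _ _
  have ht₀0 : 0 < t₀ := lt_min (lt_min (by positivity) (by positivity)) (by positivity)
  have hA1 : 1 ≤ A := by
    have : 0 ≤ M * B * (κ + B) := by positivity
    linarith
  have ht₀1 : t₀ ≤ 1 := by
    refine ht₀A.trans ?_
    rw [div_le_one (by positivity)]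
    linarith
  set C₁ := 3 * A * (1 + κ) + 2 * M * B * (1 + 2 * B) with hC₁
  have hC₁0 : 0 < C₁ := by positivity
  set E := 1 + √|D| with hE
  have hE0 : 0 < E := by positivity
  refine ⟨t₀, ht₀0, ht₀1, max (B + (2 * C₁ + 1)) (1 + 1 / √(δ₀ / 2)), by positivity,
    min (unitVol d / E) (unitVol d / (2 * K + 7) * A), by positivity, ?_⟩
  intro t ht htt₀ ξ hξ
  have hs := Real.sqrt_nonneg (depth Ω ξ)
  have hκt : κ * t ≤ δ₀ / 4 ∧ t ≤ δ₀ / 4 := by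
    have h1 := htt₀.trans ht₀κ
    rw [le_div_iff₀ (by positivity)] at h1
    have := mul_pos hκ ht
    constructor <;> linarith
  by_cases hfar : δ₀ ≤ depth Ω ξ
  -- Away from the boundary every short shift is admissible, and t + √δ is bounded, so a Euclidean
  -- ball is large enough.
  · refine ⟨Metric.closedBall 0 t, Metric.isClosed_closedBall.measurableSet, ?_, ?_⟩
    · rw [volume_closedBall_eq _ ht.le]
      apply ENNReal.ofReal_le_ofReal
      have h1 : t + √(depth Ω ξ) ≤ E := by
        have h2 := hD ξ hξ
        rw [Real.norm_of_nonneg (depth_nonneg ξ)] at h2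
        have h3 : √(depth Ω ξ) ≤ √|D| := Real.sqrt_le_sqrt (h2.trans (le_abs_self D))
        have : t ≤ 1 := htt₀.trans ht₀1
        linarith
      calc min (unitVol d / E) (unitVol d / (2 * K + 7) * A) * (t ^ (d + 1) * (t + √(depth Ω ξ)))
          ≤ unitVol d / E * (t ^ (d + 1) * E) := by gcongr; exact min_le_left _ _
        _ = t ^ (d + 1) * unitVol d := by field_simp
    · intro z hz hρ s hs l hl0 hl1
      rw [mem_closedBall_zero_iff] at hs
      have hls : ‖l • s‖ ≤ t := by
        rw [norm_smul, Real.norm_of_nonneg hl0]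
        exact (mul_le_of_le_one_left (norm_nonneg s) hl1).trans hs
      have hzd : δ₀ / 2 ≤ depth Ω z := by
        have h1 := depth_le_add (Ω := Ω) z ξ
        have h2 := norm_sub_le_rhoDist (Ω := Ω) ξ z
        linarith
      have hmem : z + l • s ∈ Ω := by
        apply mem_of_norm_sub_lt_depth hΩ hz
        rw [sub_add_cancel_left, norm_neg]
        linarith
      refine ⟨hmem, ?_⟩
      have h3 := abs_sqrt_sub_sqrt_le_div (half_pos hδ₀0) hzd (depth_nonneg (Ω := Ω) (z + l • s))
      have h4 := abs_depth_sub_le (Ω := Ω) (z + l • s) z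
      rw [sub_add_cancel_left, norm_neg] at h4
      rw [rhoDist_eq, sub_add_cancel_left, norm_neg]
      have h5 : |√(depth Ω z) - √(depth Ω (z + l • s))| ≤ t / √(δ₀ / 2) :=
        h3.trans (div_le_div_of_nonneg_right (h4.trans hls) (Real.sqrt_nonneg _))
      have h6 : (1 + 1 / √(δ₀ / 2)) * t ≤
          max (B + (2 * C₁ + 1)) (1 + 1 / √(δ₀ / 2)) * t :=
        mul_le_mul_of_nonneg_right (le_max_right _ _) ht.le
      have h7 : (1 + 1 / √(δ₀ / 2)) * t = t + t / √(δ₀ / 2) := by ring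
      linarith
  push Not at hfar
  obtain ⟨p, hpf, hp⟩ := exists_frontier_norm_eq hΩ ⟨ξ, hξ⟩ ξ
  obtain ⟨Ψ, Ψ', e, h⟩ := hch p hpf
  set u := t + √(depth Ω ξ) with hu
  have hu0 : 0 < u := by positivity
  -- The thickness t(t + √δ) of the ρ_Ω-ball along the chart axis: large enough to push all nearby
  -- points inward, small enough to change √depth by O(t) only.
  set a := A * t * u with ha
  have ha0 : 0 < a := by positivity
  have hAu : A * u ≤ 1 / 2 := by
    have h1 : √(depth Ω ξ) ≤ 1 / (4 * A) :=
      Real.sqrt_le_iff.2 ⟨by positivity, hfar.le.trans hδ₀A⟩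
    have h2 : u ≤ 1 / (4 * A) + 1 / (4 * A) := by linarith
    calc A * u ≤ A * (1 / (4 * A) + 1 / (4 * A)) := by gcongr
      _ = 1 / 2 := by field_simp; norm_num
  have hat : 2 * a ≤ t := by
    have := mul_le_mul_of_nonneg_left hAu ht.le
    rw [ha]
    linarith
  have hξp : ‖ξ - p‖ < R / 16 := by rw [← hp]; linarith
  have hBt : B * t ≤ R / (8 * (K + 1)) := by
    have h1 := htt₀.trans ht₀R
    rw [le_div_iff₀ (by positivity)] at h1 ⊢
    linarith
  have hBt8 : B * t ≤ R / 8 := by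
    refine hBt.trans (div_le_div_of_nonneg_left hR.le (by positivity) (by linarith))
  refine ⟨{s : Ambient d | ‖s‖ ≤ B * t ∧ a ≤ Ψ' ξ s ∧ Ψ' ξ s ≤ 2 * a}, ?_, ?_, ?_⟩
  · apply IsClosed.measurableSet
    exact (isClosed_le continuous_norm continuous_const).inter
      ((isClosed_le continuous_const (Ψ' ξ).continuous).inter
        (isClosed_le (Ψ' ξ).continuous continuous_const))
  · refine le_trans (ENNReal.ofReal_le_ofReal ?_)
      (h.volume_slab_ge (by linarith) ht ha0 hat)
    calc min (unitVol d / E) (unitVol d / (2 * K + 7) * A) * (t ^ (d + 1) * u)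
        ≤ unitVol d / (2 * K + 7) * A * (t ^ (d + 1) * u) := by gcongr; exact min_le_right _ _
      _ = unitVol d / (2 * K + 7) * (t ^ d * a) := by rw [ha]; ring
  · rintro z hz hρ s ⟨hs1, hs2, hs3⟩ l hl0 hl1
    have hzξ : ‖z - ξ‖ ≤ κ * t := by
      rw [norm_sub_rev]; exact (norm_sub_le_rhoDist _ _).trans hρ
    have hsl : ‖l • s‖ = l * ‖s‖ := by rw [norm_smul, Real.norm_of_nonneg hl0]
    have hls : ‖l • s‖ ≤ l * (B * t) := by rw [hsl]; gcongr
    have hls' : ‖l • s‖ ≤ B * t := hls.trans (mul_le_of_le_one_left (by positivity) hl1)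
    have hzp : ‖z - p‖ < R / 8 := by
      have := norm_sub_le_norm_sub_add_norm_sub z ξ p
      linarith
    have hz'p : ‖z + l • s - p‖ < R / 4 := by
      rw [show z + l • s - p = (z - p) + l • s by abel]
      have := norm_add_le (z - p) (l • s)
      linarith
    have hzδ : depth Ω z < R / 8 ∧ depth Ω z ≤ 1 := by
      have := depth_le_add (Ω := Ω) ξ z
      constructor <;> linarith
    have htay := h.taylor ξ z (z + l • s) (by linarith) (by linarith) (by linarith)
    rw [add_sub_cancel_left, map_smul, smul_eq_mul] at htay
    have herr : M * ‖l • s‖ * (‖z - ξ‖ + ‖l • s‖) ≤ l * a := by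
      calc M * ‖l • s‖ * (‖z - ξ‖ + ‖l • s‖) ≤ M * (l * (B * t)) * (κ * t + B * t) := by gcongr
        _ = l * ((M * B * (κ + B)) * (t * t)) := by ring
        _ ≤ l * (A * (t * u)) := by
            apply mul_le_mul_of_nonneg_left _ hl0
            apply mul_le_mul (by linarith) _ (by positivity) hA0.le
            apply mul_le_mul_of_nonneg_left _ ht.le
            linarith
        _ = l * a := by rw [ha]; ring
    have hls2 : l * a ≤ l * Ψ' ξ s := by gcongr
    have hls3 : l * Ψ' ξ s ≤ 2 * a := (mul_le_of_le_one_left (ha0.le.trans hs2) hl1).trans hs3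
    have hla : l * a ≤ a := mul_le_of_le_one_left ha0.le hl1
    rw [abs_le] at htay
    have hΨz := (h.mem_iff z (by linarith)).1 hz
    have hmem : z + l • s ∈ Ω := by
      rw [h.mem_iff _ (by linarith)]
      linarith
    refine ⟨hmem, ?_⟩
    have hΔ : |Ψ (z + l • s) - Ψ z| ≤ 3 * a := by
      rw [abs_le]
      have := mul_nonneg hl0 ha0.le
      constructor <;> linarith
    have hd := h.abs_depth_sub_depth_le hΩ (by linarith : ‖z - p‖ < R / 4) hz'p hz hmem hzδ.1
      (by rw [add_sub_cancel_left]; exact hls'.trans hBt)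
    rw [add_sub_cancel_left] at hd
    have hw0 := Real.sqrt_nonneg (depth Ω z)
    set w := √(depth Ω z) with hw
    have hδw : depth Ω z ≤ w := le_sqrt_of_le_one (depth_nonneg z) hzδ.2
    have huw : u ≤ (1 + κ) * (t + w) := by
      have := (abs_le.1 ((abs_sqrt_depth_le_rhoDist (Ω := Ω) ξ z).trans hρ)).2
      have := mul_nonneg hκ.le hw0
      linarith
    have hd2 : |depth Ω (z + l • s) - depth Ω z| ≤ C₁ * t * (t + w) := by
      have h1 : 3 * a ≤ 3 * A * (1 + κ) * t * (t + w) := by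
        calc 3 * a = 3 * A * t * u := by rw [ha]; ring
          _ ≤ 3 * A * t * ((1 + κ) * (t + w)) := by gcongr
          _ = 3 * A * (1 + κ) * t * (t + w) := by ring
      have h2 : 2 * M * ‖l • s‖ * (depth Ω z + 2 * ‖l • s‖) ≤
          2 * M * B * (1 + 2 * B) * t * (t + w) := by
        calc 2 * M * ‖l • s‖ * (depth Ω z + 2 * ‖l • s‖)
            ≤ 2 * M * (B * t) * (w + 2 * (B * t)) := by
              have := depth_nonneg (Ω := Ω) z
              gcongr
          _ ≤ 2 * M * (B * t) * ((1 + 2 * B) * (t + w)) := by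
              gcongr
              have := mul_nonneg hB0.le hw0
              linarith
          _ = 2 * M * B * (1 + 2 * B) * t * (t + w) := by ring
      have h3 : C₁ * t * (t + w) = 3 * A * (1 + κ) * t * (t + w) +
          2 * M * B * (1 + 2 * B) * t * (t + w) := by rw [hC₁]; ring
      linarith
    rw [abs_sub_comm] at hd2
    have hfin := abs_sqrt_sub_sqrt_le (depth_nonneg z) (depth_nonneg _) ht.le hC₁0.le hd2
    rw [rhoDist_eq, sub_add_cancel_left, norm_neg]
    have h6 : (B + (2 * C₁ + 1)) * t ≤
        max (B + (2 * C₁ + 1)) (1 + 1 / √(δ₀ / 2)) * t :=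
      mul_le_mul_of_nonneg_right (le_max_left _ _) ht.le
    linarith

end Volume

/-! ### Algebra of finite differences -/

section DiffSum

variable {d : ℕ}

/-- The coefficients of the `r`-th difference. -/
def diffCoeff (r j : ℕ) : ℝ := (-1 : ℝ) ^ (r + j) * (r.choose j : ℝ)

/-- The `r`-th difference, without any restriction on the nodes. -/
noncomputable def diffSum (r : ℕ) (h : Ambient d) (f : Ambient d → ℝ) (z : Ambient d) : ℝ :=
  ∑ j ∈ Finset.range (r + 1), diffCoeff r j * f (z + (j : ℝ) • h)

lemma finDiff_of_subset {r : ℕ} {h : Ambient d} {f : Ambient d → ℝ} {Ω : Set (Ambient d)}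
    {z : Ambient d} (hs : segment ℝ z (z + (r : ℝ) • h) ⊆ Ω) :
    finDiff r h f Ω z = diffSum r h f z := by
  unfold finDiff; rw [if_pos hs]; rfl

lemma finDiff_of_not_subset {r : ℕ} {h : Ambient d} {f : Ambient d → ℝ} {Ω : Set (Ambient d)}
    {z : Ambient d} (hs : ¬ segment ℝ z (z + (r : ℝ) • h) ⊆ Ω) : finDiff r h f Ω z = 0 := by
  unfold finDiff; rw [if_neg hs]

lemma segment_add_subset_iff {z v : Ambient d} {Ω : Set (Ambient d)} :
    segment ℝ z (z + v) ⊆ Ω ↔ ∀ τ : ℝ, 0 ≤ τ → τ ≤ 1 → z + τ • v ∈ Ω := by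
  rw [segment_eq_image', add_sub_cancel_left, Set.image_subset_iff]
  exact ⟨fun h τ h0 h1 => h ⟨h0, h1⟩, fun h τ hτ => h τ hτ.1 hτ.2⟩

lemma abs_diffCoeff_le (r j : ℕ) : |diffCoeff r j| ≤ 2 ^ r := by
  rw [diffCoeff, abs_mul, abs_pow, abs_neg, abs_one, one_pow, one_mul, Nat.abs_cast]
  exact_mod_cast Nat.choose_le_two_pow r j

lemma sum_diffCoeff {r : ℕ} (hr : 1 ≤ r) : ∑ j ∈ Finset.range (r + 1), diffCoeff r j = 0 := by
  have h := Int.alternating_sum_range_choose (n := r)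
  rw [if_neg (by omega)] at h
  have h2 : ∑ m ∈ Finset.range (r + 1), (-1 : ℝ) ^ m * (r.choose m : ℝ) = 0 := by
    exact_mod_cast congrArg (Int.cast : ℤ → ℝ) h
  simp only [diffCoeff, pow_add, mul_assoc]
  rw [← Finset.mul_sum, h2, mul_zero]

lemma diffSum_zero {r : ℕ} (hr : 1 ≤ r) (f : Ambient d → ℝ) (z : Ambient d) :
    diffSum r 0 f z = 0 := by
  simp only [diffSum, smul_zero, add_zero]
  rw [← Finset.sum_mul, sum_diffCoeff hr, zero_mul]

/-- Summing the values of `f` at the nodes `z + j (h + i s)` in two ways. -/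
lemma sum_diffCoeff_mul_diffSum (r : ℕ) (h s : Ambient d) (f : Ambient d → ℝ) (z : Ambient d) :
    ∑ i ∈ Finset.range (r + 1), diffCoeff r i * diffSum r (h + (i : ℝ) • s) f z =
      ∑ j ∈ Finset.range (r + 1), diffCoeff r j * diffSum r ((j : ℝ) • s) f (z + (j : ℝ) • h) := by
  simp only [diffSum, Finset.mul_sum]
  rw [Finset.sum_comm]
  refine Finset.sum_congr rfl fun j _ => Finset.sum_congr rfl fun i _ => ?_
  rw [show z + (j : ℝ) • (h + (i : ℝ) • s) = z + (j : ℝ) • h + (i : ℝ) • (j : ℝ) • s by module]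
  ring

/-- In the double sum identity the term `i = 0` on the left is, up to sign, the wanted difference,
and the term `j = 0` on the right has step zero and vanishes because `1 ≤ r`. All remaining terms
depend on the free shift `s`. -/
lemma enorm_diffSum_le_sum {r : ℕ} (hr : 1 ≤ r) (h s : Ambient d) (f : Ambient d → ℝ)
    (z : Ambient d) :
    ‖diffSum r h f z‖ₑ ≤ 2 ^ r * ∑ i ∈ Finset.range r,
      (‖diffSum r (h + ((i + 1 : ℕ) : ℝ) • s) f z‖ₑ +
        ‖diffSum r (((i + 1 : ℕ) : ℝ) • s) f (z + ((i + 1 : ℕ) : ℝ) • h)‖ₑ) := by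
  have key := sum_diffCoeff_mul_diffSum r h s f z
  rw [Finset.sum_range_succ', Finset.sum_range_succ'] at key
  simp only [Nat.cast_zero, zero_smul, add_zero, diffSum_zero hr, mul_zero] at key
  have hc : ‖diffCoeff r 0‖ₑ = 1 := by
    simp [diffCoeff, enorm_pow]
  have hcle : ∀ j, ‖diffCoeff r j‖ₑ ≤ 2 ^ r := by
    intro j
    rw [Real.enorm_eq_ofReal_abs]
    refine (ENNReal.ofReal_le_ofReal (abs_diffCoeff_le r j)).trans ?_
    rw [ENNReal.ofReal_pow (by norm_num)]
    simp
  calc ‖diffSum r h f z‖ₑ = ‖diffCoeff r 0 * diffSum r h f z‖ₑ := by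
        rw [enorm_mul, hc, one_mul]
    _ = ‖∑ j ∈ Finset.range r, (diffCoeff r (j + 1) *
          diffSum r (((j + 1 : ℕ) : ℝ) • s) f (z + ((j + 1 : ℕ) : ℝ) • h) -
          diffCoeff r (j + 1) * diffSum r (h + ((j + 1 : ℕ) : ℝ) • s) f z)‖ₑ := by
        rw [Finset.sum_sub_distrib, ← key, add_sub_cancel_left]
    _ ≤ ∑ j ∈ Finset.range r, ‖diffCoeff r (j + 1) *
          diffSum r (((j + 1 : ℕ) : ℝ) • s) f (z + ((j + 1 : ℕ) : ℝ) • h) -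
          diffCoeff r (j + 1) * diffSum r (h + ((j + 1 : ℕ) : ℝ) • s) f z‖ₑ := enorm_sum_le _ _
    _ ≤ _ := by
        rw [Finset.mul_sum]
        refine Finset.sum_le_sum fun j _ => ?_
        rw [← mul_sub, enorm_mul]
        refine mul_le_mul' (hcle _) ?_
        exact enorm_sub_le.trans (add_comm _ _).le

open Polynomial in
/-- The difference with step `n h` is a combination of differences with step `h`. -/
lemma exists_diffSum_smul_eq (r n : ℕ) (hn : 1 ≤ n) : ∃ a : ℕ → ℝ,
    ∀ (h : Ambient d) (f : Ambient d → ℝ) (z : Ambient d), diffSum r ((n : ℝ) • h) f z =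
      ∑ k ∈ Finset.range (r * (n - 1) + 1), a k * diffSum r h f (z + (k : ℝ) • h) := by
  -- From (X^n - 1)^r = Q (X - 1)^r, the coefficients of Q are the weights.
  set Q : ℝ[X] := (∑ i ∈ Finset.range n, X ^ i) ^ r with hQ
  refine ⟨fun k => Q.coeff k, fun h f z => ?_⟩
  -- The functional X^k ↦ f(z + kh) turns polynomial identities into identities between differences.
  let Φ : ℝ[X] →ₗ[ℝ] ℝ := Polynomial.lsum fun k => LinearMap.mulRight ℝ (f (z + (k : ℝ) • h))
  have hΦ : ∀ (k : ℕ) (a : ℝ), Φ (monomial k a) = a * f (z + (k : ℝ) • h) := by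
    intro k a
    simp [Φ, Polynomial.lsum_apply, Polynomial.sum_monomial_index]
  have hexp : ∀ m k : ℕ, (X : ℝ[X]) ^ k * (X ^ m - 1) ^ r =
      ∑ j ∈ Finset.range (r + 1), monomial (k + m * j) (diffCoeff r j) := by
    intro m k
    rw [sub_pow, Finset.mul_sum]
    refine Finset.sum_congr rfl fun j _ => ?_
    rw [one_pow, mul_one, ← C_mul_X_pow_eq_monomial, diffCoeff, pow_add X, pow_mul X m j]
    simp only [map_mul, map_pow, map_neg, map_one, map_natCast]
    rw [add_comm r j]
    ring
  have h1 : Φ ((X ^ n - 1) ^ r) = diffSum r ((n : ℝ) • h) f z := by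
    have := hexp n 0
    rw [pow_zero, one_mul] at this
    rw [this, map_sum, diffSum]
    refine Finset.sum_congr rfl fun j _ => ?_
    rw [hΦ, zero_add, Nat.cast_mul, mul_comm (n : ℝ), mul_smul]
  have h2 : ∀ k : ℕ, Φ (X ^ k * (X - 1) ^ r) = diffSum r h f (z + (k : ℝ) • h) := by
    intro k
    have := hexp 1 k
    rw [pow_one] at this
    rw [this, map_sum, diffSum]
    refine Finset.sum_congr rfl fun j _ => ?_
    rw [hΦ, one_mul, Nat.cast_add, add_smul, add_assoc]
  have hdeg : Q.natDegree < r * (n - 1) + 1 := by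
    rw [Nat.lt_succ_iff]
    refine natDegree_pow_le.trans (Nat.mul_le_mul_left _ ?_)
    refine natDegree_sum_le_of_forall_le _ _ fun i hi => ?_
    rw [natDegree_X_pow]
    have := Finset.mem_range.1 hi
    omega
  have h3 : ((X : ℝ[X]) ^ n - 1) ^ r = ∑ k ∈ Finset.range (r * (n - 1) + 1),
      Q.coeff k • (X ^ k * (X - 1) ^ r) := by
    rw [← geom_sum_mul, mul_pow, ← hQ]
    conv_lhs => rw [Q.as_sum_range' _ hdeg, Finset.sum_mul]
    refine Finset.sum_congr rfl fun k _ => ?_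
    rw [← C_mul_X_pow_eq_monomial, ← C_mul', mul_assoc]
  rw [← h1, h3, map_sum]
  refine Finset.sum_congr rfl fun k _ => ?_
  rw [map_smul, h2, smul_eq_mul]

end DiffSum

/-! ### Averaging a difference over a set of shifts -/

section Averaging

variable {d : ℕ}

lemma map_add_smul_volume (w : Ambient d) {α : ℝ} (hα : α ≠ 0) :
    Measure.map (fun s : Ambient d => w + α • s) volume =
      ENNReal.ofReal |(α ^ (d + 1))⁻¹| • volume := by
  have h1 : (fun s : Ambient d => w + α • s) = (fun x => w + x) ∘ (fun s => α • s) := rfl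
  rw [h1, ← Measure.map_map (by fun_prop) (by fun_prop), Measure.map_addHaar_smul _ hα,
    Measure.map_smul, (measurePreserving_add_left volume w).map_eq, finrank_euclideanSpace_fin]

lemma measurableEmbedding_add_smul (w : Ambient d) {α : ℝ} (hα : α ≠ 0) :
    MeasurableEmbedding (fun s : Ambient d => w + α • s) :=
  ((Homeomorph.smulOfNeZero α hα).trans (Homeomorph.addLeft w)).measurableEmbedding

lemma quasiMeasurePreserving_add_smul (w : Ambient d) {α : ℝ} (hα : α ≠ 0) :
    Measure.QuasiMeasurePreserving (fun s : Ambient d => w + α • s) volume volume := by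
  refine ⟨by fun_prop, ?_⟩
  rw [map_add_smul_volume w hα]
  exact Measure.smul_absolutelyContinuous

lemma aemeasurable_comp_add_smul {f : Ambient d → ℝ} {Ω S : Set (Ambient d)}
    (hf : AEMeasurable f (volume.restrict Ω)) (w : Ambient d) (α : ℝ)
    (h : ∀ s ∈ S, w + α • s ∈ Ω) :
    AEMeasurable (fun s => f (w + α • s)) (volume.restrict S) := by
  rcases eq_or_ne α 0 with rfl | hα
  · simp only [zero_smul, add_zero]
    exact aemeasurable_const
  · exact hf.comp_quasiMeasurePreserving ((quasiMeasurePreserving_add_smul w hα).restrict h)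

/-- The Jacobian factor `α ^ -(d + 1)` is at most 1. The map is a measurable embedding, so nothing
is asked of `F`. -/
lemma setLIntegral_comp_add_smul_le {S U : Set (Ambient d)}
    (w : Ambient d) {α : ℝ} (hα : 1 ≤ α) (h : ∀ s ∈ S, w + α • s ∈ U)
    (F : Ambient d → ℝ≥0∞) : ∫⁻ s in S, F (w + α • s) ≤ ∫⁻ η in U, F η := by
  have hα0 : α ≠ 0 := by linarith
  have hemb := measurableEmbedding_add_smul w hα0
  calc ∫⁻ s in S, F (w + α • s)
      ≤ ∫⁻ s in (fun s => w + α • s) ⁻¹' U, F (w + α • s) := lintegral_mono_set h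
    _ = ∫⁻ η in U, F η ∂(Measure.map (fun s : Ambient d => w + α • s) volume) := by
        rw [← hemb.lintegral_map, hemb.restrict_map]
    _ = ENNReal.ofReal |(α ^ (d + 1))⁻¹| * ∫⁻ η in U, F η := by
        rw [map_add_smul_volume w hα0, Measure.restrict_smul, lintegral_smul_measure, smul_eq_mul]
    _ ≤ 1 * ∫⁻ η in U, F η := by
        gcongr
        rw [ENNReal.ofReal_le_one, abs_of_nonneg (by positivity)]
        exact inv_le_one_of_one_le₀ (one_le_pow₀ hα)
    _ = _ := one_mul _

/-- Bounding every term by the largest one treats `p < 1` and `p ≥ 1` alike, at the cost of a cruder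
constant. -/
lemma sum_rpow_le_card_mul {ι : Type*} (s : Finset ι) (a : ι → ℝ≥0∞) {p : ℝ} (hp : 0 < p) :
    (∑ i ∈ s, a i) ^ p ≤ (s.card : ℝ≥0∞) ^ p * ∑ i ∈ s, a i ^ p := by
  rcases s.eq_empty_or_nonempty with rfl | hne
  · simp [hp]
  obtain ⟨m, hm, hmax⟩ := s.exists_max_image a hne
  calc (∑ i ∈ s, a i) ^ p ≤ (s.card * a m) ^ p := by
        gcongr
        rw [← nsmul_eq_mul]
        exact Finset.sum_le_card_nsmul _ _ _ hmax
    _ = (s.card : ℝ≥0∞) ^ p * a m ^ p := ENNReal.mul_rpow_of_nonneg _ _ hp.le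
    _ ≤ _ := by
        gcongr
        exact Finset.single_le_sum (f := fun i => a i ^ p) (fun _ _ => zero_le) hm

lemma add_rpow_le_two_mul (a b : ℝ≥0∞) {p : ℝ} (hp : 0 < p) :
    (a + b) ^ p ≤ 2 ^ p * (a ^ p + b ^ p) := by
  have := sum_rpow_le_card_mul (Finset.univ : Finset Bool) (fun i => if i then a else b) hp
  simpa using this

lemma sum_rpow_rpow_inv_le {ι : Type*} (s : Finset ι) (a : ι → ℝ≥0∞) {p : ℝ} (hp : 0 < p) :
    (∑ i ∈ s, a i ^ p) ^ (1 / p) ≤ (s.card : ℝ≥0∞) ^ (1 / p) * ∑ i ∈ s, a i := by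
  refine (sum_rpow_le_card_mul s (fun i => a i ^ p) (by positivity)).trans (le_of_eq ?_)
  congr 1
  refine Finset.sum_congr rfl fun i _ => ?_
  rw [one_div, ENNReal.rpow_rpow_inv hp.ne']

lemma setLIntegral_eq_volume_mul_localAverage {r : ℕ} {q : ℝ≥0∞} (hq0 : q ≠ 0) (hq : q ≠ ∞)
    {Ω : Set (Ambient d)} {f : Ambient d → ℝ} {ξ : Ambient d} {t : ℝ}
    (hU : volume (rhoBall Ω ξ t) ≠ ∞) :
    ∫⁻ η in rhoBall Ω ξ t, ‖finDiff r ((r : ℝ)⁻¹ • (η - ξ)) f Ω ξ‖ₑ ^ q.toReal =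
      volume (rhoBall Ω ξ t) * localAverage r q Ω f ξ t ^ q.toReal := by
  have hqr := ENNReal.toReal_pos hq0 hq
  rw [localAverage, if_neg hq, one_div, ENNReal.rpow_inv_rpow hqr.ne']
  rcases eq_or_ne (volume (rhoBall Ω ξ t)) 0 with h0 | h0
  · rw [h0, zero_mul, Measure.restrict_eq_zero.2 h0, lintegral_zero_measure]
  · rw [← mul_assoc, ENNReal.mul_inv_cancel h0 hU, one_mul]

/-- Needed to split integrals of sums over `S`. As `f` is controlled on `Ω` only, the nodes have to
stay there; the node `l = 0` does not move with `s`. -/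
lemma aemeasurable_diffSum_affine {f : Ambient d → ℝ} {Ω S : Set (Ambient d)} {r : ℕ}
    (hr : 1 ≤ r) (hf : AEMeasurable f (volume.restrict Ω)) (z h : Ambient d) (β : ℝ)
    (hs : ∀ s ∈ S, segment ℝ z (z + (r : ℝ) • (h + β • s)) ⊆ Ω) :
    AEMeasurable (fun s => diffSum r (h + β • s) f z) (volume.restrict S) := by
  unfold diffSum
  refine Finset.aemeasurable_fun_sum _ fun l hl => AEMeasurable.const_mul ?_ _
  have e : ∀ s : Ambient d, z + (l : ℝ) • (h + β • s) =
      (z + (l : ℝ) • h) + ((l : ℝ) * β) • s := fun s => by module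
  simp only [e]
  refine aemeasurable_comp_add_smul hf _ _ fun s hsS => ?_
  rw [← e]
  have hr0 : (0 : ℝ) < r := by exact_mod_cast hr
  have hlr : (l : ℝ) ≤ r := by exact_mod_cast Nat.lt_succ_iff.1 (Finset.mem_range.1 hl)
  have := segment_add_subset_iff.1 (hs s hsS) ((l : ℝ) / r) (by positivity)
    ((div_le_one hr0).2 hlr)
  rwa [smul_smul, div_mul_cancel₀ _ hr0.ne'] at this

/-- If the shifts `s ∈ S` keep all the nodes in `Ω` and in the respective balls, then a difference
is bounded by local averages. -/
lemma enorm_diffSum_le_of_shift_set {r : ℕ} (hr : 1 ≤ r) {q : ℝ≥0∞} (hq0 : q ≠ 0) (hq : q ≠ ∞)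
    {Ω S : Set (Ambient d)} (hS : MeasurableSet S) {f : Ambient d → ℝ}
    (hf : AEMeasurable f (volume.restrict Ω))
    {z h : Ambient d} {T : ℝ} {V : ℝ≥0} (hS0 : volume S ≠ 0) (hS1 : volume S ≠ ∞)
    (hV : ∀ j : ℕ, j ≤ r → volume (rhoBall Ω (z + (j : ℝ) • h) T) ≤ V * volume S)
    (hseg1 : ∀ s ∈ S, ∀ i : ℕ, i < r →
      segment ℝ z (z + (r : ℝ) • (h + ((i + 1 : ℕ) : ℝ) • s)) ⊆ Ω ∧
        z + (r : ℝ) • (h + ((i + 1 : ℕ) : ℝ) • s) ∈ rhoBall Ω z T)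
    (hseg2 : ∀ s ∈ S, ∀ i : ℕ, i < r →
      segment ℝ (z + ((i + 1 : ℕ) : ℝ) • h)
        (z + ((i + 1 : ℕ) : ℝ) • h + (r : ℝ) • ((i + 1 : ℕ) : ℝ) • s) ⊆ Ω ∧
        z + ((i + 1 : ℕ) : ℝ) • h + (r : ℝ) • ((i + 1 : ℕ) : ℝ) • s ∈
          rhoBall Ω (z + ((i + 1 : ℕ) : ℝ) • h) T) :
    ‖diffSum r h f z‖ₑ ≤
      ((2 ^ r : ℝ≥0∞) * ((2 * r : ℕ) : ℝ≥0∞) * ((2 * r * V : ℝ≥0) : ℝ≥0∞) ^ (1 / q.toReal) *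
        ((r + 1 : ℕ) : ℝ≥0∞) ^ (1 / q.toReal)) *
      ∑ j ∈ Finset.range (r + 1), localAverage r q Ω f (z + (j : ℝ) • h) T := by
  have hqr := ENNReal.toReal_pos hq0 hq
  set Q := q.toReal with hQ
  have hr0 : (r : ℝ) ≠ 0 := by positivity
  set w : ℕ → ℝ≥0∞ := fun j => localAverage r q Ω f (z + (j : ℝ) • h) T with hw
  set W := ∑ j ∈ Finset.range (r + 1), w j ^ Q with hW
  have hwW : ∀ j, j ≤ r → w j ^ Q ≤ W := fun j hj =>
    Finset.single_le_sum (f := fun j => w j ^ Q) (fun _ _ => zero_le)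
      (Finset.mem_range.2 (Nat.lt_succ_of_le hj))
  have hVtop : ∀ j : ℕ, j ≤ r → volume (rhoBall Ω (z + (j : ℝ) • h) T) ≠ ∞ := fun j hj =>
    ((hV j hj).trans_lt (ENNReal.mul_lt_top ENNReal.coe_lt_top hS1.lt_top)).ne
  set F1 : ℕ → Ambient d → ℝ≥0∞ := fun i s =>
    ‖diffSum r (h + ((i + 1 : ℕ) : ℝ) • s) f z‖ₑ with hF1
  set F2 : ℕ → Ambient d → ℝ≥0∞ := fun i s =>
    ‖diffSum r (((i + 1 : ℕ) : ℝ) • s) f (z + ((i + 1 : ℕ) : ℝ) • h)‖ₑ with hF2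
  have hα : ∀ i : ℕ, (1 : ℝ) ≤ (r : ℝ) * ((i + 1 : ℕ) : ℝ) := by
    intro i
    have : 1 ≤ r * (i + 1) := Nat.mul_pos hr (Nat.succ_pos i)
    exact_mod_cast this
  have hI : ∀ (ζ : Ambient d) (j : ℕ), j ≤ r → ζ = z + (j : ℝ) • h →
      ∫⁻ η in rhoBall Ω ζ T, ‖finDiff r ((r : ℝ)⁻¹ • (η - ζ)) f Ω ζ‖ₑ ^ Q ≤
        V * volume S * W := by
    rintro ζ j hj rfl
    rw [setLIntegral_eq_volume_mul_localAverage hq0 hq (hVtop j hj)]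
    exact mul_le_mul' (hV j hj) (hwW j hj)
  -- As a function of `s`, the far end of the segment is affine with ratio `r (i + 1) ≥ 1` and lands
  -- in the ball about `z`; the difference is then the integrand of the local average there.
  have hb1 : ∀ i, i < r → ∫⁻ s in S, F1 i s ^ Q ≤ V * volume S * W := by
    intro i hi
    refine le_trans ?_ (hI z 0 (Nat.zero_le _) (by simp))
    have hmaps : ∀ s ∈ S, (z + (r : ℝ) • h) + ((r : ℝ) * ((i + 1 : ℕ) : ℝ)) • s ∈
        rhoBall Ω z T := by
      intro s hs
      have := (hseg1 s hs i hi).2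
      rwa [show z + (r : ℝ) • (h + ((i + 1 : ℕ) : ℝ) • s) =
        (z + (r : ℝ) • h) + ((r : ℝ) * ((i + 1 : ℕ) : ℝ)) • s by module] at this
    refine le_trans (le_of_eq ?_) (setLIntegral_comp_add_smul_le
      (z + (r : ℝ) • h) (hα i) hmaps _)
    refine setLIntegral_congr_fun hS fun s hs => ?_
    have e1 : (r : ℝ)⁻¹ • ((z + (r : ℝ) • h) + ((r : ℝ) * ((i + 1 : ℕ) : ℝ)) • s - z) =
        h + ((i + 1 : ℕ) : ℝ) • s := by
      rw [show (z + (r : ℝ) • h) + ((r : ℝ) * ((i + 1 : ℕ) : ℝ)) • s - z =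
        (r : ℝ) • (h + ((i + 1 : ℕ) : ℝ) • s) by module, inv_smul_smul₀ hr0]
    simp only [hF1]
    rw [e1, finDiff_of_subset (hseg1 s hs i hi).1]
  have hb2 : ∀ i, i < r → ∫⁻ s in S, F2 i s ^ Q ≤ V * volume S * W := by
    intro i hi
    set ζ := z + ((i + 1 : ℕ) : ℝ) • h with hζ
    refine le_trans ?_ (hI ζ (i + 1) hi rfl)
    have hmaps : ∀ s ∈ S, ζ + ((r : ℝ) * ((i + 1 : ℕ) : ℝ)) • s ∈ rhoBall Ω ζ T := by
      intro s hs
      have := (hseg2 s hs i hi).2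
      rwa [smul_smul] at this
    refine le_trans (le_of_eq ?_) (setLIntegral_comp_add_smul_le ζ (hα i) hmaps _)
    refine setLIntegral_congr_fun hS fun s hs => ?_
    have e1 : (r : ℝ)⁻¹ • (ζ + ((r : ℝ) * ((i + 1 : ℕ) : ℝ)) • s - ζ) =
        ((i + 1 : ℕ) : ℝ) • s := by
      rw [add_sub_cancel_left, mul_smul, inv_smul_smul₀ hr0]
    simp only [hF2]
    rw [e1, finDiff_of_subset (hseg2 s hs i hi).1]
  have hm1 : ∀ i, i < r → AEMeasurable (fun s => F1 i s ^ Q) (volume.restrict S) := fun i hi =>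
    (aemeasurable_diffSum_affine hr hf z h _ fun s hs => (hseg1 s hs i hi).1).enorm.pow_const Q
  have hm2 : ∀ i, i < r → AEMeasurable (fun s => F2 i s ^ Q) (volume.restrict S) := by
    intro i hi
    have := aemeasurable_diffSum_affine (S := S) hr hf (z + ((i + 1 : ℕ) : ℝ) • h) 0
      ((i + 1 : ℕ) : ℝ) fun s hs => by rw [zero_add]; exact (hseg2 s hs i hi).1
    simp only [zero_add] at this
    exact this.enorm.pow_const Q
  set c : ℝ≥0∞ := (2 ^ r) ^ Q * ((r : ℝ≥0∞) ^ Q * 2 ^ Q) with hc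
  have hpt : ∀ s, ‖diffSum r h f z‖ₑ ^ Q ≤
      c * ∑ i ∈ Finset.range r, (F1 i s ^ Q + F2 i s ^ Q) := by
    intro s
    calc ‖diffSum r h f z‖ₑ ^ Q
        ≤ (2 ^ r * ∑ i ∈ Finset.range r, (F1 i s + F2 i s)) ^ Q := by
          gcongr
          exact enorm_diffSum_le_sum hr h s f z
      _ = (2 ^ r) ^ Q * (∑ i ∈ Finset.range r, (F1 i s + F2 i s)) ^ Q :=
          ENNReal.mul_rpow_of_nonneg _ _ hqr.le
      _ ≤ (2 ^ r) ^ Q * ((r : ℝ≥0∞) ^ Q * ∑ i ∈ Finset.range r, (F1 i s + F2 i s) ^ Q) := by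
          gcongr
          have := sum_rpow_le_card_mul (Finset.range r) (fun i => F1 i s + F2 i s) hqr
          rwa [Finset.card_range] at this
      _ ≤ (2 ^ r) ^ Q * ((r : ℝ≥0∞) ^ Q *
            ∑ i ∈ Finset.range r, 2 ^ Q * (F1 i s ^ Q + F2 i s ^ Q)) := by
          gcongr
          exact add_rpow_le_two_mul _ _ hqr
      _ = c * ∑ i ∈ Finset.range r, (F1 i s ^ Q + F2 i s ^ Q) := by
          rw [← Finset.mul_sum, hc]; ring
  have hctop : c ≠ ∞ := by
    rw [hc]
    have h1 : ((2 : ℝ≥0∞) ^ r) ^ Q ≠ ∞ := ENNReal.rpow_ne_top_of_nonneg hqr.le (by finiteness)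
    have h2 : ((r : ℝ≥0∞)) ^ Q ≠ ∞ := ENNReal.rpow_ne_top_of_nonneg hqr.le (by finiteness)
    have h3 : (2 : ℝ≥0∞) ^ Q ≠ ∞ := ENNReal.rpow_ne_top_of_nonneg hqr.le (by finiteness)
    finiteness
  -- The left side does not depend on `s`; integration over `S` produces `volume S` on both sides,
  -- which cancels because it is neither 0 nor ∞.
  have hint : ‖diffSum r h f z‖ₑ ^ Q * volume S ≤
      c * ((2 * r * V : ℝ≥0) : ℝ≥0∞) * W * volume S := by
    calc ‖diffSum r h f z‖ₑ ^ Q * volume S = ∫⁻ _ in S, ‖diffSum r h f z‖ₑ ^ Q := by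
          rw [setLIntegral_const]
      _ ≤ ∫⁻ s in S, c * ∑ i ∈ Finset.range r, (F1 i s ^ Q + F2 i s ^ Q) :=
          lintegral_mono hpt
      _ = c * ∑ i ∈ Finset.range r, ∫⁻ s in S, (F1 i s ^ Q + F2 i s ^ Q) := by
          rw [lintegral_const_mul' _ _ hctop, lintegral_finsetSum']
          intro i hi
          exact (hm1 i (Finset.mem_range.1 hi)).add (hm2 i (Finset.mem_range.1 hi))
      _ ≤ c * ∑ i ∈ Finset.range r, (V * volume S * W + V * volume S * W) := by
          gcongr with i hi
          have hi' := Finset.mem_range.1 hi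
          rw [lintegral_add_left' (hm1 i hi')]
          exact add_le_add (hb1 i hi') (hb2 i hi')
      _ = c * ((2 * r * V : ℝ≥0) : ℝ≥0∞) * W * volume S := by
          rw [Finset.sum_const, Finset.card_range, nsmul_eq_mul]
          push_cast
          ring
  rw [ENNReal.mul_le_mul_iff_left hS0 hS1] at hint
  calc ‖diffSum r h f z‖ₑ = (‖diffSum r h f z‖ₑ ^ Q) ^ (1 / Q) := by
        rw [one_div, ENNReal.rpow_rpow_inv hqr.ne']
    _ ≤ (c * ((2 * r * V : ℝ≥0) : ℝ≥0∞) * W) ^ (1 / Q) := by gcongr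
    _ = c ^ (1 / Q) * ((2 * r * V : ℝ≥0) : ℝ≥0∞) ^ (1 / Q) * W ^ (1 / Q) := by
        rw [ENNReal.mul_rpow_of_nonneg _ _ (by positivity),
          ENNReal.mul_rpow_of_nonneg _ _ (by positivity)]
    _ = (2 ^ r * ((2 * r : ℕ) : ℝ≥0∞)) * ((2 * r * V : ℝ≥0) : ℝ≥0∞) ^ (1 / Q) *
          W ^ (1 / Q) := by
        congr 2
        rw [hc, ← ENNReal.mul_rpow_of_nonneg _ _ hqr.le, ← ENNReal.mul_rpow_of_nonneg _ _ hqr.le,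
          one_div, ENNReal.rpow_rpow_inv hqr.ne']
        push_cast
        ring
    _ ≤ (2 ^ r * ((2 * r : ℕ) : ℝ≥0∞)) * ((2 * r * V : ℝ≥0) : ℝ≥0∞) ^ (1 / Q) *
          (((r + 1 : ℕ) : ℝ≥0∞) ^ (1 / Q) * ∑ j ∈ Finset.range (r + 1), w j) := by
        gcongr
        have := sum_rpow_rpow_inv_le (Finset.range (r + 1)) w hqr
        rwa [Finset.card_range] at this
    _ = _ := by ring

end Averaging

/-! ### Pointwise bound for short segments -/

section Pointwise

variable {d : ℕ} {Ω : Set (Ambient d)}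

/-- A difference whose segment is short in the metric `ρ_Ω` is bounded by local averages. -/
lemma exists_enorm_diffSum_le (hΩ : IsCompact Ω) {R M K : ℝ} (hR : 0 < R) (hM : 0 ≤ M)
    (hK : 0 ≤ K) (hch : HasUniformCharts Ω R M K) {r : ℕ} (hr : 1 ≤ r) {κ : ℝ} (hκ : 0 < κ) :
    ∃ t₀ : ℝ, 0 < t₀ ∧ t₀ ≤ 1 ∧ ∃ lam₀ : ℝ, 0 < lam₀ ∧ ∀ lam : ℝ, lam₀ ≤ lam → ∀ q : ℝ≥0∞, q ≠ 0 →
      q ≠ ∞ → ∃ C : ℝ≥0, ∀ f : Ambient d → ℝ, AEMeasurable f (volume.restrict Ω) →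
        ∀ t, 0 < t → t ≤ t₀ → ∀ z h : Ambient d,
        (∀ τ : ℝ, 0 ≤ τ → τ ≤ 1 → z + τ • (r : ℝ) • h ∈ Ω ∧
          rhoDist Ω z (z + τ • (r : ℝ) • h) ≤ κ * t) →
        ‖diffSum r h f z‖ₑ ≤
          C * ∑ j ∈ Finset.range (r + 1), localAverage r q Ω f (z + (j : ℝ) • h) (lam * t) := by
  obtain ⟨t₀, ht₀, ht₀1, C₁, hC₁, c, hc, hS⟩ := exists_shift_set hΩ hR hM hK hch hκ
  obtain ⟨Cu, hCu, hU⟩ := exists_volume_rhoBall_le hΩ hR hK hch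
  have hr0 : (0 : ℝ) < r := by exact_mod_cast hr
  -- Each far end is reached by going along the given segment, at cost `κ t`, and then along a
  -- shift, at cost `C₁ t`.
  refine ⟨t₀, ht₀, ht₀1, κ + C₁, by positivity, fun lam hlam q hq0 hq => ?_⟩
  have hlam0 : 0 < lam := by linarith
  -- The bound for a ball of radius `lam * t` about a node, divided by the lower bound for the
  -- volume of the rescaled shift set; t and the depth cancel.
  set V : ℝ := Cu * lam ^ (d + 1) * (lam + κ + 1) * ((r : ℝ) ^ 2) ^ (d + 1) / c with hV
  have hV0 : 0 < V := by positivity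
  set C : ℝ≥0∞ := ((2 ^ r : ℝ≥0∞) * ((2 * r : ℕ) : ℝ≥0∞) *
    ((2 * r * V.toNNReal : ℝ≥0) : ℝ≥0∞) ^ (1 / q.toReal) *
        ((r + 1 : ℕ) : ℝ≥0∞) ^ (1 / q.toReal)) with hC
  have hCtop : C ≠ ∞ := by
    have hq' : 0 ≤ 1 / q.toReal := by positivity
    have h1 : ((2 * r * V.toNNReal : ℝ≥0) : ℝ≥0∞) ^ (1 / q.toReal) ≠ ∞ :=
      ENNReal.rpow_ne_top_of_nonneg hq' ENNReal.coe_ne_top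
    have h2 : ((r + 1 : ℕ) : ℝ≥0∞) ^ (1 / q.toReal) ≠ ∞ :=
      ENNReal.rpow_ne_top_of_nonneg hq' (ENNReal.natCast_ne_top _)
    have h3 : ((2 : ℝ≥0∞) ^ r) ≠ ∞ := by finiteness
    have h4 : ((2 * r : ℕ) : ℝ≥0∞) ≠ ∞ := ENNReal.natCast_ne_top _
    exact ENNReal.mul_ne_top (ENNReal.mul_ne_top (ENNReal.mul_ne_top h3 h4) h1) h2
  refine ⟨C.toNNReal, fun f hf t ht htt₀ z h hgood => ?_⟩
  rw [ENNReal.coe_toNNReal hCtop]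
  have hz : z ∈ Ω := by simpa using (hgood 0 le_rfl zero_le_one).1
  obtain ⟨S₀, hS₀m, hS₀v, hS₀⟩ := hS t ht htt₀ z hz
  have hr2 : ((r : ℝ) ^ 2) ≠ 0 := by positivity
  -- The differences move points by multiples of `s` up to `r²`, so the shifts are scaled down to
  -- keep all of these fractions of an element of `S₀`.
  set S : Set (Ambient d) := (fun s => (r : ℝ) ^ 2 • s) ⁻¹' S₀ with hSdef
  have hSm : MeasurableSet S := hS₀m.preimage (by fun_prop)
  have hSv : volume S = ENNReal.ofReal (((r : ℝ) ^ 2) ^ (d + 1))⁻¹ * volume S₀ := by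
    rw [hSdef, Measure.addHaar_preimage_smul _ hr2, finrank_euclideanSpace_fin,
      abs_of_nonneg (by positivity)]
  have hs := Real.sqrt_nonneg (depth Ω z)
  set u := t + √(depth Ω z) with hu
  have hu0 : 0 < u := by positivity
  have hS0 : volume S ≠ 0 := by
    rw [hSv]
    refine mul_ne_zero (by simp only [ne_eq, ENNReal.ofReal_eq_zero, not_le]; positivity) ?_
    exact (lt_of_lt_of_le (ENNReal.ofReal_pos.2 (by positivity)) hS₀v).ne'
  have hS1 : volume S ≠ ∞ := by
    rw [hSv]
    refine ENNReal.mul_ne_top ENNReal.ofReal_ne_top ?_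
    -- Finiteness of the volume: `z` itself may be shifted, so a translate of `S₀` lies in the
    -- compact set `Ω`.
    have hsub : S₀ ⊆ (fun s => z + s) ⁻¹' Ω := by
      intro s hs
      have := (hS₀ z hz (by simpa [rhoDist] using (by positivity : 0 ≤ κ * t)) s hs 1
        zero_le_one le_rfl).1
      rwa [one_smul] at this
    refine ((measure_mono hsub).trans_lt ?_).ne
    rw [measure_preimage_add]
    exact hΩ.measure_lt_top
  have hnode : ∀ (τ : ℝ), 0 ≤ τ → τ ≤ 1 → ∀ s ∈ S, ∀ l : ℝ, 0 ≤ l → l ≤ 1 →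
      z + τ • (r : ℝ) • h + l • (r : ℝ) ^ 2 • s ∈ Ω ∧
        rhoDist Ω (z + τ • (r : ℝ) • h) (z + τ • (r : ℝ) • h + l • (r : ℝ) ^ 2 • s) ≤ C₁ * t :=
    fun τ h0 h1 s hs l hl0 hl1 =>
      hS₀ _ (hgood τ h0 h1).1 (hgood τ h0 h1).2 _ hs l hl0 hl1
  have hratio : ∀ i : ℕ, i < r → ((i + 1 : ℕ) : ℝ) / r ≤ 1 := fun i hi =>
    (div_le_one hr0).2 (by exact_mod_cast hi)
  refine enorm_diffSum_le_of_shift_set hr hq0 hq hSm hf hS0 hS1 ?_ ?_ ?_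
  · intro j hj
    have hj1 : (j : ℝ) / r ≤ 1 := (div_le_one hr0).2 (by exact_mod_cast hj)
    have e1 : z + ((j : ℝ) / r) • (r : ℝ) • h = z + (j : ℝ) • h := by
      rw [smul_smul, div_mul_cancel₀ _ hr0.ne']
    have hg := hgood ((j : ℝ) / r) (by positivity) hj1
    rw [e1] at hg
    refine (hU (lam * t) (by positivity) _ hg.1).trans ?_
    have hw : √(depth Ω (z + (j : ℝ) • h)) ≤ √(depth Ω z) + κ * t := by
      have := (abs_le.1 ((abs_sqrt_depth_le_rhoDist _ _).trans hg.2)).1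
      linarith
    have h1 : lam * t + √(depth Ω (z + (j : ℝ) • h)) ≤ (lam + κ + 1) * u := by
      have a1 := mul_nonneg hlam0.le hs
      have a2 := mul_nonneg hκ.le hs
      have : (lam + κ + 1) * u = lam * t + κ * t + t + lam * √(depth Ω z) + κ * √(depth Ω z) +
        √(depth Ω z) := by rw [hu]; ring
      linarith
    calc ENNReal.ofReal (Cu * ((lam * t) ^ (d + 1) * (lam * t + √(depth Ω (z + (j : ℝ) • h)))))
        ≤ ENNReal.ofReal (Cu * ((lam * t) ^ (d + 1) * ((lam + κ + 1) * u))) := by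
          apply ENNReal.ofReal_le_ofReal
          gcongr
      _ = ENNReal.ofReal V * (ENNReal.ofReal (((r : ℝ) ^ 2) ^ (d + 1))⁻¹ *
            ENNReal.ofReal (c * (t ^ (d + 1) * u))) := by
          rw [← ENNReal.ofReal_mul (by positivity), ← ENNReal.ofReal_mul hV0.le]
          congr 1
          rw [hV, mul_pow lam t]
          field_simp
      _ ≤ (V.toNNReal : ℝ≥0∞) * volume S := by
          rw [hSv]
          exact mul_le_mul' le_rfl (mul_le_mul' le_rfl hS₀v)
  · intro s hs i hi
    have key : ∀ τ : ℝ, 0 ≤ τ → τ ≤ 1 →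
        z + τ • (r : ℝ) • (h + ((i + 1 : ℕ) : ℝ) • s) =
        z + τ • (r : ℝ) • h + (τ * (((i + 1 : ℕ) : ℝ) / r)) • (r : ℝ) ^ 2 • s := by
      intro τ _ _
      rw [smul_smul (τ * _), show τ * (((i + 1 : ℕ) : ℝ) / r) * (r : ℝ) ^ 2 =
        τ * (r * ((i + 1 : ℕ) : ℝ)) by field_simp]
      module
    have hnn : 0 ≤ ((i + 1 : ℕ) : ℝ) / r := by positivity
    refine ⟨segment_add_subset_iff.2 fun τ h0 h1 => ?_, ?_⟩
    · rw [key τ h0 h1]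
      exact (hnode τ h0 h1 s hs _ (by positivity) (mul_le_one₀ h1 hnn (hratio i hi))).1
    · have k1 := key 1 zero_le_one le_rfl
      rw [one_smul, one_mul] at k1
      have hn := hnode 1 zero_le_one le_rfl s hs _ hnn (hratio i hi)
      rw [← k1] at hn
      refine ⟨hn.1, ?_⟩
      have := rhoDist_triangle (Ω := Ω) z (z + (1 : ℝ) • (r : ℝ) • h)
        (z + (r : ℝ) • (h + ((i + 1 : ℕ) : ℝ) • s))
      have h2 := (hgood 1 zero_le_one le_rfl).2
      nlinarith [hn.2]
  · intro s hs i hi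
    have hnn : 0 ≤ ((i + 1 : ℕ) : ℝ) / r := by positivity
    have e1 : z + (((i + 1 : ℕ) : ℝ) / r) • (r : ℝ) • h = z + ((i + 1 : ℕ) : ℝ) • h := by
      rw [smul_smul, div_mul_cancel₀ _ hr0.ne']
    have key : ∀ τ : ℝ, τ • (r : ℝ) • ((i + 1 : ℕ) : ℝ) • s =
        (τ * (((i + 1 : ℕ) : ℝ) / r)) • (r : ℝ) ^ 2 • s := by
      intro τ
      rw [smul_smul (τ * _), show τ * (((i + 1 : ℕ) : ℝ) / r) * (r : ℝ) ^ 2 =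
        τ * (r * ((i + 1 : ℕ) : ℝ)) by field_simp]
      module
    refine ⟨segment_add_subset_iff.2 fun τ h0 h1 => ?_, ?_⟩
    · have hn := hnode _ hnn (hratio i hi) s hs (τ * (((i + 1 : ℕ) : ℝ) / r)) (by positivity)
        (mul_le_one₀ h1 hnn (hratio i hi))
      rw [e1, ← key] at hn
      exact hn.1
    · have hn := hnode _ hnn (hratio i hi) s hs (1 * (((i + 1 : ℕ) : ℝ) / r)) (by positivity)
        (by rw [one_mul]; exact hratio i hi)
      rw [e1, ← key, one_smul] at hn
      refine ⟨hn.1, hn.2.trans ?_⟩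
      nlinarith

end Pointwise

/-! ### Subdividing the step of a difference -/

section Subdivision

variable {d : ℕ} {Ω : Set (Ambient d)}

/-- A difference is bounded by local averages at the points of a subdivision, provided that the
pieces of its segment are short in the metric `ρ_Ω`. -/
lemma exists_enorm_diffSum_le_of_subdivision (hΩ : IsCompact Ω) {R M K : ℝ} (hR : 0 < R)
    (hM : 0 ≤ M) (hK : 0 ≤ K) (hch : HasUniformCharts Ω R M K) {r : ℕ} (hr : 1 ≤ r) {κ : ℝ}
    (hκ : 0 < κ) :
    ∃ t₀ : ℝ, 0 < t₀ ∧ t₀ ≤ 1 ∧ ∃ lam₀ : ℝ, 0 < lam₀ ∧ ∀ lam : ℝ, lam₀ ≤ lam → ∀ q : ℝ≥0∞, q ≠ 0 →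
      q ≠ ∞ → ∀ n : ℕ, 1 ≤ n → ∃ C : ℝ≥0, ∀ f : Ambient d → ℝ, AEMeasurable f (volume.restrict Ω) →
        ∀ t, 0 < t → t ≤ t₀ → ∀ z h : Ambient d,
        (∀ k : ℕ, k ≤ r * (n - 1) → ∀ τ : ℝ, 0 ≤ τ → τ ≤ 1 →
          z + ((k : ℝ) / n) • h + (τ * (r / n)) • h ∈ Ω ∧
          rhoDist Ω (z + ((k : ℝ) / n) • h) (z + ((k : ℝ) / n) • h + (τ * (r / n)) • h) ≤ κ * t) →
        ‖diffSum r h f z‖ₑ ≤ C * ∑ k ∈ Finset.range (r * n + 1),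
          localAverage r q Ω f (z + ((k : ℝ) / n) • h) (lam * t) := by
  obtain ⟨t₀, ht₀, ht₀1, lam₀, hlam₀, hmain⟩ := exists_enorm_diffSum_le hΩ hR hM hK hch hr hκ
  refine ⟨t₀, ht₀, ht₀1, lam₀, hlam₀, fun lam hlam q hq0 hq n hn => ?_⟩
  obtain ⟨C, hC⟩ := hmain lam hlam q hq0 hq
  obtain ⟨a, ha⟩ := exists_diffSum_smul_eq (d := d) r n hn
  refine ⟨(∑ k ∈ Finset.range (r * (n - 1) + 1), ‖a k‖₊) * C, fun f hf t ht htt₀ z h hgood => ?_⟩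
  have hn0 : (n : ℝ) ≠ 0 := by positivity
  set H := (n : ℝ)⁻¹ • h with hH
  have hnH : (n : ℝ) • H = h := smul_inv_smul₀ hn0 h
  have hpt : ∀ k : ℕ, z + (k : ℝ) • H = z + ((k : ℝ) / n) • h := fun k => by
    rw [hH, smul_smul, div_eq_mul_inv]
  set w : ℕ → ℝ≥0∞ := fun k => localAverage r q Ω f (z + ((k : ℝ) / n) • h) (lam * t) with hw
  have hpiece : ∀ k : ℕ, k ≤ r * (n - 1) →
      ‖diffSum r H f (z + (k : ℝ) • H)‖ₑ ≤ C * ∑ k ∈ Finset.range (r * n + 1), w k := by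
    intro k hk
    refine (hC f hf t ht htt₀ (z + (k : ℝ) • H) H ?_).trans ?_
    · intro τ h0 h1
      have e : τ • (r : ℝ) • H = (τ * (r / n)) • h := by
        rw [hH, smul_smul, smul_smul]
        congr 1
        ring
      rw [hpt, e]
      exact hgood k hk τ h0 h1
    · gcongr
      have e : ∀ j : ℕ, z + (k : ℝ) • H + (j : ℝ) • H = z + (((k + j : ℕ) : ℝ) / n) • h := by
        intro j
        rw [← hpt]
        push_cast
        module
      simp only [e]
      -- The last piece starts at index `r (n - 1)` and has `r` further nodes, so it ends exactly at
      -- the last node.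
      have hle : k + (r + 1) ≤ r * n + 1 := by
        have : r * (n - 1) + r = r * n := by
          obtain ⟨m, rfl⟩ := Nat.exists_eq_add_of_le hn
          simp only [Nat.add_sub_cancel_left]
          ring
        omega
      calc ∑ j ∈ Finset.range (r + 1), w (k + j) = ∑ i ∈ Finset.Ico k (k + (r + 1)), w i := by
            rw [Finset.sum_Ico_eq_sum_range, Nat.add_sub_cancel_left]
        _ ≤ ∑ i ∈ Finset.range (r * n + 1), w i := by
            refine Finset.sum_le_sum_of_subset fun i hi => ?_
            rw [Finset.mem_Ico] at hi
            exact Finset.mem_range.2 (hi.2.trans_le hle)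
  calc ‖diffSum r h f z‖ₑ
      = ‖∑ k ∈ Finset.range (r * (n - 1) + 1), a k * diffSum r H f (z + (k : ℝ) • H)‖ₑ := by
        rw [← ha, hnH]
    _ ≤ ∑ k ∈ Finset.range (r * (n - 1) + 1),
          ‖a k * diffSum r H f (z + (k : ℝ) • H)‖ₑ := enorm_sum_le _ _
    _ ≤ ∑ k ∈ Finset.range (r * (n - 1) + 1),
          ‖a k‖ₑ * (C * ∑ k ∈ Finset.range (r * n + 1), w k) := by
        refine Finset.sum_le_sum fun k hk => ?_
        rw [enorm_mul]
        gcongr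
        exact hpiece k (Nat.lt_succ_iff.1 (Finset.mem_range.1 hk))
    _ = _ := by
        rw [← Finset.sum_mul, ← mul_assoc]
        congr 2
        push_cast
        rfl

end Subdivision

/-! ### Charts from attached domains of special type -/

section Charts

variable {d : ℕ}

/-- `horiz` as a continuous linear map. -/
noncomputable def horizL (d : ℕ) : Ambient d →L[ℝ] Base d :=
  LinearMap.toContinuousLinearMap
    { toFun := horiz
      map_add' := fun _ _ => rfl
      map_smul' := fun _ _ => rfl }

/-- `vert` as a continuous linear map. -/
noncomputable def vertL (d : ℕ) : Ambient d →L[ℝ] ℝ := EuclideanSpace.proj (Fin.last d)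

lemma norm_sq_eq_horiz_add_vert (z : Ambient d) : ‖z‖ ^ 2 = ‖horiz z‖ ^ 2 + vert z ^ 2 := by
  rw [EuclideanSpace.norm_sq_eq, EuclideanSpace.norm_sq_eq, Fin.sum_univ_castSucc]
  simp [horiz, vert]

lemma norm_horiz_le (z : Ambient d) : ‖horiz z‖ ≤ ‖z‖ := by
  apply le_of_sq_le_sq _ (norm_nonneg z)
  rw [norm_sq_eq_horiz_add_vert z]
  nlinarith [sq_nonneg (vert z)]

lemma abs_vert_le (z : Ambient d) : |vert z| ≤ ‖z‖ := by
  apply abs_le_of_sq_le_sq _ (norm_nonneg z)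
  rw [norm_sq_eq_horiz_add_vert z]
  nlinarith [sq_nonneg ‖horiz z‖]

/-- The cube `[-2b, 2b]^d`. -/
def bigCube (d : ℕ) (b : ℝ) : Set (Base d) := {u | ∀ i, |u i| ≤ 2 * b}

lemma isCompact_bigCube (d : ℕ) (b : ℝ) : IsCompact (bigCube d b) := by
  have h : bigCube d b = (EuclideanSpace.equiv (Fin d) ℝ).toHomeomorph ⁻¹'
      Set.univ.pi fun _ => Set.Icc (-(2 * b)) (2 * b) := by
    ext u
    simp only [bigCube, abs_le, Set.mem_preimage, Set.mem_univ_pi, Set.mem_Icc]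
    rfl
  rw [h, Homeomorph.isCompact_preimage]
  exact isCompact_univ_pi fun _ => isCompact_Icc

lemma convex_bigCube (d : ℕ) (b : ℝ) : Convex ℝ (bigCube d b) := by
  intro x hx y hy s t hs ht hst i
  have h1 : |s * x i + t * y i| ≤ s * |x i| + t * |y i| := by
    refine (abs_add_le _ _).trans ?_
    rw [abs_mul, abs_mul, abs_of_nonneg hs, abs_of_nonneg ht]
  have h2 : s * |x i| + t * |y i| ≤ s * (2 * b) + t * (2 * b) := by
    gcongr
    · exact hx i
    · exact hy i
  have h3 : s * (2 * b) + t * (2 * b) = 2 * b := by rw [← add_mul, hst, one_mul]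
  exact h1.trans (h2.trans h3.le)

namespace SpecialDomain

variable (G : SpecialDomain d)

/-- The height of the graph above a point. -/
noncomputable def level (z : Ambient d) : ℝ := G.g (horiz (G.toStd z)) - vert (G.toStd z)

/-- The derivative of `level`. -/
noncomputable def levelDeriv (z : Ambient d) : Ambient d →L[ℝ] ℝ :=
  ((fderiv ℝ G.g (horiz (G.toStd z))).comp (horizL d) - vertL d).comp
    (G.rot.toContinuousLinearEquiv : Ambient d →L[ℝ] Ambient d)

/-- The upward direction. -/
noncomputable def up : Ambient d := G.rot.symm (EuclideanSpace.single (Fin.last d) 1)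

lemma levelDeriv_apply (z v : Ambient d) : G.levelDeriv z v =
    fderiv ℝ G.g (horiz (G.toStd z)) (horiz (G.rot v)) - vert (G.rot v) := rfl

lemma toStd_sub_toStd (z z' : Ambient d) : G.toStd z' - G.toStd z = G.rot (z' - z) := by
  rw [toStd, toStd, map_sub]; abel

lemma horiz_sub (z z' : Ambient d) : horiz (z' - z) = horiz z' - horiz z := rfl

lemma vert_sub (z z' : Ambient d) : vert (z' - z) = vert z' - vert z := rfl

lemma continuous_toStd : Continuous G.toStd := by
  unfold toStd
  exact G.rot.continuous.sub continuous_const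

lemma continuous_fromStd : Continuous G.fromStd := by
  unfold fromStd
  exact G.rot.symm.continuous.comp (continuous_id.add continuous_const)

lemma toStd_fromStd (w : Ambient d) : G.toStd (G.fromStd w) = w := by
  simp [toStd, fromStd]

lemma fromStd_toStd (z : Ambient d) : G.fromStd (G.toStd z) = z := by
  simp [toStd, fromStd]

lemma fromStd_add (w v : Ambient d) : G.fromStd (w + v) = G.fromStd w + G.rot.symm v := by
  simp only [fromStd, map_add]; abel

lemma continuous_horiz : Continuous (horiz : Ambient d → Base d) := (horizL d).continuous

lemma continuous_vert : Continuous (vert : Ambient d → ℝ) := (vertL d).continuous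

lemma norm_horiz_toStd_sub_le (z z' : Ambient d) :
    ‖horiz (G.toStd z') - horiz (G.toStd z)‖ ≤ ‖z' - z‖ := by
  rw [← horiz_sub, toStd_sub_toStd]
  exact (norm_horiz_le _).trans (G.rot.norm_map _).le

/-- Uniform local charts around the points of a domain of special type. -/
structure ChartBounds (Ω : Set (Ambient d)) (R M K : ℝ) : Prop where
  chart : ∀ c ∈ G.carrier, LocalChart Ω c R M K G.level G.levelDeriv G.up
  horiz_mem : ∀ c ∈ G.carrier, ∀ z, ‖z - c‖ < R → horiz (G.toStd z) ∈ bigCube d G.b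
  norm_fderiv_le : ∀ x ∈ bigCube d G.b, ‖fderiv ℝ G.g x‖ ≤ K
  norm_fderiv_sub_le : ∀ x ∈ bigCube d G.b, ∀ y ∈ bigCube d G.b,
    ‖fderiv ℝ G.g y - fderiv ℝ G.g x‖ ≤ M * ‖y - x‖

/-- The closed version `Kc` of `G` lies in G*, hence in the compact set Ω, and is compact. It is
contained in an open set `V` on which belonging to Ω means belonging to G*, because G* is cut out of
Ω by a box; in `V` this means lying below the graph. A compact set keeps a positive distance from
the outside of an open set containing it. -/
lemma exists_thickening {Ω : Set (Ambient d)} (hΩ : IsCompact Ω) (hG : G.IsAttached Ω) :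
    ∃ R : ℝ, 0 < R ∧ ∀ c ∈ G.carrier, ∀ z, ‖z - c‖ < R →
      horiz (G.toStd z) ∈ bigCube d G.b ∧ (z ∈ Ω ↔ 0 ≤ G.level z) := by
  obtain ⟨l, u, hbox⟩ := hG.exists_box
  have hb := G.b_pos
  have hL := G.one_le_L
  have hgc : Continuous G.g := G.contDiff_g.continuous
  have hT := G.continuous_toStd
  have hh := continuous_horiz (d := d)
  have hv := continuous_vert (d := d)
  have hhi : ∀ i, Continuous fun z : Ambient d => horiz (G.toStd z) i := fun i =>
    (EuclideanSpace.proj (𝕜 := ℝ) i).continuous.comp (hh.comp hT)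
  set m := sInf (G.g '' {u | ∀ i, |u i| ≤ 2 * G.b}) with hm
  set Kc : Set (Ambient d) := {z | (∀ i, |horiz (G.toStd z) i| ≤ G.b) ∧
    G.g (horiz (G.toStd z)) - G.L * G.b ≤ vert (G.toStd z) ∧
    vert (G.toStd z) ≤ G.g (horiz (G.toStd z))} with hKc
  set V : Set (Ambient d) := {z | (∀ i, l i < z i ∧ z i < u i) ∧
    (∀ i, |horiz (G.toStd z) i| < 2 * G.b) ∧ m - 4 * G.L * G.b < vert (G.toStd z)} with hV
  have hstar : Kc ⊆ G.star := by
    rintro z ⟨h1, h2, h3⟩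
    refine ⟨fun i => lt_of_le_of_lt (h1 i) (by linarith), ?_, h3⟩
    have hmle : m ≤ G.g (horiz (G.toStd z)) := by
      apply csInf_le
      · exact ((isCompact_bigCube d G.b).image hgc).bddBelow
      · exact ⟨_, fun i => (h1 i).trans (by linarith), rfl⟩
    have : 0 < G.L * G.b := by positivity
    change m - 4 * G.L * G.b < _
    nlinarith
  have hstarΩ : G.star ⊆ Ω := by rw [hbox]; exact Set.inter_subset_right
  have hKcl : IsClosed Kc := by
    refine IsClosed.inter (s₁ := {z | ∀ i, |horiz (G.toStd z) i| ≤ G.b}) ?_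
      (IsClosed.inter ?_ ?_)
    · rw [Set.ofPred_forall]
      exact isClosed_iInter fun i => isClosed_le (hhi i).abs continuous_const
    · exact isClosed_le ((hgc.comp (hh.comp hT)).sub continuous_const) (hv.comp hT)
    · exact isClosed_le (hv.comp hT) (hgc.comp (hh.comp hT))
  have hKcomp : IsCompact Kc := hΩ.of_isClosed_subset hKcl (hstar.trans hstarΩ)
  have hVo : IsOpen V := by
    refine IsOpen.inter (s := {z : Ambient d | ∀ i, l i < z i ∧ z i < u i}) ?_
      (IsOpen.inter (s := {z : Ambient d | ∀ i, |horiz (G.toStd z) i| < 2 * G.b}) ?_ ?_)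
    · rw [Set.ofPred_forall]
      refine isOpen_iInter_of_finite fun i => ?_
      have hi : Continuous fun z : Ambient d => z i := (EuclideanSpace.proj (𝕜 := ℝ) i).continuous
      exact (isOpen_lt continuous_const hi).inter (isOpen_lt hi continuous_const)
    · rw [Set.ofPred_forall]
      exact isOpen_iInter_of_finite fun i => isOpen_lt (hhi i).abs continuous_const
    · exact isOpen_lt continuous_const (hv.comp hT)
  have hKV : Kc ⊆ V := by
    intro z hz
    have h1 := hstar hz
    refine ⟨?_, h1.1, h1.2.1⟩
    rw [hbox] at h1
    exact h1.1
  obtain ⟨R, hR, hRV⟩ := hKcomp.exists_thickening_subset_open hVo hKV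
  refine ⟨R, hR, fun c hc z hz => ?_⟩
  have hcK : c ∈ Kc := ⟨fun i => (hc.1 i).le, hc.2.1.le, hc.2.2⟩
  have hzV : z ∈ V := hRV (Metric.mem_thickening_iff.2 ⟨c, hcK, by rwa [dist_eq_norm]⟩)
  refine ⟨fun i => (hzV.2.1 i).le, ?_, ?_⟩
  · intro hzΩ
    have h1 : z ∈ G.star := by rw [hbox]; exact ⟨hzV.1, hzΩ⟩
    exact sub_nonneg.2 h1.2.2
  · intro h0
    exact hstarΩ ⟨hzV.2.1, hzV.2.2, sub_nonneg.1 h0⟩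

/-- The chart function is the height below the graph, g(x) - y. As g is C², its first and second
derivatives are bounded on the compact convex cube, and the mean value inequality gives the
Lipschitz and Taylor bounds. The `+ 1` in the bound `|K₀| + 1` accounts for the term -y. -/
lemma exists_chartBounds {Ω : Set (Ambient d)} (hΩ : IsCompact Ω) (hG : G.IsAttached Ω) :
    ∃ R M K : ℝ, 0 < R ∧ 0 ≤ M ∧ 0 ≤ K ∧ G.ChartBounds Ω R M K := by
  obtain ⟨R, hR, hnear⟩ := G.exists_thickening hΩ hG
  have hdg : Differentiable ℝ G.g := G.contDiff_g.differentiable (by norm_num)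
  have hd1 : ContDiff ℝ 1 (fderiv ℝ G.g) := G.contDiff_g.fderiv_right (by norm_num)
  have hdd : Differentiable ℝ (fderiv ℝ G.g) := hd1.differentiable (by norm_num)
  obtain ⟨K₀, hK₀⟩ := (isCompact_bigCube d G.b).exists_bound_of_continuousOn
    hd1.continuous.continuousOn
  obtain ⟨M₀, hM₀⟩ := (isCompact_bigCube d G.b).exists_bound_of_continuousOn
    (hd1.continuous_fderiv (by norm_num)).continuousOn
  have hK' : ∀ x ∈ bigCube d G.b, ‖fderiv ℝ G.g x‖ ≤ |K₀| := fun x hx =>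
    (hK₀ x hx).trans (le_abs_self _)
  have hM' : ∀ x ∈ bigCube d G.b, ∀ y ∈ bigCube d G.b,
      ‖fderiv ℝ G.g y - fderiv ℝ G.g x‖ ≤ |M₀| * ‖y - x‖ := fun x hx y hy =>
    (convex_bigCube d G.b).norm_image_sub_le_of_norm_fderiv_le (fun x _ => hdd x)
      (fun x hx => (hM₀ x hx).trans (le_abs_self _)) hx hy
  refine ⟨R, |M₀|, |K₀| + 1, hR, abs_nonneg _, by positivity, ?_, fun c hc z hz =>
    (hnear c hc z hz).1, fun x hx => (hK' x hx).trans (by linarith), hM'⟩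
  intro c hc
  refine ⟨hR, abs_nonneg _, by positivity, ?_, ?_, fun z hz => (hnear c hc z hz).2, ?_, ?_, ?_, ?_⟩
  · simp [up]
  · intro z l
    have e1 : G.toStd (z + l • G.up) =
        G.toStd z + l • EuclideanSpace.single (Fin.last d) (1 : ℝ) := by
      simp only [toStd, up, map_add, map_smul, LinearIsometryEquiv.apply_symm_apply]
      abel
    have e2 : horiz (G.toStd z + l • EuclideanSpace.single (Fin.last d) (1 : ℝ)) =
        horiz (G.toStd z) := by
      ext i
      simp [horiz, Fin.castSucc_ne_last]
    have e3 : vert (G.toStd z + l • EuclideanSpace.single (Fin.last d) (1 : ℝ)) =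
        vert (G.toStd z) + l := by
      simp [vert]
    rw [level, level, e1, e2, e3]
    ring
  · intro z
    have e2 : horiz (EuclideanSpace.single (Fin.last d) (1 : ℝ)) = 0 := by
      ext i
      simp [horiz, Fin.castSucc_ne_last]
    have e3 : vert (EuclideanSpace.single (Fin.last d) (1 : ℝ)) = 1 := by
      simp [vert]
    rw [levelDeriv_apply, up, LinearIsometryEquiv.apply_symm_apply, e2, e3]
    simp
  · intro z hz
    refine ContinuousLinearMap.opNorm_le_bound _ (by positivity) fun v => ?_
    rw [levelDeriv_apply]
    have h1 := (fderiv ℝ G.g (horiz (G.toStd z))).le_opNorm (horiz (G.rot v))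
    have h2 := hK' _ (hnear c hc z hz).1
    have h3 : ‖horiz (G.rot v)‖ ≤ ‖v‖ := (norm_horiz_le _).trans (G.rot.norm_map v).le
    have h4 : |vert (G.rot v)| ≤ ‖v‖ := (abs_vert_le _).trans (G.rot.norm_map v).le
    have h5 : ‖fderiv ℝ G.g (horiz (G.toStd z))‖ * ‖horiz (G.rot v)‖ ≤ |K₀| * ‖v‖ := by gcongr
    refine (norm_sub_le _ _).trans ?_
    rw [Real.norm_eq_abs (vert _)]
    linarith
  · intro z z' hz hz'
    have h1 := (convex_bigCube d G.b).norm_image_sub_le_of_norm_fderiv_le (fun x _ => hdg x)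
      hK' (hnear c hc z hz).1 (hnear c hc z' hz').1
    have h2 : |vert (G.toStd z') - vert (G.toStd z)| ≤ ‖z' - z‖ := by
      rw [← vert_sub, toStd_sub_toStd]
      exact (abs_vert_le _).trans (G.rot.norm_map _).le
    have h3 := G.norm_horiz_toStd_sub_le z z'
    have h4 : |K₀| * ‖horiz (G.toStd z') - horiz (G.toStd z)‖ ≤ |K₀| * ‖z' - z‖ := by gcongr
    rw [Real.norm_eq_abs] at h1
    have h5 : G.level z' - G.level z = (G.g (horiz (G.toStd z')) - G.g (horiz (G.toStd z))) -
        (vert (G.toStd z') - vert (G.toStd z)) := by rw [level, level]; ring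
    rw [h5]
    refine (abs_sub _ _).trans ?_
    linarith
  · intro ξ z z' hξ hz hz'
    have hx := (hnear c hc z hz).1
    have hx' := (hnear c hc z' hz').1
    have hxξ := (hnear c hc ξ hξ).1
    have h3 := G.norm_horiz_toStd_sub_le z z'
    have h4 := G.norm_horiz_toStd_sub_le ξ z
    have h1 := (convex_segment (𝕜 := ℝ) (horiz (G.toStd z))
      (horiz (G.toStd z'))).norm_image_sub_le_of_norm_fderiv_le' (f := G.g)
      (φ := fderiv ℝ G.g (horiz (G.toStd ξ))) (C := |M₀| * (‖z - ξ‖ + ‖z' - z‖))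
      (fun x _ => hdg x) ?_ (left_mem_segment ℝ _ _) (right_mem_segment ℝ _ _)
    · have h5 : G.level z' - G.level z - G.levelDeriv ξ (z' - z) =
          G.g (horiz (G.toStd z')) - G.g (horiz (G.toStd z)) -
          fderiv ℝ G.g (horiz (G.toStd ξ)) (horiz (G.toStd z') - horiz (G.toStd z)) := by
        rw [levelDeriv_apply, ← toStd_sub_toStd, horiz_sub, vert_sub, level, level]
        ring
      rw [h5]
      rw [Real.norm_eq_abs] at h1
      calc _ ≤ |M₀| * (‖z - ξ‖ + ‖z' - z‖) * ‖horiz (G.toStd z') - horiz (G.toStd z)‖ := h1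
        _ ≤ |M₀| * (‖z - ξ‖ + ‖z' - z‖) * ‖z' - z‖ := by gcongr
        _ = _ := by ring
    · intro y hy
      have hy' := (convex_bigCube d G.b).segment_subset hx hx' hy
      refine (hM' _ hxξ _ hy').trans ?_
      gcongr
      have h6 : ‖y - horiz (G.toStd z)‖ ≤ ‖horiz (G.toStd z') - horiz (G.toStd z)‖ := by
        rw [segment_eq_image'] at hy
        obtain ⟨θ, hθ, rfl⟩ := hy
        rw [add_sub_cancel_left, norm_smul, Real.norm_of_nonneg hθ.1]
        exact mul_le_of_le_one_left (norm_nonneg _) hθ.2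
      have := norm_sub_le_norm_sub_add_norm_sub y (horiz (G.toStd z)) (horiz (G.toStd ξ))
      linarith

end SpecialDomain

lemma LocalChart.mono {Ω : Set (Ambient d)} {c : Ambient d} {R M K R' M' K' : ℝ}
    {Ψ : Ambient d → ℝ} {Ψ' : Ambient d → Ambient d →L[ℝ] ℝ} {e : Ambient d}
    (h : LocalChart Ω c R M K Ψ Ψ' e) (hR' : 0 < R') (hR : R' ≤ R) (hM : M ≤ M') (hK : K ≤ K') :
    LocalChart Ω c R' M' K' Ψ Ψ' e where
  R_pos := hR'
  M_nonneg := h.M_nonneg.trans hM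
  K_nonneg := h.K_nonneg.trans hK
  norm_e := h.norm_e
  shift := h.shift
  mem_iff z hz := h.mem_iff z (hz.trans_le hR)
  deriv_e := h.deriv_e
  norm_deriv_le z hz := (h.norm_deriv_le z (hz.trans_le hR)).trans hK
  lip z z' hz hz' := (h.lip z z' (hz.trans_le hR) (hz'.trans_le hR)).trans (by gcongr)
  taylor ξ z z' hξ hz hz' :=
    (h.taylor ξ z z' (hξ.trans_le hR) (hz.trans_le hR) (hz'.trans_le hR)).trans (by gcongr)

lemma exists_hasUniformCharts {m : ℕ} {Ω : Set (Ambient d)} (hΩ : IsCompact Ω)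
    {G : Fin m → SpecialDomain d} (hG : IsAttachedCover G Ω) :
    ∃ R M K : ℝ, 0 < R ∧ 0 ≤ M ∧ 0 ≤ K ∧ HasUniformCharts Ω R M K := by
  choose R M K hR hM hK h using fun i => (G i).exists_chartBounds hΩ (hG.attached i)
  have hpos : 0 < 1 + ∑ i, (R i)⁻¹ := by
    have : 0 ≤ ∑ i, (R i)⁻¹ := Finset.sum_nonneg fun i _ => (inv_pos.2 (hR i)).le
    linarith
  -- A positive radius below every `R i`, and meaningful for an empty family too; sums replace
  -- maxima for the other two constants.
  refine ⟨(1 + ∑ i, (R i)⁻¹)⁻¹, ∑ i, M i, ∑ i, K i, inv_pos.2 hpos,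
    Finset.sum_nonneg fun i _ => hM i, Finset.sum_nonneg fun i _ => hK i, fun p hp => ?_⟩
  obtain ⟨i, hi⟩ := Set.mem_iUnion.1 (hG.cover hp)
  refine ⟨_, _, _, ((h i).chart p hi).mono (inv_pos.2 hpos) ?_
    (Finset.single_le_sum (fun i _ => hM i) (Finset.mem_univ i))
    (Finset.single_le_sum (fun i _ => hK i) (Finset.mem_univ i))⟩
  rw [inv_le_comm₀ hpos (hR i)]
  have := Finset.single_le_sum (f := fun i => (R i)⁻¹) (fun i _ => (inv_pos.2 (hR i)).le)
    (Finset.mem_univ i)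
  linarith

end Charts

/-! ### ρ_Ω-length of segments in coordinate directions -/

section ShortSegments

variable {d : ℕ} {Ω : Set (Ambient d)}

/-- The working criterion for shortness near the boundary: the second order error in the change of
depth is absorbed into C t(t + √δ), and such a change of depth alters its square root by O(t). -/
lemma LocalChart.rhoDist_le {c : Ambient d} {R M K : ℝ} {Ψ : Ambient d → ℝ}
    {Ψ' : Ambient d → Ambient d →L[ℝ] ℝ} {e : Ambient d} (h : LocalChart Ω c R M K Ψ Ψ' e)
    (hΩ : IsCompact Ω) {z z' : Ambient d} (hz : ‖z - c‖ < R / 4) (hz' : ‖z' - c‖ < R / 4)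
    (hmem : z ∈ Ω) (hmem' : z' ∈ Ω) (hδ : depth Ω z < R / 8) (hδ1 : depth Ω z ≤ 1)
    (hv : ‖z' - z‖ ≤ R / (8 * (K + 1))) {t B C : ℝ} (ht : 0 ≤ t) (hB : 0 ≤ B) (hC : 0 ≤ C)
    (hvB : ‖z' - z‖ ≤ B * t) (hΨ : |Ψ z' - Ψ z| ≤ C * t * (t + √(depth Ω z))) :
    rhoDist Ω z z' ≤ (B + (2 * (C + 2 * M * B * (1 + 2 * B)) + 1)) * t := by
  have hM := h.M_nonneg
  have hd := h.abs_depth_sub_depth_le hΩ hz hz' hmem hmem' hδ hv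
  have hw0 := Real.sqrt_nonneg (depth Ω z)
  have hδw := le_sqrt_of_le_one (depth_nonneg z) hδ1
  set w := √(depth Ω z) with hw
  have h2 : 2 * M * ‖z' - z‖ * (depth Ω z + 2 * ‖z' - z‖) ≤
      2 * M * B * (1 + 2 * B) * t * (t + w) := by
    have := depth_nonneg (Ω := Ω) z
    calc 2 * M * ‖z' - z‖ * (depth Ω z + 2 * ‖z' - z‖)
        ≤ 2 * M * (B * t) * (w + 2 * (B * t)) := by gcongr
      _ ≤ 2 * M * (B * t) * ((1 + 2 * B) * (t + w)) := by
          gcongr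
          have := mul_nonneg hB hw0
          linarith
      _ = 2 * M * B * (1 + 2 * B) * t * (t + w) := by ring
  have hd2 : |depth Ω z - depth Ω z'| ≤ (C + 2 * M * B * (1 + 2 * B)) * t * (t + w) := by
    rw [abs_sub_comm]
    have : (C + 2 * M * B * (1 + 2 * B)) * t * (t + w) =
      C * t * (t + w) + 2 * M * B * (1 + 2 * B) * t * (t + w) := by ring
    linarith
  have hfin := abs_sqrt_sub_sqrt_le (depth_nonneg z) (depth_nonneg z') ht (by positivity) hd2
  rw [rhoDist_eq, norm_sub_rev]
  linarith

/-- Away from the boundary the square root of the depth is Lipschitz. -/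
lemma rhoDist_le_of_le_depth {z z' : Ambient d} {ε B t : ℝ} (hε : 0 < ε) (hz : ε ≤ depth Ω z)
    (h : ‖z' - z‖ ≤ B * t) : rhoDist Ω z z' ≤ B * (1 + 1 / √ε) * t := by
  have h3 := abs_sqrt_sub_sqrt_le_div hε hz (depth_nonneg (Ω := Ω) z')
  have h4 := abs_depth_sub_le (Ω := Ω) z' z
  rw [norm_sub_rev] at h4
  have h5 : |√(depth Ω z) - √(depth Ω z')| ≤ B * t / √ε :=
    h3.trans (div_le_div_of_nonneg_right (h4.trans h) (Real.sqrt_nonneg _))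
  rw [rhoDist_eq, norm_sub_rev]
  have h7 : B * (1 + 1 / √ε) * t = B * t + B * t / √ε := by ring
  linarith

lemma phiDist_le {a ξ : Ambient d} {B : ℝ} (hB : 0 ≤ B)
    (h : ∀ l₁ l₂ : ℝ, 0 ≤ l₁ → 0 ≤ l₂ → segment ℝ (ξ - l₁ • a) (ξ + l₂ • a) ⊆ Ω →
      √(l₁ * l₂) ≤ B) : phiDist Ω a ξ ≤ B := by
  apply Real.sSup_le _ hB
  rintro v ⟨l₁, l₂, h1, h2, hs, rfl⟩
  exact h l₁ l₂ h1 h2 hs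

lemma phiDist_nonneg (a ξ : Ambient d) : 0 ≤ phiDist Ω a ξ := by
  apply Real.sSup_nonneg
  rintro v ⟨l₁, l₂, h1, h2, hs, rfl⟩
  exact Real.sqrt_nonneg _

lemma mem_of_segment_line {a ξ : Ambient d} {l₁ l₂ x : ℝ}
    (hs : segment ℝ (ξ - l₁ • a) (ξ + l₂ • a) ⊆ Ω) (h1 : -l₁ ≤ x) (h2 : x ≤ l₂) :
    ξ + x • a ∈ Ω := by
  rcases eq_or_lt_of_le (h1.trans h2) with h | h
  · have hx : x = l₂ := le_antisymm h2 (by linarith)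
    rw [hx]
    exact hs (right_mem_segment ℝ _ _)
  · apply hs
    rw [segment_eq_image']
    have hpos : 0 < l₂ + l₁ := by linarith
    refine ⟨(x + l₁) / (l₂ + l₁), ⟨by apply div_nonneg <;> linarith,
      (div_le_one hpos).2 (by linarith)⟩, ?_⟩
    have e : ξ + l₂ • a - (ξ - l₁ • a) = (l₂ + l₁) • a := by module
    simp only
    rw [e, smul_smul, div_mul_cancel₀ _ hpos.ne']
    module

/-- If the domain ends shortly after `z = ξ + α a` in one of the directions `± a`, then
`phiDist` is small at `ξ`. -/
lemma phiDist_sq_le {a ξ : Ambient d} (ha : ‖a‖ = 1) {D : ℝ} (hD0 : 0 ≤ D)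
    (hD : ∀ x ∈ Ω, ∀ y ∈ Ω, ‖x - y‖ ≤ D)
    {L α m σ : ℝ} (hξ : ξ ∈ Ω) (hm : 0 ≤ m) (hσ : σ = 1 ∨ σ = -1) (hα : |α| ≤ L)
    (hsym : ∀ x : ℝ, |x| ≤ L → ξ + x • a ∈ Ω)
    (hend : ∀ l, m < l → ∃ l', m < l' ∧ l' < l ∧ ξ + (α + σ * l') • a ∉ Ω) :
    phiDist Ω a ξ ^ 2 ≤ D * (m + L) := by
  have hL : 0 ≤ L := (abs_nonneg α).trans hα
  have hB : 0 ≤ D * (m + L) := by positivity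
  refine (pow_le_pow_left₀ (phiDist_nonneg a ξ) (phiDist_le (Real.sqrt_nonneg (D * (m + L))) ?_)
    2).trans (Real.sq_sqrt hB).le
  intro l₁ l₂ h1 h2 hs
  apply Real.sqrt_le_sqrt
  have hl : ∀ x : ℝ, ξ + x • a ∈ Ω → |x| ≤ D := by
    intro x hx
    have := hD _ hx _ hξ
    rwa [add_sub_cancel_left, norm_smul, ha, mul_one, Real.norm_eq_abs] at this
  have hl₁ : l₁ ≤ D := by
    have := hl (-l₁) (mem_of_segment_line hs le_rfl (by linarith))
    rwa [abs_neg, abs_of_nonneg h1] at this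
  have hl₂ : l₂ ≤ D := by
    have := hl l₂ (mem_of_segment_line hs (by linarith) le_rfl)
    rwa [abs_of_nonneg h2] at this
  rw [abs_le] at hα
  -- On the side where the domain ends, the admissible length is at most m + L: a longer one would
  -- include the exterior point supplied by `hend`. The other length is at most the diameter bound
  -- `D`.
  rcases hσ with rfl | rfl
  · have : l₂ ≤ m + L := by
      by_contra! hcon
      obtain ⟨l', hm', hl', hn⟩ := hend (l₂ - L) (by linarith)
      apply hn
      rw [one_mul]
      by_cases h0 : 0 ≤ α + l'
      · exact mem_of_segment_line hs (by linarith) (by linarith)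
      · exact hsym _ (abs_le.2 ⟨by linarith, by linarith⟩)
    exact mul_le_mul hl₁ this h2 hD0
  · have : l₁ ≤ m + L := by
      by_contra! hcon
      obtain ⟨l', hm', hl', hn⟩ := hend (l₁ - L) (by linarith)
      apply hn
      by_cases h0 : α + -1 * l' ≤ 0
      · exact mem_of_segment_line hs (by linarith) (by linarith)
      · exact hsym _ (abs_le.2 ⟨by linarith, by linarith⟩)
    rw [mul_comm]
    exact mul_le_mul hl₂ this h1 hD0

/-- Along a direction `a` in which the slope `θ` of the defining function is steep compared with
its value, the domain ends at distance at most `2 Ψ z / |θ|`. -/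
lemma LocalChart.exists_notMem_line {c : Ambient d} {R M K : ℝ} {Ψ : Ambient d → ℝ}
    {Ψ' : Ambient d → Ambient d →L[ℝ] ℝ} {e : Ambient d} (h : LocalChart Ω c R M K Ψ Ψ' e)
    {z a : Ambient d} (ha : ‖a‖ = 1) {θ : ℝ} (hθ : 0 < θ) (hda : Ψ' z a = -θ)
    (hz : ‖z - c‖ < R / 2) (hΨ0 : 0 ≤ Ψ z) (hΨR : Ψ z < R ^ 2 / 16)
    (hsteep : 4 * (M + 1) * Ψ z < θ ^ 2) {l : ℝ} (hl : 2 * Ψ z / θ < l) :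
    ∃ l', 2 * Ψ z / θ < l' ∧ l' < l ∧ z + l' • a ∉ Ω := by
  have hR := h.R_pos
  have hM := h.M_nonneg
  have hm : 0 ≤ 2 * Ψ z / θ := by positivity
  have h1 : 2 * Ψ z / θ < R / 2 := by
    have : (2 * Ψ z / θ) ^ 2 < (R / 2) ^ 2 := by
      rw [div_pow, div_lt_iff₀ (by positivity)]
      have h4 : Ψ z ≤ θ ^ 2 := by nlinarith [mul_nonneg hM hΨ0]
      rcases eq_or_lt_of_le hΨ0 with h0 | h0
      · have : 0 < (R / 2) ^ 2 * θ ^ 2 := by positivity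
        rw [← h0]
        linarith
      · nlinarith
    exact lt_of_pow_lt_pow_left₀ 2 (by positivity) this
  have h2 : 2 * Ψ z / θ < θ / (2 * (M + 1)) := by
    rw [div_lt_div_iff₀ hθ (by positivity)]
    nlinarith
  -- Below `θ / (2 * (M + 1))` the quadratic Taylor term is at most half of the linear decrease `θ
  -- l'`, and beyond `2 * Ψ z / θ` the other half exceeds `Ψ z`. The hypotheses on `Ψ z` leave room
  -- between these bounds and inside the chart.
  obtain ⟨l', hl'1, hl'2⟩ := exists_between (lt_min hl (lt_min h1 h2))
  have hl'0 : 0 < l' := hm.trans_lt hl'1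
  have b1 := hl'2.trans_le (min_le_left _ _)
  have b2 := hl'2.trans_le ((min_le_right _ _).trans (min_le_left _ _))
  have b3 := hl'2.trans_le ((min_le_right _ _).trans (min_le_right _ _))
  refine ⟨l', hl'1, b1, fun hmem => ?_⟩
  have hn : ‖l' • a‖ = l' := by rw [norm_smul, ha, mul_one, Real.norm_of_nonneg hl'0.le]
  have hc : ‖z + l' • a - c‖ < R := by
    rw [show z + l' • a - c = (z - c) + l' • a by abel]
    have := norm_add_le (z - c) (l' • a)
    linarith
  have hpos := (h.mem_iff _ hc).1 hmem
  have ht := h.taylor z z (z + l' • a) (by linarith) (by linarith) hc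
  rw [add_sub_cancel_left, sub_self, norm_zero, zero_add, hn, map_smul, hda, smul_eq_mul] at ht
  have ht2 := (abs_le.1 ht).2
  rw [lt_div_iff₀ (by positivity)] at b3
  rw [div_lt_iff₀ hθ] at hl'1
  have h5 : M * l' * l' ≤ θ / 2 * l' := by
    apply mul_le_mul_of_nonneg_right _ hl'0.le
    nlinarith
  nlinarith

lemma exists_nat_ge_and_one_le (x : ℝ) : ∃ n : ℕ, 1 ≤ n ∧ x ≤ n := by
  obtain ⟨n, hn⟩ := exists_nat_ge x
  exact ⟨n + 1, by omega, hn.trans (by push_cast; linarith)⟩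

set_option maxHeartbeats 1000000 in
/-- The pieces of the segments that occur in the directional moduli are short. -/
lemma exists_rhoDist_le_of_directional (hΩ : IsCompact Ω) {R M K : ℝ} (hR : 0 < R)
    (hM : 0 ≤ M) (hK : 0 ≤ K) (hch : HasUniformCharts Ω R M K) {r : ℕ} (hr : 1 ≤ r) :
    ∃ κ : ℝ, 0 < κ ∧ ∀ t₀ : ℝ, 0 < t₀ → t₀ ≤ 1 → ∃ n : ℕ, 1 ≤ n ∧ ∀ t, 0 < t → t ≤ 1 →
      ∀ h : ℝ, |h| ≤ t → ∀ ξ ∈ Ω, ∀ a : Ambient d, ‖a‖ = 1 →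
      (∀ x : ℝ, |x| ≤ r / 2 * (|h| * phiDist Ω a ξ) → ξ + x • a ∈ Ω) →
      ∀ α β : ℝ, |α| ≤ r / 2 * (|h| * phiDist Ω a ξ) →
        |α + β| ≤ r / 2 * (|h| * phiDist Ω a ξ) → |β| ≤ r * (|h| * phiDist Ω a ξ) / n →
        rhoDist Ω (ξ + α • a) (ξ + (α + β) • a) ≤ κ * (t₀ * t) := by
  obtain ⟨D', hD'⟩ := hΩ.isBounded.exists_norm_le
  set D := 2 * |D'| + 1 with hDdef
  have hD0 : 0 < D := by positivity
  have hD : ∀ x ∈ Ω, ∀ y ∈ Ω, ‖x - y‖ ≤ D := fun x hx y hy => by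
    have := norm_sub_le x y
    have h1 := (hD' x hx).trans (le_abs_self D')
    have h2 := (hD' y hy).trans (le_abs_self D')
    linarith
  have hr0 : (0 : ℝ) < r := by exact_mod_cast hr
  set δ₁ := min (min (R / 16) 1) (R ^ 2 / (32 * (K + 1))) with hδ₁
  have hδ₁0 : 0 < δ₁ := lt_min (lt_min (by positivity) (by positivity)) (by positivity)
  have hδR : δ₁ ≤ R / 16 := (min_le_left _ _).trans (min_le_left _ _)
  have hδ1 : δ₁ ≤ 1 := (min_le_left _ _).trans (min_le_right _ _)
  have hδK : δ₁ ≤ R ^ 2 / (32 * (K + 1)) := min_le_right _ _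
  set B := r * D with hB
  have hB0 : 0 < B := by positivity
  set C₂ := B * √(4 * (M + 1) * K) + r * √(4 * D * K * K) + r * (D * r) * K with hC₂
  have hC₂0 : 0 ≤ C₂ := by positivity
  set C₃ := C₂ + M * B * B with hC₃
  have hC₃0 : 0 ≤ C₃ := by positivity
  refine ⟨max (B * (1 + 1 / √δ₁)) (B + (2 * (C₃ + 2 * M * B * (1 + 2 * B)) + 1)), by positivity,
    fun t₀ ht₀ ht₀1 => ?_⟩
  -- The square is needed where φ_Ω = O(|h|): there a piece has length O(h²/n), to be bounded by
  -- (t₀t)². The other summand keeps pieces inside a chart.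
  obtain ⟨n, hn1, hn⟩ := exists_nat_ge_and_one_le (1 / t₀ ^ 2 + B * (8 * (K + 1)) / R)
  have hn0 : (0 : ℝ) < n := by exact_mod_cast hn1
  have hn2 : 1 / (n : ℝ) ≤ t₀ ^ 2 := by
    rw [one_div_le hn0 (by positivity)]
    have : 0 ≤ B * (8 * (K + 1)) / R := by positivity
    linarith
  have hn3 : B / n ≤ R / (8 * (K + 1)) := by
    rw [div_le_div_iff₀ hn0 (by positivity), ← div_le_iff₀' hR]
    have : 0 ≤ 1 / t₀ ^ 2 := by positivity
    linarith
  have hn4 : 1 / (n : ℝ) ≤ t₀ := hn2.trans (by nlinarith)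
  refine ⟨n, hn1, fun t ht ht1 h hht ξ hξ a ha hsym α β hα hαβ hβ => ?_⟩
  set φ := phiDist Ω a ξ with hφ
  have hφ0 : 0 ≤ φ := phiDist_nonneg a ξ
  have hline : ∀ x : ℝ, ξ + x • a ∈ Ω → |x| ≤ D := by
    intro x hx
    have := hD _ hx _ hξ
    rwa [add_sub_cancel_left, norm_smul, ha, mul_one, Real.norm_eq_abs] at this
  have hφD : φ ≤ D := by
    refine phiDist_le hD0.le fun l₁ l₂ h1 h2 hs => Real.sqrt_le_iff.2 ⟨hD0.le, ?_⟩
    have a1 := hline (-l₁) (mem_of_segment_line hs le_rfl (by linarith))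
    have a2 := hline l₂ (mem_of_segment_line hs (by linarith) le_rfl)
    rw [abs_neg, abs_of_nonneg h1] at a1
    rw [abs_of_nonneg h2] at a2
    rw [sq]
    exact mul_le_mul a1 a2 h2 hD0.le
  set t' := t₀ * t with ht'
  have ht'0 : 0 < t' := by positivity
  have hhn : |h| / n ≤ t' := by
    calc |h| / n = |h| * (1 / n) := by ring
      _ ≤ t * t₀ := by gcongr
      _ = t' := mul_comm _ _
  have hβ1 : |β| ≤ r * φ * (|h| / n) := hβ.trans (le_of_eq (by ring))
  have hβ2 : |β| ≤ B * t' := by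
    refine hβ1.trans ?_
    rw [hB]
    gcongr
  have hβ3 : |β| ≤ R / (8 * (K + 1)) := by
    refine le_trans ?_ hn3
    refine hβ1.trans ?_
    rw [hB, div_eq_mul_one_div |h|, div_eq_mul_one_div (r * D)]
    have : |h| * (1 / (n : ℝ)) ≤ 1 * (1 / n) := by gcongr; exact hht.trans ht1
    rw [one_mul] at this
    gcongr
  have hβ4 : |β| ≤ R / 8 :=
    hβ3.trans (div_le_div_of_nonneg_left hR.le (by positivity) (by linarith))
  have hz : ξ + α • a ∈ Ω := hsym α hα
  have hz' : ξ + (α + β) • a ∈ Ω := hsym (α + β) hαβ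
  set z := ξ + α • a with hzdef
  set z' := ξ + (α + β) • a with hz'def
  have hzz : z' - z = β • a := by rw [hzdef, hz'def]; module
  have hzn : ‖z' - z‖ = |β| := by rw [hzz, norm_smul, ha, mul_one, Real.norm_eq_abs]
  by_cases hfar : δ₁ ≤ depth Ω z
  · refine (rhoDist_le_of_le_depth hδ₁0 hfar (hzn.le.trans hβ2)).trans ?_
    exact mul_le_mul_of_nonneg_right (le_max_left _ _) ht'0.le
  push Not at hfar
  obtain ⟨p, hpf, hp⟩ := exists_frontier_norm_eq hΩ ⟨ξ, hξ⟩ z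
  obtain ⟨Ψ, Ψ', e, hc⟩ := hch p hpf
  have hzp : ‖z - p‖ < R / 16 := by rw [← hp]; linarith
  have hz'p : ‖z' - p‖ < R / 4 := by
    have := norm_sub_le_norm_sub_add_norm_sub z' z p
    linarith
  refine (hc.rhoDist_le hΩ (by linarith) hz'p hz hz' (by linarith) (by linarith)
    (hzn.le.trans hβ3) ht'0.le hB0.le hC₃0 (hzn.le.trans hβ2) ?_).trans
    (mul_le_mul_of_nonneg_right (le_max_right _ _) ht'0.le)
  set w := √(depth Ω z) with hw
  have hw0 : 0 ≤ w := Real.sqrt_nonneg _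
  have hw2 : w ^ 2 = depth Ω z := Real.sq_sqrt (depth_nonneg z)
  have hΨ0 := (hc.mem_iff z (by linarith)).1 hz
  have hΨK : Ψ z ≤ K * depth Ω z := by
    have h1 := (abs_le.1 (hc.lip p z (by rw [sub_self, norm_zero]; exact hR) (by linarith))).2
    rw [hc.frontier_eq_zero hΩ (by rw [sub_self, norm_zero]; exact hR) hpf, ← hp] at h1
    linarith
  have htay := hc.taylor z z z' (by linarith) (by linarith) (by linarith)
  rw [sub_self, norm_zero, zero_add, hzn, hzz, map_smul, smul_eq_mul] at htay
  set θ := |Ψ' z a| with hθ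
  have hθ0 : 0 ≤ θ := abs_nonneg _
  have hθK : θ ≤ K := by
    have h1 := (Ψ' z).le_opNorm a
    rw [ha, mul_one, Real.norm_eq_abs] at h1
    exact h1.trans (hc.norm_deriv_le z (by linarith))
  -- Three regimes. If the slope satisfies θ² = O(Ψ), then θ = O(√depth). Otherwise the line leaves
  -- Ω within m = 2Ψ/θ, so φ² ≤ D(m + L). If m dominates, then (φθ)² = O(Ψθ), so φθ = O(√depth). If
  -- L dominates, then φ = O(|h|), since L is a multiple of |h|φ, and the step is of second order in
  -- h.
  have hmain : |β| * θ ≤ C₂ * t' * (t' + w) := by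
    have T1 : 0 ≤ B * √(4 * (M + 1) * K) * t' * (t' + w) := by positivity
    have T2 : 0 ≤ r * √(4 * D * K * K) * t' * (t' + w) := by positivity
    have T3 : 0 ≤ r * (D * r) * K * t' * (t' + w) := by positivity
    have Tsum : C₂ * t' * (t' + w) = B * √(4 * (M + 1) * K) * t' * (t' + w) +
        r * √(4 * D * K * K) * t' * (t' + w) + r * (D * r) * K * t' * (t' + w) := by
      rw [hC₂]; ring
    by_cases hsteep : θ ^ 2 ≤ 4 * (M + 1) * Ψ z
    · have h1 : θ ≤ √(4 * (M + 1) * K) * w := by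
        rw [hw, ← Real.sqrt_mul (by positivity)]
        apply Real.le_sqrt_of_sq_le
        refine hsteep.trans ?_
        rw [mul_assoc _ K]
        gcongr
      calc |β| * θ ≤ B * t' * (√(4 * (M + 1) * K) * w) := by gcongr
        _ ≤ B * t' * (√(4 * (M + 1) * K) * (t' + w)) := by gcongr; linarith
        _ = B * √(4 * (M + 1) * K) * t' * (t' + w) := by ring
        _ ≤ _ := by linarith
    push Not at hsteep
    have hθpos : 0 < θ := by
      by_contra! hcon
      have : θ = 0 := le_antisymm hcon hθ0
      rw [this] at hsteep
      have : 0 ≤ 4 * (M + 1) * Ψ z := by positivity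
      linarith
    have hΨR : Ψ z < R ^ 2 / 16 := by
      rw [le_div_iff₀ (by positivity)] at hδK
      have := depth_nonneg (Ω := Ω) z
      nlinarith
    set L := r / 2 * (|h| * φ) with hL
    set m := 2 * Ψ z / θ with hm
    have hm0 : 0 ≤ m := by positivity
    obtain ⟨σ, hσ, hσd⟩ : ∃ σ : ℝ, (σ = 1 ∨ σ = -1) ∧ Ψ' z (σ • a) = -θ := by
      rcases le_or_gt 0 (Ψ' z a) with h0 | h0
      · exact ⟨-1, Or.inr rfl, by rw [map_smul, smul_eq_mul, hθ, abs_of_nonneg h0]; ring⟩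
      · exact ⟨1, Or.inl rfl, by rw [map_smul, smul_eq_mul, hθ, abs_of_neg h0]; ring⟩
    have hσa : ‖σ • a‖ = 1 := by
      rcases hσ with rfl | rfl <;> simp [ha]
    have hsq : φ ^ 2 ≤ D * (m + L) := by
      refine phiDist_sq_le ha hD0.le hD hξ hm0 hσ hα hsym fun l hl => ?_
      obtain ⟨l', h1, h2, h3⟩ := hc.exists_notMem_line hσa hθpos hσd (by linarith) hΨ0 hΨR hsteep hl
      refine ⟨l', h1, h2, ?_⟩
      convert h3 using 2
      rw [hzdef]
      module
    have hβθ : |β| * θ ≤ r * (|h| / n) * (φ * θ) := by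
      calc |β| * θ ≤ r * φ * (|h| / n) * θ := by gcongr
        _ = _ := by ring
    by_cases hcase : φ ^ 2 ≤ 2 * D * m
    · have h1 : φ * θ ≤ √(4 * D * K * K) * w := by
        rw [hw, ← Real.sqrt_mul (by positivity)]
        apply Real.le_sqrt_of_sq_le
        have hmθ : m * θ = 2 * Ψ z := div_mul_cancel₀ _ hθpos.ne'
        have hdz := depth_nonneg (Ω := Ω) z
        calc (φ * θ) ^ 2 = φ ^ 2 * θ * θ := by ring
          _ ≤ 2 * D * m * θ * θ := by gcongr
          _ = 2 * D * (m * θ) * θ := by ring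
          _ = 4 * D * Ψ z * θ := by rw [hmθ]; ring
          _ ≤ 4 * D * (K * depth Ω z) * K := by gcongr
          _ = _ := by ring
      calc |β| * θ ≤ r * (|h| / n) * (φ * θ) := hβθ
        _ ≤ r * t' * (√(4 * D * K * K) * w) := by gcongr
        _ ≤ r * t' * (√(4 * D * K * K) * (t' + w)) := by gcongr; linarith
        _ = r * √(4 * D * K * K) * t' * (t' + w) := by ring
        _ ≤ _ := by linarith
    · push Not at hcase
      have h1 : φ ≤ D * r * |h| := by
        have h2 : φ * φ ≤ D * r * |h| * φ := by
          have e1 : D * (m + L) = D * m + D * r * |h| * φ / 2 := by rw [hL]; ring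
          rw [e1, sq] at hsq
          rw [sq] at hcase
          linarith
        by_contra! hcon
        have hφpos : 0 < φ := lt_of_le_of_lt (by positivity) hcon
        have := mul_lt_mul_of_pos_right hcon hφpos
        linarith
      have h2 : |h| / n * |h| ≤ t' * t' := by
        calc |h| / n * |h| = 1 / n * (|h| * |h|) := by ring
          _ ≤ t₀ ^ 2 * (t * t) := by gcongr
          _ = t' * t' := by rw [ht']; ring
      calc |β| * θ ≤ r * (|h| / n) * (φ * θ) := hβθ
        _ ≤ r * (|h| / n) * (D * r * |h| * K) := by gcongr
        _ = r * (D * r) * K * (|h| / n * |h|) := by ring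
        _ ≤ r * (D * r) * K * (t' * t') := by gcongr
        _ ≤ r * (D * r) * K * (t' * (t' + w)) := by gcongr; linarith
        _ = r * (D * r) * K * t' * (t' + w) := by ring
        _ ≤ _ := by linarith
  have hq : M * |β| * |β| ≤ M * B * B * t' * (t' + w) := by
    calc M * |β| * |β| ≤ M * (B * t') * (B * t') := by gcongr
      _ ≤ M * (B * t') * (B * (t' + w)) := by gcongr; linarith
      _ = _ := by ring
  have habs : |Ψ z' - Ψ z| ≤ |β| * θ + M * |β| * |β| := by
    have e1 : Ψ z' - Ψ z = (Ψ z' - Ψ z - β * Ψ' z a) + β * Ψ' z a := by ring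
    rw [e1]
    refine (abs_add_le _ _).trans ?_
    rw [abs_mul β, ← hθ]
    linarith
  have e3 : C₃ * t' * (t' + w) = C₂ * t' * (t' + w) + M * B * B * t' * (t' + w) := by
    rw [hC₃]; ring
  linarith

end ShortSegments

/-! ### ρ_Ω-length of almost tangential segments -/

section TangentSegments

variable {d : ℕ} {Ω : Set (Ambient d)}

lemma horiz_tangentVec (g : Base d → ℝ) (j : Fin d) (u : Base d) :
    horiz (tangentVec g j u) = EuclideanSpace.single j 1 := by
  ext i
  simp [horiz, tangentVec]

lemma vert_tangentVec (g : Base d → ℝ) (j : Fin d) (u : Base d) :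
    vert (tangentVec g j u) = partialD j g u := by
  have h : (Fin.last d) ≠ j.castSucc := (Fin.castSucc_ne_last j).symm
  simp [vert, tangentVec, h]

lemma norm_tangentVec_le (g : Base d → ℝ) (j : Fin d) (u : Base d) :
    ‖tangentVec g j u‖ ≤ 1 + ‖fderiv ℝ g u‖ := by
  refine (norm_add_le _ _).trans ?_
  rw [norm_smul, PiLp.norm_single, PiLp.norm_single, norm_one, mul_one]
  gcongr
  refine ((fderiv ℝ g u).le_opNorm _).trans ?_
  rw [PiLp.norm_single, norm_one, mul_one]

/-- The vector is tangent to the graph above `u`, so only the variation of the gradient of g between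
`u` and the base point of `z` remains. -/
lemma SpecialDomain.levelDeriv_tangentVec (G : SpecialDomain d) (z : Ambient d) (j : Fin d)
    (u : Base d) : G.levelDeriv z (G.rot.symm (tangentVec G.g j u)) =
      (fderiv ℝ G.g (horiz (G.toStd z)) - fderiv ℝ G.g u) (EuclideanSpace.single j 1) := by
  rw [G.levelDeriv_apply, LinearIsometryEquiv.apply_symm_apply, horiz_tangentVec, vert_tangentVec]
  rfl

set_option maxHeartbeats 1000000 in
/-- The pieces of the segments that occur in the tangential moduli are short. -/
lemma SpecialDomain.exists_rhoDist_le_of_tangential (G : SpecialDomain d) (hΩ : IsCompact Ω)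
    (hG : G.IsAttached Ω) {r : ℕ} (hr : 1 ≤ r) :
    ∃ κ : ℝ, 0 < κ ∧ ∀ t₀ : ℝ, 0 < t₀ → t₀ ≤ 1 → ∃ n : ℕ, 1 ≤ n ∧ ∀ t, 0 < t → t ≤ 1 →
      ∀ s : ℝ, 0 < s → s ≤ t → ∀ c ∈ G.carrier, ∀ u : Base d, (∀ i, |u i| < G.b) →
      ‖u - horiz (G.toStd c)‖ ≤ t * G.b → ∀ j : Fin d, ∀ v : Ambient d,
      v = G.rot.symm (s • tangentVec G.g j u) →
      ∀ α β : ℝ, 0 ≤ α → α ≤ r → 0 ≤ β → β ≤ r / n → c + α • v ∈ Ω → c + α • v + β • v ∈ Ω →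
        rhoDist Ω (c + α • v) (c + α • v + β • v) ≤ κ * (t₀ * t) := by
  obtain ⟨R, M, K, hR, hM, hK, hch⟩ := G.exists_chartBounds hΩ hG
  have hr0 : (0 : ℝ) < r := by exact_mod_cast hr
  have hb := G.b_pos
  set δ₁ := min (R / 16) 1 with hδ₁
  have hδ₁0 : 0 < δ₁ := lt_min (by positivity) one_pos
  have hδR : δ₁ ≤ R / 16 := min_le_left _ _
  have hδ1 : δ₁ ≤ 1 := min_le_right _ _
  set B := r * (1 + K) with hB
  have hB0 : 0 < B := by positivity
  set C := B * (M * (B + G.b)) + M * B * B with hC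
  have hC0 : 0 ≤ C := by positivity
  set t₁ := R / (16 * (K + 1) * B) with ht₁
  have ht₁0 : 0 < t₁ := by positivity
  refine ⟨max (max (B * (1 + 1 / √δ₁)) (B + (2 * (C + 2 * M * B * (1 + 2 * B)) + 1))) 2,
    by positivity, fun t₀ ht₀ ht₀1 => ?_⟩
  -- The first summand makes the change of level at most a multiple of (t₀t)². The second makes a
  -- piece at most (t₀t)² long in Euclidean norm when `t ≥ t₁`.
  obtain ⟨n, hn1, hn⟩ := exists_nat_ge_and_one_le (1 / t₀ ^ 2 + B / (t₀ ^ 2 * t₁))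
  have hn0 : (0 : ℝ) < n := by exact_mod_cast hn1
  have hn2 : 1 / (n : ℝ) ≤ t₀ ^ 2 := by
    rw [one_div_le hn0 (by positivity)]
    have : 0 ≤ B / (t₀ ^ 2 * t₁) := by positivity
    linarith
  have hn3 : B / n ≤ t₀ ^ 2 * t₁ := by
    rw [div_le_iff₀ hn0, ← div_le_iff₀' (by positivity)]
    have : 0 ≤ 1 / t₀ ^ 2 := by positivity
    linarith
  have hn4 : 1 / (n : ℝ) ≤ t₀ := hn2.trans (by nlinarith)
  have hn5 : 1 / (n : ℝ) ≤ 1 := hn4.trans ht₀1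
  refine ⟨n, hn1, fun t ht ht1 s hs hst c hc u hu hut j v hv α β hα0 hαr hβ0 hβr hz hz' => ?_⟩
  have huQ : u ∈ bigCube d G.b := fun i => (hu i).le.trans (by linarith)
  set t' := t₀ * t with ht'
  have ht'0 : 0 < t' := by positivity
  have ht'1 : t' ≤ 1 := mul_le_one₀ ht₀1 ht.le ht1
  have hvn : ‖v‖ ≤ t * (1 + K) := by
    rw [hv, LinearIsometryEquiv.norm_map, norm_smul, Real.norm_of_nonneg hs.le]
    have h1 : ‖tangentVec G.g j u‖ ≤ 1 + K :=
      (norm_tangentVec_le _ _ _).trans (by linarith [hch.norm_fderiv_le u huQ])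
    gcongr
  have hαv : ‖α • v‖ ≤ B * t := by
    rw [norm_smul, Real.norm_of_nonneg hα0, hB]
    calc α * ‖v‖ ≤ r * (t * (1 + K)) := by gcongr
      _ = r * (1 + K) * t := by ring
  have hβv : ‖β • v‖ ≤ B * t * (1 / n) := by
    rw [norm_smul, Real.norm_of_nonneg hβ0, hB]
    calc β * ‖v‖ ≤ r / n * (t * (1 + K)) := by gcongr
      _ = r * (1 + K) * t * (1 / n) := by ring
  have hβv2 : ‖β • v‖ ≤ B * t' := by
    refine hβv.trans ?_
    calc B * t * (1 / n) ≤ B * t * t₀ := by gcongr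
      _ = B * t' := by rw [ht']; ring
  have hβv3 : ‖β • v‖ ≤ B * t := hβv.trans (mul_le_of_le_one_right (by positivity) hn5)
  set z := c + α • v with hzdef
  set z' := z + β • v with hz'def
  have hzz : z' - z = β • v := by rw [hz'def, add_sub_cancel_left]
  have hzn : ‖z' - z‖ = ‖β • v‖ := by rw [hzz]
  -- For such `t` the segment may leave the chart around `c`, and the Hölder bound for the square
  -- root is used instead.
  by_cases hlarge : t₁ ≤ t
  · refine (rhoDist_le_of_norm_le_sq ht'0.le ht'1 ?_).trans
      (mul_le_mul_of_nonneg_right (le_max_right _ _) ht'0.le)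
    rw [norm_sub_rev, hzn]
    refine hβv.trans ?_
    calc B * t * (1 / n) = t * (B / n) := by ring
      _ ≤ t * (t₀ ^ 2 * t₁) := by gcongr
      _ ≤ t * (t₀ ^ 2 * t) := by gcongr
      _ = t' ^ 2 := by rw [ht']; ring
  push Not at hlarge
  have hBt : B * t ≤ R / (16 * (K + 1)) := by
    rw [ht₁, lt_div_iff₀ (by positivity)] at hlarge
    rw [le_div_iff₀ (by positivity)]
    linarith
  have hBt8 : B * t ≤ R / (8 * (K + 1)) :=
    hBt.trans (div_le_div_of_nonneg_left hR.le (by positivity) (by linarith))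
  have hBt16 : B * t ≤ R / 16 :=
    hBt.trans (div_le_div_of_nonneg_left hR.le (by positivity) (by linarith))
  have hle1 : max (B * (1 + 1 / √δ₁)) (B + (2 * (C + 2 * M * B * (1 + 2 * B)) + 1)) ≤
    max (max (B * (1 + 1 / √δ₁)) (B + (2 * (C + 2 * M * B * (1 + 2 * B)) + 1))) 2 := le_max_left _ _
  by_cases hfar : δ₁ ≤ depth Ω z
  · refine (rhoDist_le_of_le_depth hδ₁0 hfar (hzn.le.trans hβv2)).trans ?_
    exact mul_le_mul_of_nonneg_right ((le_max_left _ _).trans hle1) ht'0.le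
  push Not at hfar
  have hloc := hch.chart c hc
  have hzc0 : ‖z - c‖ ≤ B * t := by rw [hzdef, add_sub_cancel_left]; exact hαv
  have hzc : ‖z - c‖ ≤ R / 16 := hzc0.trans hBt16
  have hz'c : ‖z' - c‖ ≤ R / 8 := by
    have := norm_sub_le_norm_sub_add_norm_sub z' z c
    linarith
  refine (hloc.rhoDist_le hΩ (by linarith) (by linarith) hz hz' (by linarith) (by linarith)
    (hzn.le.trans (hβv3.trans hBt8)) ht'0.le hB0.le hC0 (hzn.le.trans hβv2) ?_).trans
    (mul_le_mul_of_nonneg_right ((le_max_right _ _).trans hle1) ht'0.le)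
  have hw0 : 0 ≤ √(depth Ω z) := Real.sqrt_nonneg _
  have htay := hloc.taylor z z z' (by linarith) (by linarith) (by linarith)
  rw [sub_self, norm_zero, zero_add, hzn, hzz] at htay
  have hzQ := hch.horiz_mem c hc z (by linarith)
  have hdist : ‖horiz (G.toStd z) - u‖ ≤ (B + G.b) * t := by
    have h1 := norm_sub_le_norm_sub_add_norm_sub (horiz (G.toStd z)) (horiz (G.toStd c)) u
    have h2 := G.norm_horiz_toStd_sub_le c z
    rw [norm_sub_rev] at hut
    linarith
  -- Here `u` and the base point of `z` are O(t) apart, so the slope of `level` along the tangent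
  -- vector is O(t); the step `β s ≤ r t / n` supplies the other factor t and the factor t₀².
  have hder : |G.levelDeriv z (β • v)| ≤ B * (M * (B + G.b)) * (t' * t') := by
    rw [map_smul, hv, map_smul, map_smul, G.levelDeriv_tangentVec, smul_eq_mul, smul_eq_mul,
      abs_mul, abs_mul, abs_of_nonneg hβ0, abs_of_pos hs]
    have h1 := ((fderiv ℝ G.g (horiz (G.toStd z)) - fderiv ℝ G.g u)).le_opNorm
      (EuclideanSpace.single j 1)
    rw [PiLp.norm_single, norm_one, mul_one, Real.norm_eq_abs] at h1
    have h2 := hch.norm_fderiv_sub_le u huQ _ hzQ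
    have h3 : |(fderiv ℝ G.g (horiz (G.toStd z)) - fderiv ℝ G.g u)
        (EuclideanSpace.single j 1)| ≤ M * ((B + G.b) * t) :=
      h1.trans (h2.trans (by gcongr))
    have hrB : (r : ℝ) ≤ B := le_mul_of_one_le_right hr0.le (by linarith)
    calc β * (s * |(fderiv ℝ G.g (horiz (G.toStd z)) - fderiv ℝ G.g u)
        (EuclideanSpace.single j 1)|) ≤ r / n * (t * (M * ((B + G.b) * t))) := by gcongr
      _ = r * (M * (B + G.b)) * (1 / n * (t * t)) := by ring
      _ ≤ B * (M * (B + G.b)) * (t₀ ^ 2 * (t * t)) := by gcongr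
      _ = B * (M * (B + G.b)) * (t' * t') := by rw [ht']; ring
  have hq : M * ‖β • v‖ * ‖β • v‖ ≤ M * B * B * (t' * t') := by
    calc M * ‖β • v‖ * ‖β • v‖ ≤ M * (B * t') * (B * t') := by gcongr
      _ = _ := by ring
  have habs : |G.level z' - G.level z| ≤ C * (t' * t') := by
    have e1 : G.level z' - G.level z =
      (G.level z' - G.level z - G.levelDeriv z (β • v)) + G.levelDeriv z (β • v) := by ring
    rw [e1]
    refine (abs_add_le _ _).trans ?_
    have e2 : C * (t' * t') = B * (M * (B + G.b)) * (t' * t') + M * B * B * (t' * t') := by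
      rw [hC]; ring
    linarith
  calc |G.level z' - G.level z| ≤ C * (t' * t') := habs
    _ ≤ C * (t' * (t' + √(depth Ω z))) := by gcongr; linarith
    _ = C * t' * (t' + √(depth Ω z)) := by ring

end TangentSegments

/-! ### Change of variables on a line -/

section ChangeOfVariables

/-- The change of variables `y ↦ y + c β √(l₁ l₂)` on the part of a set of reals where
`β √(l₁ l₂) ≤ min l₁ l₂`; here `l₁` and `l₂` are the distances to the ends of the component. -/
lemma setLIntegral_comp_add_sqrt_le {A : Set ℝ} (hA : MeasurableSet A) {l₁ l₂ : ℝ → ℝ}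
    (hm₁ : Measurable l₁) (hm₂ : Measurable l₂)
    (hnn : ∀ y ∈ A, 0 ≤ l₁ y ∧ 0 ≤ l₂ y)
    (hmem : ∀ y ∈ A, ∀ x, -l₁ y ≤ x → x ≤ l₂ y → y + x ∈ A)
    (hshift : ∀ y ∈ A, ∀ x, -l₁ y ≤ x → x ≤ l₂ y → l₁ (y + x) = l₁ y + x ∧ l₂ (y + x) = l₂ y - x)
    {β c : ℝ} (hβ : 0 ≤ β) (hc : |c| ≤ 1) (F : ℝ → ℝ≥0∞) :
    ∫⁻ y in {y ∈ A | β * √(l₁ y * l₂ y) ≤ l₁ y ∧ β * √(l₁ y * l₂ y) ≤ l₂ y},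
      F (y + c * (β * √(l₁ y * l₂ y))) ≤ 3 * ∫⁻ y in A, F y := by
  set φ : ℝ → ℝ := fun y => √(l₁ y * l₂ y) with hφ
  have hφm : Measurable φ := (hm₁.mul hm₂).sqrt
  set D : Set ℝ := {y ∈ A | β * φ y ≤ l₁ y ∧ β * φ y ≤ l₂ y} with hD
  set P : Set ℝ := {y | 0 < φ y} with hP
  have hPm : MeasurableSet P := measurableSet_lt measurable_const hφm
  have hDm : MeasurableSet D := hA.inter ((measurableSet_le (hφm.const_mul β) hm₁).inter
    (measurableSet_le (hφm.const_mul β) hm₂))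
  set T : ℝ → ℝ := fun y => y + c * (β * φ y) with hT
  change ∫⁻ y in D, F (T y) ≤ _
  have hφ0 : ∀ y, 0 ≤ φ y := fun y => Real.sqrt_nonneg _
  have hsq : ∀ y ∈ A, φ y ^ 2 = l₁ y * l₂ y := fun y hy =>
    Real.sq_sqrt (mul_nonneg (hnn y hy).1 (hnn y hy).2)
  have hcβ : ∀ y, |c * (β * φ y)| ≤ β * φ y := by
    intro y
    have h0 : 0 ≤ β * φ y := mul_nonneg hβ (hφ0 y)
    rw [abs_mul, abs_of_nonneg h0]
    exact mul_le_of_le_one_left h0 hc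
  have hstep : ∀ y ∈ D, -l₁ y ≤ c * (β * φ y) ∧ c * (β * φ y) ≤ l₂ y := by
    intro y hy
    have := abs_le.1 (hcβ y)
    exact ⟨by linarith [hy.2.1], by linarith [hy.2.2]⟩
  -- From φ² = l₁l₂ and βφ ≤ min(l₁, l₂) one gets βl₁, βl₂ ≤ φ. As φ' = (l₂ - l₁)/(2φ), the
  -- derivative of `T` differs from 1 by at most 1/2.
  have hslope : ∀ y ∈ D, 0 < φ y → |c * β * (l₂ y - l₁ y)| ≤ φ y := by
    intro y hy hpos
    have e := hsq y hy.1
    have h1 : β * l₁ y ≤ φ y := by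
      have : β * l₁ y * φ y ≤ φ y * φ y := by
        calc β * l₁ y * φ y = l₁ y * (β * φ y) := by ring
          _ ≤ l₁ y * l₂ y := mul_le_mul_of_nonneg_left hy.2.2 (hnn y hy.1).1
          _ = φ y * φ y := by rw [← e]; ring
      exact le_of_mul_le_mul_right this hpos
    have h2 : β * l₂ y ≤ φ y := by
      have : β * l₂ y * φ y ≤ φ y * φ y := by
        calc β * l₂ y * φ y = (β * φ y) * l₂ y := by ring
          _ ≤ l₁ y * l₂ y := mul_le_mul_of_nonneg_right hy.2.1 (hnn y hy.1).2
          _ = φ y * φ y := by rw [← e]; ring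
      exact le_of_mul_le_mul_right this hpos
    have h3 : |β * (l₂ y - l₁ y)| ≤ φ y := by
      have a1 := mul_nonneg hβ (hnn y hy.1).1
      have a2 := mul_nonneg hβ (hnn y hy.1).2
      rw [abs_le]
      constructor <;> linarith
    rw [mul_assoc, abs_mul]
    exact (mul_le_of_le_one_left (abs_nonneg _) hc).trans h3
  have hmaps : ∀ y ∈ D, T y ∈ A := fun y hy => hmem y hy.1 _ (hstep y hy).1 (hstep y hy).2
  set T' : ℝ → ℝ := fun y => 1 + c * (β * ((l₂ y - l₁ y) / (2 * φ y))) with hT'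
  have hderiv : ∀ y ∈ D ∩ P, HasDerivWithinAt T (T' y) (D ∩ P) y := by
    rintro y ⟨hy, hpos⟩
    apply HasDerivAt.hasDerivWithinAt
    have hl : l₁ y * l₂ y ≠ 0 := by
      rw [← hsq y hy.1]
      exact (pow_pos hpos 2).ne'
    have hl1 : 0 < l₁ y := lt_of_le_of_ne (hnn y hy.1).1 (fun h => hl (by rw [← h, zero_mul]))
    have hl2 : 0 < l₂ y := lt_of_le_of_ne (hnn y hy.1).2 (fun h => hl (by rw [← h, mul_zero]))
    have hd0 : HasDerivAt (fun x : ℝ => (l₁ y + (x - y)) * (l₂ y - (x - y))) (l₂ y - l₁ y) y := by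
      have h1 : HasDerivAt (fun x : ℝ => l₁ y + (x - y)) 1 y :=
        ((hasDerivAt_id y).sub_const y).const_add _
      have h2 : HasDerivAt (fun x : ℝ => l₂ y - (x - y)) (-1) y :=
        ((hasDerivAt_id y).sub_const y).const_sub _
      refine (h1.mul h2).congr_deriv ?_
      ring
    have hd1 : HasDerivAt (fun x : ℝ => √((l₁ y + (x - y)) * (l₂ y - (x - y))))
        ((l₂ y - l₁ y) / (2 * φ y)) y := by
      have := hd0.sqrt (by simpa using hl)
      simpa using this
    have hd2 : HasDerivAt φ ((l₂ y - l₁ y) / (2 * φ y)) y := by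
      refine hd1.congr_of_eventuallyEq ?_
      have hnhds : Set.Ioo (y - l₁ y) (y + l₂ y) ∈ nhds y :=
        Ioo_mem_nhds (by linarith) (by linarith)
      filter_upwards [hnhds] with x hx
      have := hshift y hy.1 (x - y) (by linarith [hx.1]) (by linarith [hx.2])
      rw [add_sub_cancel] at this
      simp only [hφ]
      rw [this.1, this.2]
    exact (hasDerivAt_id y).add ((hd2.const_mul β).const_mul c)
  have hTlow : ∀ y ∈ D ∩ P, (1 : ℝ≥0∞) ≤ 2 * ENNReal.ofReal |T' y| := by
    rintro y ⟨hy, hpos⟩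
    have hpos' : 0 < φ y := hpos
    have h1 := hslope y hy hpos
    have h2 : |c * (β * ((l₂ y - l₁ y) / (2 * φ y)))| ≤ 1 / 2 := by
      rw [show c * (β * ((l₂ y - l₁ y) / (2 * φ y))) = c * β * (l₂ y - l₁ y) / (2 * φ y) by ring,
        abs_div, abs_of_pos (show 0 < 2 * φ y by linarith), div_le_div_iff₀ (by linarith) two_pos]
      linarith
    have h3 : 1 / 2 ≤ |T' y| := by
      have := (abs_le.1 h2).1
      exact le_trans (by simp only [hT']; linarith) (le_abs_self _)
    rw [← ENNReal.ofReal_ofNat, ← ENNReal.ofReal_mul (by norm_num), ENNReal.one_le_ofReal]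
    linarith
  -- Monotonicity is not available, as the set need not be an interval. A common image puts both
  -- points in one component, where l₁ and l₂ are affine; then φ(y)² - φ(y')² is computed exactly.
  -- Cancelling φ(y) - φ(y') would give 2(φ(y) + φ(y')) ≤ φ(y) + φ(y').
  have hinj : Set.InjOn T (D ∩ P) := by
    rintro y ⟨hy, hpos⟩ y' ⟨hy', hpos'⟩ hTT
    have hpy : 0 < φ y := hpos
    have hpy' : 0 < φ y' := hpos'
    have e1 := hshift y hy.1 _ (hstep y hy).1 (hstep y hy).2
    have e2 := hshift y' hy'.1 _ (hstep y' hy').1 (hstep y' hy').2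
    simp only [hT] at hTT
    rw [hTT, e2.1, e2.2] at e1
    have s1 := hsq y hy.1
    have s2 := hsq y' hy'.1
    have b1 := hslope y hy hpy
    have b2 := hslope y' hy' hpy'
    by_contra hne
    set u := φ y with hu
    set u' := φ y' with hu'
    have hΔ : y' - y = c * β * (u - u') := by linarith
    have huu : u - u' ≠ 0 := by
      intro h0
      rw [h0, mul_zero] at hΔ
      exact hne (by linarith)
    have f1 : l₁ y' = l₁ y + (y' - y) := by linarith [e1.1]
    have f2 : l₂ y' = l₂ y - (y' - y) := by linarith [e1.2]
    have h4 : (u - u') * (2 * (u + u')) =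
        (u - u') * (-(c * β * (l₂ y - l₁ y)) - c * β * (l₂ y' - l₁ y')) := by
      have h5 : 2 * (u ^ 2 - u' ^ 2) = -(y' - y) * ((l₂ y - l₁ y) + (l₂ y' - l₁ y')) := by
        rw [s1, s2, f1, f2]; ring
      calc (u - u') * (2 * (u + u')) = 2 * (u ^ 2 - u' ^ 2) := by ring
        _ = -(y' - y) * ((l₂ y - l₁ y) + (l₂ y' - l₁ y')) := h5
        _ = _ := by rw [hΔ]; ring
    have h6 := mul_left_cancel₀ huu h4
    have h7 := (abs_le.1 b1).1
    have h8 := (abs_le.1 b2).1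
    linarith
  rw [← lintegral_inter_add_sdiff (fun y => F (T y)) D hPm]
  have h1 : ∫⁻ y in D ∩ P, F (T y) ≤ 2 * ∫⁻ y in A, F y := by
    calc ∫⁻ y in D ∩ P, F (T y)
        ≤ ∫⁻ y in D ∩ P, 2 * (ENNReal.ofReal |T' y| * F (T y)) := by
          refine setLIntegral_mono' (hDm.inter hPm) fun y hy => ?_
          rw [← mul_assoc]
          exact le_mul_of_one_le_left zero_le (hTlow y hy)
      _ = 2 * ∫⁻ y in T '' (D ∩ P), F y := by
          rw [lintegral_const_mul' _ _ (by norm_num),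
            lintegral_image_eq_lintegral_abs_deriv_mul (hDm.inter hPm) hderiv hinj]
      _ ≤ 2 * ∫⁻ y in A, F y := by
          gcongr
          rintro _ ⟨y, hy, rfl⟩
          exact hmaps y hy.1
  -- Where φ vanishes the map is the identity; with the factor 2 above this accounts for the
  -- constant 3.
  have h2 : ∫⁻ y in D \ P, F (T y) ≤ ∫⁻ y in A, F y := by
    calc ∫⁻ y in D \ P, F (T y) = ∫⁻ y in D \ P, F y := by
          refine setLIntegral_congr_fun (hDm.diff hPm) fun y hy => ?_
          have : φ y = 0 := le_antisymm (not_lt.1 hy.2) (hφ0 y)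
          simp only [hT, this, mul_zero, add_zero]
      _ ≤ ∫⁻ y in A, F y := lintegral_mono_set fun y hy => hy.1.1
  calc _ ≤ (2 * ∫⁻ y in A, F y) + ∫⁻ y in A, F y := add_le_add h1 h2
    _ = 3 * ∫⁻ y in A, F y := by ring

variable {d : ℕ}

lemma lintegral_eq_lintegral_line (j : Fin (d + 1)) {H : Ambient d → ℝ≥0∞} (hH : Measurable H) :
    ∫⁻ z, H z = ∫⁻ x : Fin d → ℝ, ∫⁻ y : ℝ,
      H (WithLp.toLp 2 (j.insertNth 0 x : Fin (d + 1) → ℝ) + y • EuclideanSpace.single j 1) := by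
  have h1 : ∫⁻ z, H z = ∫⁻ v : Fin (d + 1) → ℝ, H (WithLp.toLp 2 v) :=
    ((PiLp.volume_preserving_toLp (Fin (d + 1))).lintegral_comp hH).symm
  have hH2 : Measurable fun v : Fin (d + 1) → ℝ => H (WithLp.toLp 2 v) :=
    hH.comp (PiLp.volume_preserving_toLp (Fin (d + 1))).measurable
  have h2 := (volume_preserving_piFinSuccAbove (fun _ : Fin (d + 1) => ℝ) j).symm.lintegral_comp hH2
  rw [h1, ← h2, Measure.volume_eq_prod, lintegral_prod_symm']
  · refine lintegral_congr fun x => lintegral_congr fun y => ?_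
    congr 1
    ext i
    change (j.insertNth y x : Fin (d + 1) → ℝ) i =
      (j.insertNth 0 x : Fin (d + 1) → ℝ) i + y * (EuclideanSpace.single j (1 : ℝ)) i
    refine Fin.succAboveCases j ?_ (fun k => ?_) i
    · simp
    · simp [Fin.succAbove_ne]
  · exact hH2.comp (MeasurableEquiv.measurable _)

end ChangeOfVariables

/-! ### Distance to the ends of a line component, and φ_Ω -/

section Reach

variable {d : ℕ} {Ω : Set (Ambient d)}

/-- How far one can go from `ξ` in the direction `a` without leaving `Ω`. -/
noncomputable def reach (Ω : Set (Ambient d)) (a ξ : Ambient d) : ℝ :=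
  sSup {l | 0 ≤ l ∧ ∀ x : ℝ, 0 ≤ x → x ≤ l → ξ + x • a ∈ Ω}

lemma reach_nonneg (a ξ : Ambient d) : 0 ≤ reach Ω a ξ := Real.sSup_nonneg fun _ h => h.1

lemma bddAbove_reach (hΩ : IsCompact Ω) {a : Ambient d} (ha : ‖a‖ = 1) (ξ : Ambient d) :
    BddAbove {l | 0 ≤ l ∧ ∀ x : ℝ, 0 ≤ x → x ≤ l → ξ + x • a ∈ Ω} := by
  obtain ⟨D, hD⟩ := hΩ.isBounded.exists_norm_le
  refine ⟨D + ‖ξ‖, fun l hl => ?_⟩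
  have h1 := hD _ (hl.2 l hl.1 le_rfl)
  have h2 : l = ‖(ξ + l • a) - ξ‖ := by
    rw [add_sub_cancel_left, norm_smul, ha, mul_one, Real.norm_of_nonneg hl.1]
  rw [h2]
  exact (norm_sub_le _ _).trans (by linarith)

lemma le_reach (hΩ : IsCompact Ω) {a : Ambient d} (ha : ‖a‖ = 1) {ξ : Ambient d} {l : ℝ}
    (hl : 0 ≤ l) (h : ∀ x : ℝ, 0 ≤ x → x ≤ l → ξ + x • a ∈ Ω) : l ≤ reach Ω a ξ :=
  le_csSup (bddAbove_reach hΩ ha ξ) ⟨hl, h⟩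

/-- The supremum is attained because `Ω` is closed. -/
lemma mem_of_le_reach (hΩ : IsCompact Ω) {a ξ : Ambient d} (hξ : ξ ∈ Ω)
    {x : ℝ} (h0 : 0 ≤ x) (h : x ≤ reach Ω a ξ) : ξ + x • a ∈ Ω := by
  have hne : {l | 0 ≤ l ∧ ∀ x : ℝ, 0 ≤ x → x ≤ l → ξ + x • a ∈ Ω}.Nonempty :=
    ⟨0, le_rfl, fun x h0 h1 => by rw [le_antisymm h1 h0, zero_smul, add_zero]; exact hξ⟩
  have hlt : ∀ y : ℝ, 0 ≤ y → y < reach Ω a ξ → ξ + y • a ∈ Ω := by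
    intro y hy0 hy
    obtain ⟨l, hl, hyl⟩ := exists_lt_of_lt_csSup hne hy
    exact hl.2 y hy0 hyl.le
  rcases eq_or_lt_of_le h0 with rfl | hpos
  · rw [zero_smul, add_zero]; exact hξ
  have hcl : IsClosed {y : ℝ | ξ + y • a ∈ Ω} :=
    hΩ.isClosed.preimage (by fun_prop)
  have hsub : Set.Ioo 0 x ⊆ {y : ℝ | ξ + y • a ∈ Ω} := fun y hy =>
    hlt y hy.1.le (hy.2.trans_le h)
  have := hcl.closure_subset_iff.2 hsub
  rw [closure_Ioo hpos.ne] at this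
  exact this ⟨h0, le_rfl⟩

lemma mem_of_mem_reach (hΩ : IsCompact Ω) {a ξ : Ambient d} (hξ : ξ ∈ Ω)
    {x : ℝ} (h1 : -reach Ω (-a) ξ ≤ x) (h2 : x ≤ reach Ω a ξ) : ξ + x • a ∈ Ω := by
  rcases le_total 0 x with h0 | h0
  · exact mem_of_le_reach hΩ hξ h0 h2
  · have := mem_of_le_reach hΩ (a := -a) hξ (neg_nonneg.2 h0) (by linarith)
    rwa [smul_neg, neg_smul, neg_neg] at this

lemma reach_add (hΩ : IsCompact Ω) {a ξ : Ambient d} (ha : ‖a‖ = 1) (hξ : ξ ∈ Ω)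
    {x : ℝ} (h1 : -reach Ω (-a) ξ ≤ x) (h2 : x ≤ reach Ω a ξ) :
    reach Ω a (ξ + x • a) = reach Ω a ξ - x := by
  have hη := mem_of_mem_reach hΩ hξ h1 h2
  apply le_antisymm
  · rw [le_sub_iff_add_le]
    rcases lt_or_ge (reach Ω a (ξ + x • a) + x) 0 with hneg | hpos
    · exact hneg.le.trans (reach_nonneg _ _)
    refine le_reach hΩ ha hpos fun y hy0 hy => ?_
    rcases le_total y x with hyx | hyx
    · exact mem_of_le_reach hΩ hξ hy0 (hyx.trans h2)
    · have := mem_of_le_reach hΩ hη (sub_nonneg.2 hyx) (by linarith)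
      rwa [add_assoc, ← add_smul, add_sub_cancel] at this
  · refine le_reach hΩ ha (by linarith) fun y hy0 hy => ?_
    rw [add_assoc, ← add_smul]
    exact mem_of_mem_reach hΩ hξ (by linarith) (by linarith)

lemma reach_neg_add (hΩ : IsCompact Ω) {a ξ : Ambient d} (ha : ‖a‖ = 1) (hξ : ξ ∈ Ω)
    {x : ℝ} (h1 : -reach Ω (-a) ξ ≤ x) (h2 : x ≤ reach Ω a ξ) :
    reach Ω (-a) (ξ + x • a) = reach Ω (-a) ξ + x := by
  have := reach_add hΩ (a := -a) (x := -x) (by rwa [norm_neg]) hξ (by rw [neg_neg]; linarith)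
    (by linarith)
  rwa [smul_neg, neg_smul, neg_neg, sub_neg_eq_add] at this

/-- For c > 0 the superlevel set is an intersection of translates of `Ω`, hence closed. Outside `Ω`
the supremum is over the empty set and is 0, so those points do not enter. -/
lemma measurable_reach (hΩ : IsCompact Ω) {a : Ambient d} (ha : ‖a‖ = 1) :
    Measurable (reach Ω a) := by
  refine measurable_of_Ici fun c => ?_
  rcases le_or_gt c 0 with hc | hc
  · convert MeasurableSet.univ
    exact Set.eq_univ_of_forall fun ξ => hc.trans (reach_nonneg a ξ)
  · have : reach Ω a ⁻¹' Set.Ici c = ⋂ x ∈ Set.Icc 0 c, (fun ξ => ξ + x • a) ⁻¹' Ω := by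
      ext ξ
      simp only [Set.mem_preimage, Set.mem_Ici, Set.mem_iInter, Set.mem_Icc]
      constructor
      · rintro h x ⟨hx0, hx⟩
        refine mem_of_le_reach hΩ ?_ hx0 (hx.trans h)
        by_contra hξ
        have hem : {l | 0 ≤ l ∧ ∀ x : ℝ, 0 ≤ x → x ≤ l → ξ + x • a ∈ Ω} = ∅ := by
          rw [Set.eq_empty_iff_forall_notMem]
          rintro l ⟨hl0, hl⟩
          have := hl 0 le_rfl hl0
          rw [zero_smul, add_zero] at this
          exact hξ this
        rw [reach, hem, Real.sSup_empty] at h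
        linarith
      · intro h
        exact le_reach hΩ ha hc.le fun x h0 h1 => h x ⟨h0, h1⟩
    rw [this]
    apply IsClosed.measurableSet
    exact isClosed_biInter fun x _ => hΩ.isClosed.preimage (by fun_prop)

/-- Both lengths can be maximal at once. This identifies φ_Ω with the function √(l₁l₂) of the
one-dimensional change of variables and makes it measurable on `Ω`. -/
lemma phiDist_eq_sqrt_reach (hΩ : IsCompact Ω) {a ξ : Ambient d} (ha : ‖a‖ = 1) (hξ : ξ ∈ Ω) :
    phiDist Ω a ξ = √(reach Ω (-a) ξ * reach Ω a ξ) := by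
  apply IsGreatest.csSup_eq
  constructor
  · refine ⟨_, _, reach_nonneg _ _, reach_nonneg _ _, ?_, rfl⟩
    have e : ξ + reach Ω a ξ • a = (ξ - reach Ω (-a) ξ • a) +
        (reach Ω (-a) ξ + reach Ω a ξ) • a := by module
    rw [e, segment_add_subset_iff]
    intro τ h0 h1
    have hn1 := reach_nonneg (Ω := Ω) a ξ
    have hn2 := reach_nonneg (Ω := Ω) (-a) ξ
    rw [show ξ - reach Ω (-a) ξ • a + τ • (reach Ω (-a) ξ + reach Ω a ξ) • a =
      ξ + (-reach Ω (-a) ξ + τ * (reach Ω (-a) ξ + reach Ω a ξ)) • a by module]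
    refine mem_of_mem_reach hΩ hξ ?_ ?_
    · have := mul_nonneg h0 (add_nonneg hn2 hn1)
      linarith
    · have := mul_le_of_le_one_left (add_nonneg hn2 hn1) h1
      linarith
  · rintro v ⟨l₁, l₂, h1, h2, hs, rfl⟩
    apply Real.sqrt_le_sqrt
    refine mul_le_mul ?_ ?_ h2 (reach_nonneg _ _)
    · refine le_reach hΩ (by rwa [norm_neg]) h1 fun x hx0 hx => ?_
      rw [smul_neg, ← neg_smul]
      exact mem_of_segment_line hs (by linarith) (by linarith)
    · exact le_reach hΩ ha h2 fun x hx0 hx => mem_of_segment_line hs (by linarith) hx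

/-- The change of variables `ξ ↦ ξ + c β φ_Ω(e_j, ξ) e_j` in `Ω`. -/
lemma setLIntegral_comp_add_phiDist_le (hΩ : IsCompact Ω) (j : Fin (d + 1)) {β c : ℝ}
    (hβ : 0 ≤ β) (hc : |c| ≤ 1) {F : Ambient d → ℝ≥0∞} (hF : Measurable F) :
    ∫⁻ ξ in {ξ ∈ Ω | ∀ x : ℝ, |x| ≤ β * phiDist Ω (EuclideanSpace.single j 1) ξ →
        ξ + x • EuclideanSpace.single j 1 ∈ Ω},
      F (ξ + (c * (β * phiDist Ω (EuclideanSpace.single j 1) ξ)) • EuclideanSpace.single j 1) ≤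
      3 * ∫⁻ ξ in Ω, F ξ := by
  set a : Ambient d := EuclideanSpace.single j 1 with ha'
  have ha : ‖a‖ = 1 := by rw [ha', PiLp.norm_single, norm_one]
  have ha2 : ‖-a‖ = 1 := by rwa [norm_neg]
  have hm1 := measurable_reach hΩ ha2
  have hm2 := measurable_reach hΩ ha
  set φ : Ambient d → ℝ := fun ξ => √(reach Ω (-a) ξ * reach Ω a ξ) with hφ
  have hφm : Measurable φ := (hm1.mul hm2).sqrt
  set S : Set (Ambient d) := {ξ ∈ Ω | β * φ ξ ≤ reach Ω (-a) ξ ∧ β * φ ξ ≤ reach Ω a ξ} with hS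
  have hSm : MeasurableSet S := hΩ.measurableSet.inter
    ((measurableSet_le (hφm.const_mul β) hm1).inter (measurableSet_le (hφm.const_mul β) hm2))
  have hSsub : {ξ ∈ Ω | ∀ x : ℝ, |x| ≤ β * phiDist Ω a ξ → ξ + x • a ∈ Ω} ⊆ S := by
    rintro ξ ⟨hξ, h⟩
    rw [phiDist_eq_sqrt_reach hΩ ha hξ] at h
    have h0 : 0 ≤ β * φ ξ := mul_nonneg hβ (Real.sqrt_nonneg _)
    refine ⟨hξ, le_reach hΩ ha2 h0 fun x hx0 hx => ?_, le_reach hΩ ha h0 fun x hx0 hx =>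
      h x (by rwa [abs_of_nonneg hx0])⟩
    rw [smul_neg, ← neg_smul]
    exact h _ (by rwa [abs_neg, abs_of_nonneg hx0])
  refine (lintegral_mono_set hSsub).trans ?_
  have hG : Measurable fun ξ => F (ξ + (c * (β * φ ξ)) • a) := by
    apply hF.comp
    exact measurable_id.add (((hφm.const_mul β).const_mul c).smul_const a)
  calc ∫⁻ ξ in S, F (ξ + (c * (β * phiDist Ω a ξ)) • a)
      = ∫⁻ ξ in S, F (ξ + (c * (β * φ ξ)) • a) := by
        refine setLIntegral_congr_fun hSm fun ξ hξ => ?_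
        rw [phiDist_eq_sqrt_reach hΩ ha hξ.1]
    _ = ∫⁻ ξ, S.indicator (fun ξ => F (ξ + (c * (β * φ ξ)) • a)) ξ :=
        (lintegral_indicator hSm _).symm
    _ ≤ ∫⁻ ξ, 3 * Ω.indicator F ξ := by
        rw [lintegral_eq_lintegral_line j (hG.indicator hSm), lintegral_eq_lintegral_line j
          ((hF.indicator hΩ.measurableSet).const_mul 3)]
        refine lintegral_mono fun x => ?_
        set ξ₀ : Ambient d := WithLp.toLp 2 (j.insertNth 0 x : Fin (d + 1) → ℝ) with hξ₀
        have hline : Continuous fun y : ℝ => ξ₀ + y • a := by fun_prop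
        set A : Set ℝ := (fun y : ℝ => ξ₀ + y • a) ⁻¹' Ω with hA
        have hAm : MeasurableSet A := hΩ.measurableSet.preimage hline.measurable
        have hadd : ∀ y x : ℝ, ξ₀ + (y + x) • a = (ξ₀ + y • a) + x • a := fun y x => by module
        have key := setLIntegral_comp_add_sqrt_le hAm (l₁ := fun y => reach Ω (-a) (ξ₀ + y • a))
          (l₂ := fun y => reach Ω a (ξ₀ + y • a)) (hm1.comp hline.measurable)
          (hm2.comp hline.measurable) (fun y _ => ⟨reach_nonneg _ _, reach_nonneg _ _⟩)
          (fun y hy x h1 h2 => by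
            change ξ₀ + (y + x) • a ∈ Ω
            rw [hadd]
            exact mem_of_mem_reach hΩ hy h1 h2)
          (fun y hy x h1 h2 => by
            simp only [hadd]
            exact ⟨reach_neg_add hΩ ha hy h1 h2, reach_add hΩ ha hy h1 h2⟩)
          hβ hc (fun y => F (ξ₀ + y • a))
        rw [← lintegral_indicator hAm, ← lintegral_const_mul' _ _ (by norm_num)] at key
        refine le_trans (le_of_eq ?_) key
        rw [← lintegral_indicator]
        · refine lintegral_congr fun y => ?_
          simp only [hadd]
          rfl
        · exact hSm.preimage hline.measurable
    _ = 3 * ∫⁻ ξ in Ω, F ξ := by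
        rw [lintegral_const_mul' _ _ (by norm_num), lintegral_indicator hΩ.measurableSet]

end Reach

/-! ### Measurability of the local averages -/

section Measurability

variable {d : ℕ} {Ω : Set (Ambient d)}

/-- The pairs (ξ, η) whose segment lies in `Ω` form an intersection of closed sets, so the
difference is jointly measurable and Tonelli applies to numerator and volume. -/
lemma measurable_localAverage (hΩ : IsClosed Ω) (r : ℕ) {q : ℝ≥0∞} (hq : q ≠ ∞)
    {f : Ambient d → ℝ} (hf : Measurable f) (t : ℝ) :
    Measurable fun ξ => localAverage r q Ω f ξ t := by
  set U : Set (Ambient d × Ambient d) := {p | p.2 ∈ Ω ∧ rhoDist Ω p.1 p.2 ≤ t} with hU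
  have hUm : MeasurableSet U := by
    apply IsClosed.measurableSet
    exact (hΩ.preimage continuous_snd).inter (isClosed_le continuous_rhoDist continuous_const)
  set S : Set (Ambient d × Ambient d) := {p | segment ℝ p.1
    (p.1 + (r : ℝ) • (r : ℝ)⁻¹ • (p.2 - p.1)) ⊆ Ω} with hS
  have hSm : MeasurableSet S := by
    have : S = ⋂ τ ∈ Set.Icc (0 : ℝ) 1,
        (fun p : Ambient d × Ambient d => p.1 + τ • (r : ℝ) • (r : ℝ)⁻¹ • (p.2 - p.1)) ⁻¹' Ω := by
      ext p
      simp only [hS, Set.mem_ofPred_eq, segment_add_subset_iff, Set.mem_iInter, Set.mem_Icc,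
        Set.mem_preimage, and_imp]
    rw [this]
    apply IsClosed.measurableSet
    exact isClosed_biInter fun τ _ => hΩ.preimage (by fun_prop)
  have hfd : Measurable fun p : Ambient d × Ambient d =>
      finDiff r ((r : ℝ)⁻¹ • (p.2 - p.1)) f Ω p.1 := by
    have hsum : Measurable fun p : Ambient d × Ambient d =>
        ∑ j ∈ Finset.range (r + 1), (-1 : ℝ) ^ (r + j) * (r.choose j : ℝ) *
          f (p.1 + (j : ℝ) • (r : ℝ)⁻¹ • (p.2 - p.1)) := by
      refine Finset.measurable_fun_sum _ fun j _ => Measurable.const_mul (hf.comp ?_) _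
      exact Continuous.measurable (by fun_prop)
    unfold finDiff
    exact Measurable.ite hSm hsum measurable_const
  have hvol : Measurable fun ξ => volume (rhoBall Ω ξ t) := measurable_measure_prodMk_left hUm
  have hint : Measurable fun ξ => ∫⁻ η in rhoBall Ω ξ t,
      ‖finDiff r ((r : ℝ)⁻¹ • (η - ξ)) f Ω ξ‖ₑ ^ q.toReal := by
    have := ((hfd.enorm.pow_const q.toReal).indicator hUm).lintegral_prod_right'
      (ν := (volume : Measure (Ambient d)))
    convert this using 2 with ξ
    rw [← lintegral_indicator (isClosed_rhoBall hΩ ξ t).measurableSet]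
    rfl
  simp only [localAverage, if_neg hq]
  exact (hvol.inv.mul hint).pow_const _

/-- Changing `f` on a null set changes its local averages on a null set only. -/
lemma ae_localAverage_eq (hΩ : IsClosed Ω) {r : ℕ} (hr : 1 ≤ r) {q : ℝ≥0∞} (hq : q ≠ ∞)
    {f f' : Ambient d → ℝ} (h : f =ᵐ[volume.restrict Ω] f') (t : ℝ) :
    (fun ξ => localAverage r q Ω f ξ t) =ᵐ[volume.restrict Ω]
      fun ξ => localAverage r q Ω f' ξ t := by
  have hr0 : (r : ℝ) ≠ 0 := by positivity
  have h' : ∀ᵐ x : Ambient d, x ∈ Ω → f x = f' x := (ae_restrict_iff' hΩ.measurableSet).1 h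
  filter_upwards [h] with ξ hξ
  simp only [localAverage, if_neg hq]
  congr 2
  apply lintegral_congr_ae
  apply ae_restrict_of_ae
  -- For j ≠ 0 the node is a nonsingular affine function of η, so null sets pull back to null sets.
  -- The node j = 0 is ξ itself, which is why the equality holds only for almost every ξ.
  have hall : ∀ᵐ η : Ambient d, ∀ j : ℕ, j ≠ 0 →
      (ξ + (j : ℝ) • (r : ℝ)⁻¹ • (η - ξ) ∈ Ω → f (ξ + (j : ℝ) • (r : ℝ)⁻¹ • (η - ξ)) =
        f' (ξ + (j : ℝ) • (r : ℝ)⁻¹ • (η - ξ))) := by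
    rw [ae_all_iff]
    intro j
    by_cases hj : j = 0
    · exact Filter.Eventually.of_forall fun η h0 => absurd hj h0
    have hα : (j : ℝ) * (r : ℝ)⁻¹ ≠ 0 := mul_ne_zero (by exact_mod_cast hj) (inv_ne_zero hr0)
    have := (quasiMeasurePreserving_add_smul (ξ - ((j : ℝ) * (r : ℝ)⁻¹) • ξ) hα).ae h'
    filter_upwards [this] with η hη _
    have e : ξ + (j : ℝ) • (r : ℝ)⁻¹ • (η - ξ) =
        ξ - ((j : ℝ) * (r : ℝ)⁻¹) • ξ + ((j : ℝ) * (r : ℝ)⁻¹) • η := by module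
    rw [e]
    exact hη
  filter_upwards [hall] with η hη
  congr 2
  by_cases hs : segment ℝ ξ (ξ + (r : ℝ) • (r : ℝ)⁻¹ • (η - ξ)) ⊆ Ω
  · rw [finDiff_of_subset hs, finDiff_of_subset hs]
    refine Finset.sum_congr rfl fun j hj => ?_
    congr 1
    by_cases hj0 : j = 0
    · rw [hj0, Nat.cast_zero, zero_smul, add_zero]
      exact hξ
    · apply hη j hj0
      have hjr : (j : ℝ) ≤ r := by exact_mod_cast Nat.lt_succ_iff.1 (Finset.mem_range.1 hj)
      have := segment_add_subset_iff.1 hs ((j : ℝ) / r) (by positivity)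
        (div_le_one_of_le₀ hjr (Nat.cast_nonneg r))
      rwa [smul_smul, div_mul_cancel₀ _ hr0] at this
  · rw [finDiff_of_not_subset hs, finDiff_of_not_subset hs]

lemma aemeasurable_localAverage (hΩ : IsClosed Ω) {r : ℕ} (hr : 1 ≤ r) {q : ℝ≥0∞} (hq : q ≠ ∞)
    {f : Ambient d → ℝ} (hf : AEMeasurable f (volume.restrict Ω)) (t : ℝ) :
    AEMeasurable (fun ξ => localAverage r q Ω f ξ t) (volume.restrict Ω) :=
  ⟨_, measurable_localAverage hΩ r hq hf.measurable_mk t, ae_localAverage_eq hΩ hr hq hf.ae_eq_mk t⟩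

/-- Put ∞ on a measurable null set containing all points where `F` differs from its measurable
version. Domination everywhere is needed since pointwise bounds are evaluated at arbitrary nodes,
and measurability since the changes of variables require it. -/
lemma exists_measurable_ge_ae_eq {α : Type*} [MeasurableSpace α] {μ : Measure α} {F : α → ℝ≥0∞}
    (hF : AEMeasurable F μ) : ∃ W : α → ℝ≥0∞, Measurable W ∧ (∀ x, F x ≤ W x) ∧ W =ᵐ[μ] F := by
  classical
  set N := toMeasurable μ {x | F x ≠ hF.mk F x} with hN
  have hN0 : μ N = 0 := by
    rw [hN, measure_toMeasurable]
    exact hF.ae_eq_mk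
  refine ⟨fun x => if x ∈ N then ∞ else hF.mk F x,
    Measurable.ite (measurableSet_toMeasurable _ _) measurable_const hF.measurable_mk, ?_, ?_⟩
  · intro x
    by_cases hx : x ∈ N
    · simp [hx]
    · simp only [hx, if_false]
      by_contra hcon
      exact hx (subset_toMeasurable μ _ fun h => hcon h.le)
  · have h1 : ∀ᵐ x ∂μ, x ∉ N := measure_eq_zero_iff_ae_notMem.1 hN0
    filter_upwards [h1, hF.ae_eq_mk] with x hx hx2
    simp only [hx, if_false]
    exact hx2.symm

end Measurability

/-! ### Auxiliary norm estimates -/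

section Norms

variable {d : ℕ} {Ω : Set (Ambient d)}

/-- The average of order `1` is at most the supremum. -/
lemma localAverage_one_le (hΩ : IsClosed Ω) (r : ℕ) (f : Ambient d → ℝ) (ξ : Ambient d) (t : ℝ) :
    localAverage r 1 Ω f ξ t ≤ localAverage r ∞ Ω f ξ t := by
  simp only [localAverage, if_neg ENNReal.one_ne_top, if_true, ENNReal.toReal_one, div_one,
    ENNReal.rpow_one]
  set S := ⨆ η ∈ rhoBall Ω ξ t, ‖finDiff r ((r : ℝ)⁻¹ • (η - ξ)) f Ω ξ‖ₑ with hS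
  calc _ ≤ (volume (rhoBall Ω ξ t))⁻¹ * ∫⁻ _ in rhoBall Ω ξ t, S := by
        refine mul_le_mul' le_rfl ?_
        refine setLIntegral_mono' (isClosed_rhoBall hΩ ξ t).measurableSet fun η hη => ?_
        exact le_iSup₂_of_le (f := fun η (_ : η ∈ rhoBall Ω ξ t) =>
          ‖finDiff r ((r : ℝ)⁻¹ • (η - ξ)) f Ω ξ‖ₑ) η hη le_rfl
    _ = ((volume (rhoBall Ω ξ t))⁻¹ * volume (rhoBall Ω ξ t)) * S := by
        rw [setLIntegral_const]; ring
    _ ≤ S := mul_le_of_le_one_left zero_le (ENNReal.inv_mul_le_one _)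

lemma le_lpQuasiNorm_top (F : Ambient d → ℝ≥0∞) {S : Set (Ambient d)} {z : Ambient d} (hz : z ∈ S) :
    F z ≤ lpQuasiNorm ∞ S F := by
  simp only [lpQuasiNorm, if_true]
  exact le_iSup₂_of_le (f := fun z (_ : z ∈ S) => F z) z hz le_rfl

lemma rpow_inv_le_of_le {A B D I : ℝ≥0∞} {p : ℝ} (hp : 0 < p) (h : A ≤ B ^ p * D * I) :
    A ^ (1 / p) ≤ B * D ^ (1 / p) * I ^ (1 / p) := by
  have h0 : 0 ≤ 1 / p := (one_div_pos.2 hp).le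
  refine (ENNReal.rpow_le_rpow h h0).trans (le_of_eq ?_)
  rw [ENNReal.mul_rpow_of_nonneg _ _ h0, ENNReal.mul_rpow_of_nonneg _ _ h0, ← ENNReal.rpow_mul,
    mul_one_div_cancel hp.ne', ENNReal.rpow_one]

end Norms

/-! ### The directional moduli -/

section Directional

variable {d : ℕ} {Ω : Set (Ambient d)}

lemma aemeasurable_phiDist (hΩ : IsCompact Ω) {a : Ambient d} (ha : ‖a‖ = 1) :
    AEMeasurable (phiDist Ω a) (volume.restrict Ω) := by
  refine ⟨fun ξ => √(reach Ω (-a) ξ * reach Ω a ξ),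
    ((measurable_reach hΩ (by rwa [norm_neg])).mul (measurable_reach hΩ ha)).sqrt, ?_⟩
  exact (ae_restrict_iff' hΩ.measurableSet).2
    (Filter.Eventually.of_forall fun ξ hξ => phiDist_eq_sqrt_reach hΩ ha hξ)

/-- `W` stands for a majorant of the local averages. The hypothesis `hdir` makes the pieces short,
`hsub` then bounds the difference by values of `W` at the nodes ξ + c_k β φ_Ω(ξ) e_j, and the change
of variables bounds each of these in the norm of `W`. -/
lemma directionalModulus_le (hΩ : IsCompact Ω) {r n : ℕ} (hr : 1 ≤ r) (hn : 1 ≤ n) {κ t : ℝ}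
    {f : Ambient d → ℝ} {W : Ambient d → ℝ≥0∞} {C : ℝ≥0} {p : ℝ≥0∞} (hp : p ≠ 0)
    (hW : p ≠ ∞ → Measurable W)
    (hsub : ∀ z h : Ambient d, (∀ k : ℕ, k ≤ r * (n - 1) → ∀ τ : ℝ, 0 ≤ τ → τ ≤ 1 →
      z + ((k : ℝ) / n) • h + (τ * (r / n)) • h ∈ Ω ∧
        rhoDist Ω (z + ((k : ℝ) / n) • h) (z + ((k : ℝ) / n) • h + (τ * (r / n)) • h) ≤ κ) →
      ‖diffSum r h f z‖ₑ ≤ C * ∑ k ∈ Finset.range (r * n + 1), W (z + ((k : ℝ) / n) • h))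
    (hdir : ∀ h : ℝ, |h| ≤ t → ∀ ξ ∈ Ω, ∀ a : Ambient d, ‖a‖ = 1 →
      (∀ x : ℝ, |x| ≤ (r : ℝ) / 2 * (|h| * phiDist Ω a ξ) → ξ + x • a ∈ Ω) →
      ∀ α β : ℝ, |α| ≤ (r : ℝ) / 2 * (|h| * phiDist Ω a ξ) →
        |α + β| ≤ (r : ℝ) / 2 * (|h| * phiDist Ω a ξ) →
        |β| ≤ r * (|h| * phiDist Ω a ξ) / n → rhoDist Ω (ξ + α • a) (ξ + (α + β) • a) ≤ κ)
    (j : Fin (d + 1)) :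
    directionalModulus r p Ω f t (EuclideanSpace.single j 1) ≤
      (C * ((r * n + 1 : ℕ) : ℝ≥0) * (3 * ((r * n + 1 : ℕ) : ℝ≥0)) ^ (1 / p.toReal) : ℝ≥0) *
        lpQuasiNorm p Ω W := by
  set a : Ambient d := EuclideanSpace.single j 1 with ha'
  have ha : ‖a‖ = 1 := by rw [ha', PiLp.norm_single, norm_one]
  set N : ℕ := r * n + 1 with hN
  have hn0 : (0 : ℝ) < n := by exact_mod_cast hn
  have hr0 : (0 : ℝ) < r := by exact_mod_cast hr
  refine iSup₂_le fun h hh => ?_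
  replace hh : |h| ≤ t := hh.trans (min_le_left _ _)
  set β : ℝ := (r : ℝ) / 2 * |h| with hβ
  have hβ0 : 0 ≤ β := by positivity
  set D : Set (Ambient d) := {ξ ∈ Ω | ∀ x : ℝ, |x| ≤ β * phiDist Ω a ξ → ξ + x • a ∈ Ω} with hD
  obtain ⟨ε, hε, hhε⟩ : ∃ ε : ℝ, |ε| = 1 ∧ h = ε * |h| := by
    rcases abs_choice h with h1 | h1
    · exact ⟨1, abs_one, by linarith⟩
    · exact ⟨-1, by norm_num, by linarith⟩
  -- The nodes run symmetrically from one end of the segment to the other, in the order given by the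
  -- sign `ε` of `h`; hence |c k| ≤ 1.
  set c : ℕ → ℝ := fun k => (2 * k / (r * n) - 1) * ε with hc
  have hc1 : ∀ k ∈ Finset.range N, |c k| ≤ 1 := by
    intro k hk
    have hk' : (k : ℝ) ≤ r * n := by exact_mod_cast Nat.lt_succ_iff.1 (Finset.mem_range.1 hk)
    have h0 : (k : ℝ) / (r * n) ≤ 1 := div_le_one_of_le₀ hk' (by positivity)
    have h1 : 0 ≤ (k : ℝ) / (r * n) := by positivity
    rw [hc, abs_mul, hε, mul_one, mul_div_assoc, abs_le]
    constructor <;> linarith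
  have hnode : ∀ (ξ : Ambient d) (k : ℕ),
      ξ - ((r : ℝ) / 2) • (h * phiDist Ω a ξ) • a + ((k : ℝ) / n) • (h * phiDist Ω a ξ) • a =
        ξ + (c k * (β * phiDist Ω a ξ)) • a := by
    intro ξ k
    have e : c k * (β * phiDist Ω a ξ) = ((k : ℝ) / n - r / 2) * (h * phiDist Ω a ξ) := by
      conv_rhs => rw [hhε]
      simp only [hc, hβ]
      field_simp
    rw [e]
    module
  have hpt : ∀ ξ ∈ D, ‖symFinDiff r ((h * phiDist Ω a ξ) • a) f Ω ξ‖ₑ ≤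
      C * ∑ k ∈ Finset.range N, W (ξ + (c k * (β * phiDist Ω a ξ)) • a) := by
    rintro ξ ⟨hξ, hξD⟩
    set φ := phiDist Ω a ξ with hφ
    have hφ0 : 0 ≤ φ := phiDist_nonneg a ξ
    simp only [symFinDiff]
    by_cases hs : segment ℝ (ξ - ((r : ℝ) / 2) • (h * φ) • a)
      (ξ - ((r : ℝ) / 2) • (h * φ) • a + (r : ℝ) • (h * φ) • a) ⊆ Ω
    swap
    · rw [finDiff_of_not_subset hs, enorm_zero]
      exact zero_le
    rw [finDiff_of_subset hs]
    have hnode' : ∀ k : ℕ, ξ - ((r : ℝ) / 2) • (h * φ) • a + ((k : ℝ) / n) • (h * φ) • a =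
        ξ + (c k * (β * φ)) • a := hnode ξ
    simp only [← hnode']
    refine hsub _ _ fun k hk τ h0 h1 => ?_
    have hkn : (k : ℝ) + r ≤ r * n := by
      have : k + r ≤ r * n := by
        obtain ⟨m, rfl⟩ : ∃ m, n = m + 1 := ⟨n - 1, by omega⟩
        rw [Nat.add_sub_cancel] at hk
        rw [mul_add, mul_one]
        omega
      exact_mod_cast this
    have key : ∀ x : ℝ, 0 ≤ x → x ≤ r → |(x - r / 2) * (h * φ)| ≤ (r : ℝ) / 2 * (|h| * φ) := by
      intro x hx0 hx
      rw [abs_mul, abs_mul, abs_of_nonneg hφ0]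
      refine mul_le_mul_of_nonneg_right ?_ (by positivity)
      rw [abs_le]
      constructor <;> linarith
    have hk0 : (0 : ℝ) ≤ (k : ℝ) / n := by positivity
    have hτr : 0 ≤ τ * (r / n) := by positivity
    have hsum : (k : ℝ) / n + τ * (r / n) ≤ r := by
      have : τ * (r / n) ≤ r / n := mul_le_of_le_one_left (by positivity) h1
      have h2 : (k : ℝ) / n + r / n ≤ r := by
        rw [← add_div, div_le_iff₀ hn0]
        exact hkn
      linarith
    have e1 : ξ - ((r : ℝ) / 2) • (h * φ) • a + ((k : ℝ) / n) • (h * φ) • a =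
        ξ + (((k : ℝ) / n - r / 2) * (h * φ)) • a := by module
    have e2 : ξ - ((r : ℝ) / 2) • (h * φ) • a + ((k : ℝ) / n) • (h * φ) • a +
        (τ * (r / n)) • (h * φ) • a =
        ξ + ((((k : ℝ) / n - r / 2) * (h * φ)) + (τ * (r / n)) * (h * φ)) • a := by module
    have hb : |((k : ℝ) / n - r / 2) * (h * φ) + (τ * (r / n)) * (h * φ)| ≤
        (r : ℝ) / 2 * (|h| * φ) := by
      have := key ((k : ℝ) / n + τ * (r / n)) (by linarith) hsum
      rwa [show ((k : ℝ) / n + τ * (r / n) - r / 2) * (h * φ) =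
        ((k : ℝ) / n - r / 2) * (h * φ) + (τ * (r / n)) * (h * φ) by ring] at this
    have hξD' : ∀ x : ℝ, |x| ≤ (r : ℝ) / 2 * (|h| * φ) → ξ + x • a ∈ Ω := fun x hx =>
      hξD x (by rw [hβ, mul_assoc]; exact hx)
    rw [e2, e1]
    refine ⟨hξD' _ hb, hdir h hh ξ hξ a ha hξD' _ _ (key _ hk0 (by linarith)) hb ?_⟩
    rw [abs_mul, abs_of_nonneg hτr, abs_mul, abs_of_nonneg hφ0]
    calc τ * (r / n) * (|h| * φ) ≤ (r / n) * (|h| * φ) :=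
          mul_le_mul_of_nonneg_right (mul_le_of_le_one_left (by positivity) h1) (by positivity)
      _ = r * (|h| * φ) / n := by ring
  -- `D` contains every point at which the centred segment lies in `Ω`, so elsewhere the difference
  -- is 0 by definition. If h φ_Ω = 0 the segment is a single point.
  have hout : ∀ ξ, ξ ∉ D → ‖symFinDiff r ((h * phiDist Ω a ξ) • a) f Ω ξ‖ₑ = 0 := by
    intro ξ hξ
    rw [symFinDiff, finDiff_of_not_subset, enorm_zero]
    intro hs
    apply hξ
    rw [segment_add_subset_iff] at hs
    have hx : ∀ x : ℝ, |x| ≤ β * phiDist Ω a ξ → ξ + x • a ∈ Ω := by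
      intro x hx
      set φ := phiDist Ω a ξ with hφ
      have hφ0 : 0 ≤ φ := phiDist_nonneg a ξ
      have hx' := abs_le.1 hx
      rcases eq_or_lt_of_le (mul_nonneg hβ0 hφ0) with h0 | hpos
      · have hx0 : x = 0 := by
          apply abs_eq_zero.1
          exact le_antisymm (h0 ▸ hx) (abs_nonneg _)
        have := hs (1 / 2) (by norm_num) (by norm_num)
        rw [hx0, zero_smul, add_zero]
        convert this using 1
        module
      · have hne : h * φ ≠ 0 := by
          intro h0
          have : |h| * φ = 0 := by rw [← abs_of_nonneg hφ0, ← abs_mul, h0, abs_zero]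
          rw [hβ, mul_assoc, this, mul_zero] at hpos
          exact lt_irrefl _ hpos
        have hq : |x / (r * (h * φ))| ≤ 1 / 2 := by
          have hpos2 : 0 < |h * φ| := abs_pos.2 hne
          rw [abs_div, abs_mul, abs_of_pos hr0, div_le_iff₀ (by positivity), abs_mul,
            abs_of_nonneg hφ0]
          calc |x| ≤ β * φ := hx
            _ = _ := by rw [hβ]; ring
        have hq' := abs_le.1 hq
        have := hs (1 / 2 + x / (r * (h * φ))) (by linarith) (by linarith)
        convert this using 1
        have e : x = (x / (r * (h * φ))) * (r * (h * φ)) :=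
          (div_mul_cancel₀ x (mul_ne_zero hr0.ne' hne)).symm
        set y := x / (r * (h * φ)) with hy
        rw [e]
        module
    refine ⟨?_, hx⟩
    have := hx 0 (by rw [abs_zero]; exact mul_nonneg hβ0 (phiDist_nonneg a ξ))
    rwa [zero_smul, add_zero] at this
  by_cases hpt' : p = ∞
  · subst hpt'
    simp only [ENNReal.toReal_top, div_zero, NNReal.rpow_zero, mul_one]
    conv_lhs => simp only [lpQuasiNorm, if_true]
    refine iSup₂_le fun ξ hξ => ?_
    by_cases hξD : ξ ∈ D
    · refine (hpt ξ hξD).trans ?_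
      rw [ENNReal.coe_mul]
      refine le_of_le_of_eq (mul_le_mul' le_rfl ?_) (mul_assoc _ _ _).symm
      refine (Finset.sum_le_card_nsmul _ _ (lpQuasiNorm ∞ Ω W) fun k hk => ?_).trans ?_
      · refine le_lpQuasiNorm_top W (hξD.2 _ ?_)
        have h0 : 0 ≤ β * phiDist Ω a ξ := mul_nonneg hβ0 (phiDist_nonneg a ξ)
        rw [abs_mul, abs_of_nonneg h0]
        exact mul_le_of_le_one_left h0 (hc1 k hk)
      · rw [Finset.card_range, nsmul_eq_mul]
        norm_cast
    · rw [hout ξ hξD]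
      exact zero_le
  have hp0 : 0 < p.toReal := ENNReal.toReal_pos hp hpt'
  have hp1 : 0 ≤ 1 / p.toReal := (one_div_pos.2 hp0).le
  simp only [lpQuasiNorm, if_neg hpt']
  rw [ENNReal.coe_mul, ENNReal.coe_rpow_of_nonneg _ hp1]
  apply rpow_inv_le_of_le hp0
  set P := p.toReal with hP
  have hWm : Measurable fun ξ => W ξ ^ P := (hW hpt').pow_const P
  have hDsub : D ⊆ Ω := fun ξ h => h.1
  calc ∫⁻ ξ in Ω, ‖symFinDiff r ((h * phiDist Ω a ξ) • a) f Ω ξ‖ₑ ^ P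
      ≤ ∫⁻ ξ in Ω, D.indicator (fun ξ => (C * N : ℝ≥0∞) ^ P *
          ∑ k ∈ Finset.range N, W (ξ + (c k * (β * phiDist Ω a ξ)) • a) ^ P) ξ := by
        refine lintegral_mono fun ξ => ?_
        by_cases hξ : ξ ∈ D
        · rw [Set.indicator_of_mem hξ]
          refine (ENNReal.rpow_le_rpow (hpt ξ hξ) hp0.le).trans ?_
          rw [ENNReal.mul_rpow_of_nonneg _ _ hp0.le, ENNReal.mul_rpow_of_nonneg _ _ hp0.le]
          refine le_of_le_of_eq (mul_le_mul' le_rfl ?_) (mul_assoc _ _ _).symm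
          have := sum_rpow_le_card_mul (Finset.range N)
            (fun k => W (ξ + (c k * (β * phiDist Ω a ξ)) • a)) hp0
          rwa [Finset.card_range] at this
        · simp only [hout ξ hξ, ENNReal.zero_rpow_of_pos hp0]
          exact zero_le
    _ ≤ ∫⁻ ξ in D, (C * N : ℝ≥0∞) ^ P *
          ∑ k ∈ Finset.range N, W (ξ + (c k * (β * phiDist Ω a ξ)) • a) ^ P := by
        refine (setLIntegral_le_lintegral _ _).trans ?_
        exact lintegral_indicator_le _ _
    _ = ∑ k ∈ Finset.range N, ∫⁻ ξ in D, (C * N : ℝ≥0∞) ^ P *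
          W (ξ + (c k * (β * phiDist Ω a ξ)) • a) ^ P := by
        rw [← lintegral_finsetSum']
        · simp only [Finset.mul_sum]
        · intro k _
          refine AEMeasurable.const_mul (hWm.comp_aemeasurable ?_) _
          exact aemeasurable_id.add ((((aemeasurable_phiDist hΩ ha).mono_set hDsub).const_mul
            β).const_mul (c k) |>.smul_const a)
    _ ≤ ∑ k ∈ Finset.range N, (C * N : ℝ≥0∞) ^ P * (3 * ∫⁻ ξ in Ω, W ξ ^ P) := by
        refine Finset.sum_le_sum fun k hk => ?_
        rw [lintegral_const_mul' _ _ (ENNReal.rpow_ne_top_of_nonneg hp0.le (by finiteness))]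
        gcongr
        exact setLIntegral_comp_add_phiDist_le hΩ j hβ0 (hc1 k hk) hWm
    _ = _ := by
        rw [Finset.sum_const, Finset.card_range, nsmul_eq_mul]
        push_cast
        ring

end Directional

/-! ### The tangential moduli -/

section Tangential

variable {d : ℕ} {Ω : Set (Ambient d)}

lemma continuous_tangentVec {g : Base d → ℝ} (hg : ContDiff ℝ 2 g) (j : Fin d) :
    Continuous (tangentVec g j) := by
  have h : Continuous (partialD j g) :=
    (hg.continuous_fderiv (by norm_num)).clm_apply continuous_const
  exact continuous_const.add (h.smul continuous_const)

/-- A tangential average is a multiple of the integral: for fixed `u` the shift is a translation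
whose horizontal part does not depend on `u`. -/
lemma lintegral_lintegral_add_tangentVec {g : Base d → ℝ} (hg : ContDiff ℝ 2 g) (j : Fin d)
    {Φ : Ambient d → ℝ≥0∞} (hΦ : Measurable Φ) (α : ℝ) {ρ : ℝ} (hρ : 0 ≤ ρ) :
    ∫⁻ w : Ambient d, ∫⁻ u in {u : Base d | ‖u - horiz w‖ ≤ ρ}, Φ (w + α • tangentVec g j u) =
      ENNReal.ofReal (ρ ^ d) * volume (Metric.ball (0 : Base d) 1) * ∫⁻ w, Φ w := by
  set e : Base d := α • EuclideanSpace.single j 1 with he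
  have hball : ∀ x : Base d, {u : Base d | ‖u - x‖ ≤ ρ} = Metric.closedBall x ρ := by
    intro x
    ext u
    rw [Metric.mem_closedBall, dist_eq_norm]
    rfl
  have hset : MeasurableSet {p : Ambient d × Base d | ‖p.2 - horiz p.1‖ ≤ ρ} :=
    (isClosed_le ((continuous_snd.sub (SpecialDomain.continuous_horiz.comp continuous_fst)).norm)
      continuous_const).measurableSet
  have hset' : MeasurableSet {p : Ambient d × Base d | ‖p.2 - (horiz p.1 - e)‖ ≤ ρ} :=
    (isClosed_le ((continuous_snd.sub ((SpecialDomain.continuous_horiz.comp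
      continuous_fst).sub continuous_const)).norm) continuous_const).measurableSet
  have hT : Continuous fun p : Ambient d × Base d => p.1 + α • tangentVec g j p.2 :=
    continuous_fst.add (((continuous_tangentVec hg j).comp continuous_snd).const_smul α)
  calc ∫⁻ w : Ambient d, ∫⁻ u in {u : Base d | ‖u - horiz w‖ ≤ ρ}, Φ (w + α • tangentVec g j u)
      = ∫⁻ w : Ambient d, ∫⁻ u : Base d, {p : Ambient d × Base d | ‖p.2 - horiz p.1‖ ≤ ρ}.indicator
          (fun p => Φ (p.1 + α • tangentVec g j p.2)) (w, u) := by
        refine lintegral_congr fun w => ?_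
        rw [← lintegral_indicator (by rw [hball]; exact Metric.isClosed_closedBall.measurableSet)]
        rfl
    _ = ∫⁻ u : Base d, ∫⁻ w : Ambient d, {p : Ambient d × Base d | ‖p.2 - horiz p.1‖ ≤ ρ}.indicator
          (fun p => Φ (p.1 + α • tangentVec g j p.2)) (w, u) :=
        lintegral_lintegral_swap ((hΦ.comp hT.measurable).indicator hset).aemeasurable
    _ = ∫⁻ u : Base d, ∫⁻ w : Ambient d,
          {p : Ambient d × Base d | ‖p.2 - (horiz p.1 - e)‖ ≤ ρ}.indicator
          (fun p => Φ p.1) (w, u) := by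
        refine lintegral_congr fun u => ?_
        rw [← lintegral_add_right_eq_self (fun w : Ambient d =>
          {p : Ambient d × Base d | ‖p.2 - (horiz p.1 - e)‖ ≤ ρ}.indicator
            (fun p => Φ p.1) (w, u)) (α • tangentVec g j u)]
        refine lintegral_congr fun w => ?_
        have h : horiz (w + α • tangentVec g j u) - e = horiz w := by
          rw [show horiz (w + α • tangentVec g j u) = horiz w + α • horiz (tangentVec g j u) from
            rfl, horiz_tangentVec, ← he, add_sub_cancel_right]
        simp only [Set.indicator_apply, Set.mem_ofPred_eq, h]
    _ = ∫⁻ w : Ambient d, ∫⁻ u : Base d,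
          {p : Ambient d × Base d | ‖p.2 - (horiz p.1 - e)‖ ≤ ρ}.indicator
          (fun p => Φ p.1) (w, u) :=
        (lintegral_lintegral_swap (μ := (volume : Measure (Ambient d)))
          (ν := (volume : Measure (Base d))) (f := fun w u =>
            {p : Ambient d × Base d | ‖p.2 - (horiz p.1 - e)‖ ≤ ρ}.indicator (fun p => Φ p.1) (w, u))
          ((hΦ.comp measurable_fst).indicator hset').aemeasurable).symm
    _ = ∫⁻ w : Ambient d, ENNReal.ofReal (ρ ^ d) * volume (Metric.ball (0 : Base d) 1) * Φ w := by
        refine lintegral_congr fun w => ?_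
        have h : ∀ u : Base d, {p : Ambient d × Base d | ‖p.2 - (horiz p.1 - e)‖ ≤ ρ}.indicator
          (fun p => Φ p.1) (w, u) = (Metric.closedBall (horiz w - e) ρ).indicator
            (fun _ => Φ w) u := by
          intro u
          rw [← hball]
          rfl
        simp only [h]
        rw [lintegral_indicator_const Metric.isClosed_closedBall.measurableSet,
          Measure.addHaar_closedBall _ _ hρ, finrank_euclideanSpace, Fintype.card_fin, mul_comm]
    _ = _ := lintegral_const_mul _ hΦ

namespace SpecialDomain

variable (G : SpecialDomain d)

lemma measurePreserving_fromStd : MeasurePreserving G.fromStd :=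
  G.rot.symm.measurePreserving.comp (measurePreserving_add_right volume G.shift)

lemma finDiff_comp_fromStd (r : ℕ) (h : Ambient d) (f : Ambient d → ℝ) (w : Ambient d) :
    finDiff r h (fun w => f (G.fromStd w)) (G.toStd '' Ω) w =
      finDiff r (G.rot.symm h) f Ω (G.fromStd w) := by
  have hmem : ∀ x, x ∈ G.toStd '' Ω ↔ G.fromStd x ∈ Ω := by
    intro x
    constructor
    · rintro ⟨z, hz, rfl⟩
      rwa [G.fromStd_toStd]
    · exact fun hx => ⟨_, hx, G.toStd_fromStd x⟩
  have hseg : segment ℝ w (w + (r : ℝ) • h) ⊆ G.toStd '' Ω ↔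
      segment ℝ (G.fromStd w) (G.fromStd w + (r : ℝ) • G.rot.symm h) ⊆ Ω := by
    rw [segment_add_subset_iff, segment_add_subset_iff]
    simp only [hmem, G.fromStd_add, map_smul]
  by_cases hs : segment ℝ w (w + (r : ℝ) • h) ⊆ G.toStd '' Ω
  · rw [finDiff_of_subset hs, finDiff_of_subset (hseg.1 hs)]
    simp only [diffSum, G.fromStd_add, map_smul]
  · rw [finDiff_of_not_subset hs, finDiff_of_not_subset fun h => hs (hseg.2 h)]

/-- The pointwise part is as for the directional moduli, in the coordinates of `Ω`. In the integral
part the region for `u` is enlarged to a full ball, so that Tonelli and translation in `w` apply. -/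
lemma tangentialModulus_le (hΩ : IsCompact Ω) {r n : ℕ} (hn : 1 ≤ n) {κ t : ℝ}
    (ht0 : 0 < t) (ht1 : t ≤ 1) {f : Ambient d → ℝ} {W : Ambient d → ℝ≥0∞} {C V : ℝ≥0} {p : ℝ≥0∞}
    (hV : volume (Metric.ball (0 : Base d) 1) = V) (hp : p ≠ 0) (hW : p ≠ ∞ → Measurable W)
    (hsub : ∀ z h : Ambient d, (∀ k : ℕ, k ≤ r * (n - 1) → ∀ τ : ℝ, 0 ≤ τ → τ ≤ 1 →
      z + ((k : ℝ) / n) • h + (τ * (r / n)) • h ∈ Ω ∧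
        rhoDist Ω (z + ((k : ℝ) / n) • h) (z + ((k : ℝ) / n) • h + (τ * (r / n)) • h) ≤ κ) →
      ‖diffSum r h f z‖ₑ ≤ C * ∑ k ∈ Finset.range (r * n + 1), W (z + ((k : ℝ) / n) • h))
    (htan : ∀ s : ℝ, 0 < s → s ≤ t → ∀ c ∈ G.carrier, ∀ u : Base d, (∀ i, |u i| < G.b) →
      ‖u - horiz (G.toStd c)‖ ≤ t * G.b → ∀ j : Fin d, ∀ v : Ambient d,
      v = G.rot.symm (s • tangentVec G.g j u) →
      ∀ α β : ℝ, 0 ≤ α → α ≤ r → 0 ≤ β → β ≤ r / n → c + α • v ∈ Ω → c + α • v + β • v ∈ Ω →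
        rhoDist Ω (c + α • v) (c + α • v + β • v) ≤ κ) (A₀ : ℝ) :
    tangentialModulus r p Ω G A₀ f t ≤
      (C * ((r * n + 1 : ℕ) : ℝ≥0) * (((r * n + 1 : ℕ) : ℝ≥0) * V) ^ (1 / p.toReal) : ℝ≥0) *
        lpQuasiNorm p Ω W := by
  set N : ℕ := r * n + 1 with hN
  have hn0 : (0 : ℝ) < n := by exact_mod_cast hn
  unfold tangentialModulus stdTangentialModulus
  rw [min_eq_left ht1]
  refine iSup₂_le fun s hs => iSup_le fun j => ?_
  simp only [G.finDiff_comp_fromStd]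
  -- Cutting `W` off outside `Ω` loses nothing at the nodes, which lie in `Ω`, and allows
  -- integration over the whole space.
  set W' : Ambient d → ℝ≥0∞ := fun w => Ω.indicator W (G.fromStd w) with hW'
  set v : Base d → Ambient d := fun u => s • tangentVec G.g j u with hv
  have hpt : ∀ w ∈ stdInner G.b G.L G.g A₀ t, ∀ u ∈ baseBall G.b (horiz w) (t * G.b),
      ‖finDiff r (G.rot.symm (v u)) f Ω (G.fromStd w)‖ₑ ≤
        C * ∑ k ∈ Finset.range N, W' (w + ((k : ℝ) / n) • v u) := by
    intro w hw u hu
    by_cases hseg : segment ℝ (G.fromStd w) (G.fromStd w + (r : ℝ) • G.rot.symm (v u)) ⊆ Ω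
    swap
    · rw [finDiff_of_not_subset hseg, enorm_zero]
      exact zero_le
    rw [finDiff_of_subset hseg]
    have hmem : ∀ x : ℝ, 0 ≤ x → x ≤ r → G.fromStd w + x • G.rot.symm (v u) ∈ Ω := by
      intro x hx0 hx
      rcases eq_or_lt_of_le (hx0.trans hx) with hr0 | hr0
      · have := segment_add_subset_iff.1 hseg 0 le_rfl zero_le_one
        rwa [show x = 0 by linarith, zero_smul, add_zero, ← add_zero (G.fromStd w),
          ← zero_smul ℝ ((r : ℝ) • G.rot.symm (v u))]
      · have := segment_add_subset_iff.1 hseg (x / r) (by positivity)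
          (div_le_one_of_le₀ hx hr0.le)
        rwa [smul_smul, div_mul_cancel₀ _ hr0.ne'] at this
    refine (hsub (G.fromStd w) (G.rot.symm (v u)) fun k hk τ h0 h1 => ?_).trans (le_of_eq ?_)
    · have hkn : (k : ℝ) + r ≤ r * n := by
        have : k + r ≤ r * n := by
          obtain ⟨m, rfl⟩ : ∃ m, n = m + 1 := ⟨n - 1, by omega⟩
          rw [Nat.add_sub_cancel] at hk
          rw [mul_add, mul_one]
          omega
        exact_mod_cast this
      have hk0 : (0 : ℝ) ≤ (k : ℝ) / n := by positivity
      have hτr : 0 ≤ τ * (r / n) := by positivity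
      have hτ1 : τ * (r / n) ≤ r / n := mul_le_of_le_one_left (by positivity) h1
      have h2 : (k : ℝ) / n + r / n ≤ r := by
        rw [← add_div, div_le_iff₀ hn0]
        exact hkn
      have m1 := hmem ((k : ℝ) / n) hk0 (by linarith)
      have m2 : G.fromStd w + ((k : ℝ) / n) • G.rot.symm (v u) +
          (τ * (r / n)) • G.rot.symm (v u) ∈ Ω := by
        rw [add_assoc, ← add_smul]
        exact hmem _ (by linarith) (by linarith)
      refine ⟨m2, htan s hs.1 hs.2 _ ?_ u hu.1 ?_ j _ rfl _ _ hk0 (by linarith) hτr hτ1 m1 m2⟩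
      · change G.toStd (G.fromStd w) ∈ stdDomain G.b G.L G.g
        rw [G.toStd_fromStd]
        exact hw.1
      · rw [G.toStd_fromStd]
        exact hu.2
    · congr 1
      refine Finset.sum_congr rfl fun k hk => ?_
      have hk' : (k : ℝ) ≤ r * n := by exact_mod_cast Nat.lt_succ_iff.1 (Finset.mem_range.1 hk)
      simp only [hW', G.fromStd_add, map_smul]
      rw [Set.indicator_of_mem]
      exact hmem _ (by positivity) (by rwa [div_le_iff₀ hn0])
  by_cases hpt' : p = ∞
  · subst hpt'
    simp only [ENNReal.toReal_top, div_zero, NNReal.rpow_zero, mul_one, if_true]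
    refine iSup₂_le fun w hw => iSup₂_le fun u hu => (hpt w hw u hu).trans ?_
    rw [ENNReal.coe_mul]
    refine le_of_le_of_eq (mul_le_mul' le_rfl ?_) (mul_assoc _ _ _).symm
    refine (Finset.sum_le_card_nsmul _ _ (lpQuasiNorm ∞ Ω W) fun k hk => ?_).trans ?_
    · by_cases h : G.fromStd (w + ((k : ℝ) / n) • v u) ∈ Ω
      · simp only [hW', Set.indicator_of_mem h]
        exact le_lpQuasiNorm_top W h
      · simp only [hW', Set.indicator_of_notMem h]
        exact zero_le
    · rw [Finset.card_range, nsmul_eq_mul]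
      norm_cast
  have hp0 : 0 < p.toReal := ENNReal.toReal_pos hp hpt'
  have hp1 : 0 ≤ 1 / p.toReal := (one_div_pos.2 hp0).le
  simp only [lpQuasiNorm, if_neg hpt']
  rw [ENNReal.coe_mul, ENNReal.coe_rpow_of_nonneg _ hp1]
  apply rpow_inv_le_of_le hp0
  set P := p.toReal with hP
  set ρ := t * G.b with hρ
  have hρ0 : 0 < ρ := mul_pos ht0 G.b_pos
  have hW'm : Measurable fun w => W' w ^ P :=
    (((hW hpt').indicator hΩ.measurableSet).comp G.continuous_fromStd.measurable).pow_const P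
  have hint : ∫⁻ w, W' w ^ P = ∫⁻ ξ in Ω, W ξ ^ P := by
    rw [← lintegral_indicator hΩ.measurableSet,
      ← G.measurePreserving_fromStd.lintegral_comp
        (((hW hpt').pow_const P).indicator hΩ.measurableSet)]
    refine lintegral_congr fun w => ?_
    by_cases h : G.fromStd w ∈ Ω
    · simp only [hW', Set.indicator_of_mem h]
    · simp only [hW', Set.indicator_of_notMem h, ENNReal.zero_rpow_of_pos hp0]
  have hball : ∀ x : Base d, MeasurableSet (baseBall G.b x ρ) := by
    intro x
    have e : baseBall G.b x ρ = (⋂ i, {u : Base d | |u i| < G.b}) ∩ Metric.closedBall x ρ := by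
      ext u
      simp only [baseBall, Set.mem_inter_iff, Set.mem_iInter, Set.mem_ofPred_eq,
        Metric.mem_closedBall, dist_eq_norm]
    rw [e]
    refine (MeasurableSet.iInter fun i => ?_).inter Metric.isClosed_closedBall.measurableSet
    exact measurableSet_lt (by fun_prop) measurable_const
  have hinner : MeasurableSet (stdInner G.b G.L G.g A₀ t) := by
    have hh : ∀ i, Measurable fun w : Ambient d => |horiz w i| := fun i => by
      have := (continuous_horiz (d := d)).measurable
      fun_prop
    have hg : Measurable fun w : Ambient d => G.g (horiz w) :=
      (G.contDiff_g.continuous.comp continuous_horiz).measurable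
    have hvm : Measurable (vert : Ambient d → ℝ) := continuous_vert.measurable
    have e : stdInner G.b G.L G.g A₀ t = ((⋂ i, {w : Ambient d | |horiz w i| < G.b}) ∩
        ({w | G.g (horiz w) - G.L * G.b < vert w} ∩ {w | vert w ≤ G.g (horiz w)})) ∩
        {w | A₀ * t ^ 2 ≤ Metric.infDist w (stdGraph G.b G.g)} := by
      ext w
      simp only [stdInner, stdDomain, Set.mem_inter_iff, Set.mem_iInter, Set.mem_ofPred_eq]
    rw [e]
    exact ((MeasurableSet.iInter fun i => measurableSet_lt (hh i) measurable_const).inter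
      ((measurableSet_lt (hg.sub_const _) hvm).inter (measurableSet_le hvm hg))).inter
      (measurableSet_le measurable_const (Metric.continuous_infDist_pt _).measurable)
  set c := ENNReal.ofReal ((G.b * t) ^ d) with hc
  have hc0 : c ≠ 0 := (ENNReal.ofReal_pos.2 (pow_pos (mul_pos G.b_pos ht0) d)).ne'
  have hct : c ≠ ∞ := ENNReal.ofReal_ne_top
  have hcP : (C * N : ℝ≥0∞) ^ P ≠ ∞ := ENNReal.rpow_ne_top_of_nonneg hp0.le (by finiteness)
  have hvc : Continuous v := (continuous_tangentVec G.contDiff_g j).const_smul s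
  have hterm : ∀ k : ℕ, Measurable fun q : Ambient d × Base d =>
      {q : Ambient d × Base d | ‖q.2 - horiz q.1‖ ≤ ρ}.indicator
        (fun q => W' (q.1 + ((k : ℝ) / n) • v q.2) ^ P) q := by
    intro k
    exact (hW'm.comp (continuous_fst.add
      ((hvc.comp continuous_snd).const_smul ((k : ℝ) / n))).measurable).indicator
      (isClosed_le (continuous_snd.sub (continuous_horiz.comp continuous_fst)).norm
        continuous_const).measurableSet
  calc ∫⁻ w in stdInner G.b G.L G.g A₀ t, c⁻¹ * ∫⁻ u in baseBall G.b (horiz w) ρ,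
        ‖finDiff r (G.rot.symm (v u)) f Ω (G.fromStd w)‖ₑ ^ P
      ≤ ∫⁻ w in stdInner G.b G.L G.g A₀ t, c⁻¹ * ∫⁻ u in baseBall G.b (horiz w) ρ,
          (C * N : ℝ≥0∞) ^ P * ∑ k ∈ Finset.range N, W' (w + ((k : ℝ) / n) • v u) ^ P := by
        refine setLIntegral_mono' hinner fun w hw => ?_
        refine mul_le_mul' le_rfl (setLIntegral_mono' (hball _) fun u hu => ?_)
        refine (ENNReal.rpow_le_rpow (hpt w hw u hu) hp0.le).trans ?_
        rw [ENNReal.mul_rpow_of_nonneg _ _ hp0.le, ENNReal.mul_rpow_of_nonneg _ _ hp0.le]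
        refine le_of_le_of_eq (mul_le_mul' le_rfl ?_) (mul_assoc _ _ _).symm
        have := sum_rpow_le_card_mul (Finset.range N)
          (fun k => W' (w + ((k : ℝ) / n) • v u)) hp0
        rwa [Finset.card_range] at this
    _ ≤ ∫⁻ w : Ambient d, c⁻¹ * ∫⁻ u in {u : Base d | ‖u - horiz w‖ ≤ ρ},
          (C * N : ℝ≥0∞) ^ P * ∑ k ∈ Finset.range N, W' (w + ((k : ℝ) / n) • v u) ^ P := by
        refine (setLIntegral_le_lintegral _ _).trans (lintegral_mono fun w => ?_)
        exact mul_le_mul' le_rfl (lintegral_mono_set fun u hu => hu.2)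
    _ = c⁻¹ * ((C * N : ℝ≥0∞) ^ P * ∑ k ∈ Finset.range N, ∫⁻ w : Ambient d,
          ∫⁻ u in {u : Base d | ‖u - horiz w‖ ≤ ρ}, W' (w + ((k : ℝ) / n) • v u) ^ P) := by
        have hin : ∀ w : Ambient d, ∫⁻ u in {u : Base d | ‖u - horiz w‖ ≤ ρ}, (C * N : ℝ≥0∞) ^ P *
            ∑ k ∈ Finset.range N, W' (w + ((k : ℝ) / n) • v u) ^ P =
            (C * N : ℝ≥0∞) ^ P * ∑ k ∈ Finset.range N,
              ∫⁻ u in {u : Base d | ‖u - horiz w‖ ≤ ρ}, W' (w + ((k : ℝ) / n) • v u) ^ P := by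
          intro w
          rw [lintegral_const_mul' _ _ hcP, lintegral_finsetSum]
          exact fun k _ => hW'm.comp
            (continuous_const.add (hvc.const_smul ((k : ℝ) / n))).measurable
        simp only [hin]
        rw [lintegral_const_mul' _ _ (ENNReal.inv_ne_top.2 hc0), lintegral_const_mul' _ _ hcP,
          lintegral_finsetSum]
        intro k _
        refine (congrArg Measurable (funext fun w => ?_)).mp
          ((hterm k).lintegral_prod_right' (ν := (volume : Measure (Base d))))
        have hB : MeasurableSet {u : Base d | ‖u - horiz w‖ ≤ ρ} :=
          (isClosed_le (continuous_id.sub continuous_const).norm continuous_const).measurableSet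
        rw [← lintegral_indicator hB]
        rfl
    -- The ball of radius `t b` in the base has volume `(b t) ^ d` times `V`, which cancels the
    -- normalisation of the average over `u`.
    _ = c⁻¹ * ((C * N : ℝ≥0∞) ^ P * ∑ k ∈ Finset.range N, c * V * ∫⁻ ξ in Ω, W ξ ^ P) := by
        congr 2
        refine Finset.sum_congr rfl fun k _ => ?_
        have := lintegral_lintegral_add_tangentVec G.contDiff_g j hW'm ((k : ℝ) / n * s) hρ0.le
        rw [hint, hV, show ρ = G.b * t from mul_comm _ _] at this
        rw [← this, show ρ = G.b * t from mul_comm _ _]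
        simp only [hv, smul_smul]
    _ = (c⁻¹ * c) * ((C * N : ℝ≥0∞) ^ P * (N * V) * ∫⁻ ξ in Ω, W ξ ^ P) := by
        rw [Finset.sum_const, Finset.card_range, nsmul_eq_mul]
        ring
    _ = _ := by
        rw [ENNReal.inv_mul_cancel hc0 hct, one_mul]
        push_cast
        rfl

end SpecialDomain

end Tangential

/-! ### Choice of constants and conclusion -/

section Main

variable {d : ℕ} {Ω : Set (Ambient d)}

lemma IsCompactC2Domain.isCompact (hΩ : IsCompactC2Domain Ω) : IsCompact Ω := by
  obtain ⟨Ω₀, -, -, hb, rfl⟩ := hΩ.exists_open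
  exact hb.isCompact_closure

lemma InLp.aemeasurable {p : ℝ≥0∞} {f : Ambient d → ℝ} (hf : InLp p Ω f) (hΩ : IsCompact Ω) :
    AEMeasurable f (volume.restrict Ω) := by
  unfold InLp at hf
  split_ifs at hf
  · exact hf.aemeasurable hΩ.measurableSet
  · exact hf.1.aemeasurable

/-- The local averages have a pointwise majorant with the same norm that is measurable if
`p < ∞`. -/
lemma exists_majorant_localAverage (hΩ : IsCompact Ω) {r : ℕ} (hr : 1 ≤ r) (p : ℝ≥0∞) {q : ℝ≥0∞}
    (hq : q ≠ ∞) {f : Ambient d → ℝ} (hf : AEMeasurable f (volume.restrict Ω)) (t : ℝ) :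
    ∃ W : Ambient d → ℝ≥0∞, (p ≠ ∞ → Measurable W) ∧ (∀ ξ, localAverage r q Ω f ξ t ≤ W ξ) ∧
      lpQuasiNorm p Ω W = ivanovModulus r p q Ω f t := by
  by_cases hp : p = ∞
  · exact ⟨fun ξ => localAverage r q Ω f ξ t, fun h => absurd hp h, fun ξ => le_rfl, rfl⟩
  · obtain ⟨W, hW, hle, hae⟩ := exists_measurable_ge_ae_eq
      (aemeasurable_localAverage hΩ.isClosed hr hq hf t)
    refine ⟨W, fun _ => hW, hle, ?_⟩
    simp only [ivanovModulus, lpQuasiNorm, if_neg hp]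
    congr 1
    refine lintegral_congr_ae ?_
    filter_upwards [hae] with ξ hξ
    rw [hξ]

/-- The comparison of the moduli for `q < ∞`. -/
lemma exists_newModulus_le (hΩ : IsCompact Ω) {m : ℕ} {G : Fin m → SpecialDomain d}
    (hG : IsAttachedCover G Ω) {r : ℕ} (hr : 1 ≤ r) :
    ∃ c₀ : ℝ, 1 < c₀ ∧ ∀ A₀ : ℝ, ∀ p q : ℝ≥0∞, p ≠ 0 → q ≠ 0 → q ≠ ∞ →
      ∃ C : ℝ≥0, ∀ f : Ambient d → ℝ, AEMeasurable f (volume.restrict Ω) → ∀ t : ℝ, 0 < t → t ≤ 1 →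
        newModulus r p Ω G A₀ f t ≤ C * ivanovModulus r p q Ω f (c₀ * t) := by
  obtain ⟨R, M, K, hR, hM, hK, hch⟩ := exists_hasUniformCharts hΩ hG
  obtain ⟨κ₁, hκ₁, hdir⟩ := exists_rhoDist_le_of_directional hΩ hR hM hK hch hr
  choose κ₂ hκ₂ htan using fun i => (G i).exists_rhoDist_le_of_tangential hΩ (hG.attached i) hr
  -- One `κ` for all kinds of segments, fixed before `t₀`; the numbers of pieces are chosen after
  -- `t₀`.
  set κ := κ₁ + ∑ i, κ₂ i with hκ
  have hsum : 0 ≤ ∑ i, κ₂ i := Finset.sum_nonneg fun i _ => (hκ₂ i).le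
  have hκ1 : κ₁ ≤ κ := by linarith
  have hκ2 : ∀ i, κ₂ i ≤ κ := fun i => by
    have := Finset.single_le_sum (f := κ₂) (fun i _ => (hκ₂ i).le) (Finset.mem_univ i)
    linarith
  obtain ⟨t₀, ht₀, ht₀1, lam₀, hlam₀, hsub⟩ := exists_enorm_diffSum_le_of_subdivision hΩ hR hM hK
    hch hr (show 0 < κ by linarith)
  obtain ⟨n₁, hn₁, hdir⟩ := hdir t₀ ht₀ ht₀1
  choose n₂ hn₂ htan using fun i => htan i t₀ ht₀ ht₀1
  -- The pointwise bound is applied at scale `t₀ * t`, so that all `t ≤ 1` are admissible, and c₀ =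
  -- `lam * t₀`. The second entry makes it at least 2.
  set lam := max lam₀ (2 / t₀) with hlam
  refine ⟨lam * t₀, ?_, fun A₀ p q hp hq0 hq => ?_⟩
  · have : 2 / t₀ * t₀ ≤ lam * t₀ := mul_le_mul_of_nonneg_right (le_max_right _ _) ht₀.le
    rw [div_mul_cancel₀ _ ht₀.ne'] at this
    linarith
  obtain ⟨C₁, hC₁⟩ := hsub lam (le_max_left _ _) q hq0 hq n₁ hn₁
  choose C₂ hC₂ using fun i => hsub lam (le_max_left _ _) q hq0 hq (n₂ i) (hn₂ i)
  set V : ℝ≥0 := (volume (Metric.ball (0 : Base d) 1)).toNNReal with hV'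
  have hV : volume (Metric.ball (0 : Base d) 1) = V :=
    (ENNReal.coe_toNNReal measure_ball_lt_top.ne).symm
  refine ⟨C₁ * ((r * n₁ + 1 : ℕ) : ℝ≥0) * (3 * ((r * n₁ + 1 : ℕ) : ℝ≥0)) ^ (1 / p.toReal) +
    ∑ i, C₂ i * ((r * n₂ i + 1 : ℕ) : ℝ≥0) * (((r * n₂ i + 1 : ℕ) : ℝ≥0) * V) ^ (1 / p.toReal),
    fun f hf t ht ht1 => ?_⟩
  obtain ⟨W, hWm, hle, hnorm⟩ := exists_majorant_localAverage hΩ hr p hq hf (lam * t₀ * t)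
  have ht' : 0 < t₀ * t := mul_pos ht₀ ht
  have ht'1 : t₀ * t ≤ t₀ := mul_le_of_le_one_right ht₀.le ht1
  rw [← hnorm, ENNReal.coe_add, add_mul, ENNReal.ofNNReal_finsetSum, Finset.sum_mul]
  refine add_le_add (iSup_le fun j => ?_) (Finset.sum_le_sum fun i _ => ?_)
  · refine directionalModulus_le hΩ hr hn₁ (κ := κ * (t₀ * t)) hp hWm (fun z h hz => ?_)
      (fun h hh ξ hξ a ha hs α β h1 h2 h3 => ?_) j
    · refine (hC₁ f hf (t₀ * t) ht' ht'1 z h hz).trans ?_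
      refine mul_le_mul' le_rfl (Finset.sum_le_sum fun k _ => ?_)
      rw [← mul_assoc]
      exact hle _
    · exact (hdir t ht ht1 h hh ξ hξ a ha hs α β h1 h2 h3).trans
        (mul_le_mul_of_nonneg_right hκ1 ht'.le)
  · refine (G i).tangentialModulus_le hΩ (hn₂ i) (κ := κ * (t₀ * t)) ht ht1 hV hp hWm
      (fun z h hz => ?_) (fun s hs hst c hc u hu hun j v hv α β h1 h2 h3 h4 h5 h6 => ?_) A₀
    · refine (hC₂ i f hf (t₀ * t) ht' ht'1 z h hz).trans ?_
      refine mul_le_mul' le_rfl (Finset.sum_le_sum fun k _ => ?_)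
      rw [← mul_assoc]
      exact hle _
    · exact (htan i t ht ht1 s hs hst c hc u hu hun j v hv α β h1 h2 h3 h4 h5 h6).trans
        (mul_le_mul_of_nonneg_right (hκ2 i) ht'.le)

end Main

theorem mainTheorem5 {d : ℕ} (hd : 1 ≤ d) (Ω : Set (Ambient d)) (hΩ : IsCompactC2Domain Ω)
    {m : ℕ} (G : Fin m → SpecialDomain d) (hG : IsAttachedCover G Ω) (r : ℕ) (hr : 1 ≤ r) :
    ∃ c₀ : ℝ, 1 < c₀ ∧ ∀ A₀ : ℝ, 1 < A₀ → ∀ p q : ℝ≥0∞, 0 < q → q ≤ p →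
      ∃ C : ℝ≥0, ∀ f : Ambient d → ℝ, InLp p Ω f → ∀ t : ℝ, 0 < t → t ≤ 1 →
        newModulus r p Ω G A₀ f t ≤ C * ivanovModulus r p q Ω f (c₀ * t) := by
  have hcomp := hΩ.isCompact
  obtain ⟨c₀, hc₀, H⟩ := exists_newModulus_le hcomp hG hr
  refine ⟨c₀, hc₀, fun A₀ _ p q hq hqp => ?_⟩
  have hp : p ≠ 0 := (hq.trans_le hqp).ne'
  -- Here `p = ∞` as well; the case q = 1 suffices because an average does not exceed the supremum.
  by_cases hqt : q = ∞
  · subst hqt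
    obtain rfl : p = ∞ := top_le_iff.1 hqp
    obtain ⟨C, hC⟩ := H A₀ ∞ 1 hp one_ne_zero ENNReal.one_ne_top
    refine ⟨C, fun f hf t ht ht1 => (hC f (hf.aemeasurable hcomp) t ht ht1).trans ?_⟩
    refine mul_le_mul' le_rfl ?_
    simp only [ivanovModulus, lpQuasiNorm, if_true]
    exact iSup₂_mono fun ξ _ => localAverage_one_le hcomp.isClosed r f ξ _
  · obtain ⟨C, hC⟩ := H A₀ p q hp hq.ne' hqt
    exact ⟨C, fun f hf t ht ht1 => hC f (hf.aemeasurable hcomp) t ht ht1⟩
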